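/- Let $k$ be an algebraically closed field of any characteristic, let $X \subset \mathbb{P}^N$ be a projective variety over $k$ (closed and irreducible), put $n = \dim X$, and let $m$ be an integer with $n \leq m < N$. Let $X^{sm}$ be the smooth locus of $X$, let $\mathbb{T}_xX \subset \mathbb{P}^N$ be the embedded tangent space of $X$ at $x \in X^{sm}$, and let $\mathbb{G}(m,\mathbb{P}^N)$ be the Grassmann variety of $m$-planes in $\mathbb{P}^N$. Let $$P_m^X := \overline{\{(L,x) \in \mathbb{G}(m,\mathbb{P}^N) \times X^{sm} \mid \mathbb{T}_xX \subset L\}} \subset \mathbb{G}(m,\mathbb{P}^N) \times \mathbb{P}^N,$$ let the $m$-th Gauss map $\gamma_m : P_m^X \to \mathbb{G}(m,\mathbb{P}^N)$ be the first projection, and let $X_m^* := \gamma_m(P_m^X)$ be the set of tangent $m$-planes. Assume that $\gamma_m$ is separable, that is, that the function field of $P_m^X$ is a separable (equivalently, separably generated) extension of the function field of $X_m^*$. Then for a general tangent $m$-plane $L$, i.e. for every $L$ in some nonempty Zariski open subset of $X_m^*$, the contact locus of $L$ on $X$, $$\overline{\{x \in X^{sm} \mid \mathbb{T}_xX \subset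 L\}},$$ is a (nonempty) linear subvariety of $\mathbb{P}^N$. -/

import Mathlib

open MvPolynomial

noncomputable section

namespace GaussMap

/-! ### Multi-projective coordinates

A space `Z` is given homogeneous coordinates indexed by `σ` by a map `reps : Z → Set (σ → k)`, sending
a point to the set of all its coordinate vectors, and by a weight `w` on `σ` that gives the
multi-grading of the polynomial ring. -/

section Coordinates

variable {k : Type*} [Field k] {Z σ M : Type*} [AddCommMonoid M]

/-- The Zariski topology: it is generated by the complements of the zero loci of
multihomogeneous polynomials in the coordinates. -/
@[reducible] def zariskiTopology (reps : Z → Set (σ → k)) (w : σ → M) : TopologicalSpace Z :=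
  TopologicalSpace.generateFrom
    {U | ∃ (F : MvPolynomial σ k) (d : M), IsWeightedHomogeneous w F d ∧
      U = {z | ∀ v ∈ reps z, eval v F ≠ 0}}

/-- The ideal of all polynomials that vanish on (all coordinate vectors of) a set of points. -/
def idealOf (reps : Z → Set (σ → k)) (S : Set Z) : Ideal (MvPolynomial σ k) :=
  vanishingIdeal k (⋃ z ∈ S, reps z)

/-- The class of the coordinate `i` in the fraction field of the coordinate ring of `I`. -/
def coord (I : Ideal (MvPolynomial σ k)) (i : σ) : FractionRing (MvPolynomial σ k ⧸ I) :=
  algebraMap (MvPolynomial σ k ⧸ I) _ (Ideal.Quotient.mk I (X i))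

/-- The subfield, generated over `k` by the quotients of coordinates `x_i / x_j` with `r i j`, of the
fraction field of the coordinate ring. When `r i j` says that `i` and `j` belong to the same factor of
a product of projective spaces, this is the function field of the variety with ideal `I` (every
quotient of two multihomogeneous polynomials of the same multidegree is a rational function of
these quotients). -/
def ratioField (I : Ideal (MvPolynomial σ k)) [I.IsPrime] (r : σ → σ → Prop) :
    IntermediateField k (FractionRing (MvPolynomial σ k ⧸ I)) :=
  IntermediateField.adjoin k {f | ∃ i j, r i j ∧ f = coord I i / coord I j}

lemma ratioField_mono (I : Ideal (MvPolynomial σ k)) [I.IsPrime] {r s : σ → σ → Prop}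
    (h : ∀ i j, r i j → s i j) : ratioField I r ≤ ratioField I s := by
  apply IntermediateField.adjoin.mono
  rintro f ⟨i, j, hij, rfl⟩
  exact ⟨i, j, h i j hij, rfl⟩

end Coordinates

/-- `L / K` is separably generated: `L` is separable algebraic over `K(s)` for some transcendence
basis `s`. For finitely generated `L / K` this is separability of the extension. -/
def SeparablyGenerated (K L : Type*) [Field K] [Field L] [Algebra K L] : Prop :=
  ∃ s : Set L, IsTranscendenceBasis K ((↑) : s → L) ∧
    Algebra.IsSeparable (IntermediateField.adjoin K s) L

/-! ### Projective space, Grassmannians and their product -/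

section Spaces

variable (k : Type*) [Field k] (N m : ℕ)

/-- Projective space `ℙ^N`. -/
abbrev PSpace : Type _ := Projectivization k (Fin (N + 1) → k)

/-- The Grassmannian `𝔾(m, ℙ^N)` of `m`-planes, as the set of `(m+1)`-dimensional linear subspaces of
`k^(N+1)`. -/
def Gr : Type _ := {L : Submodule k (Fin (N + 1) → k) // Module.finrank k L = m + 1}

/-- The product `𝔾(m, ℙ^N) × ℙ^N` (a structure of its own, since its topology is not the product
topology). -/
structure GrProd where
  /-- the `m`-plane -/
  plane : Gr k N m
  /-- the point -/
  point : PSpace k N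

/-- Index set of the Plücker coordinates: increasing sequences `j_0 < ... < j_m` in `{0, ..., N}`. -/
abbrev PluckerIdx : Type := Fin (m + 1) ↪o Fin (N + 1)

variable {k N m}

/-- The vectors of homogeneous coordinates of a point of `ℙ^N`. -/
def pointReps (x : PSpace k N) : Set (Fin (N + 1) → k) :=
  {v | ∃ hv : v ≠ 0, Projectivization.mk k v hv = x}

/-- The maximal minors of an `(m+1) × (N+1)` matrix. -/
def plucker (v : Fin (m + 1) → Fin (N + 1) → k) : PluckerIdx N m → k :=
  fun J => Matrix.det (Matrix.of fun a b => v a (J b))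

/-- The vectors of Plücker coordinates of an `m`-plane: the maximal minors of its bases. -/
def planeReps (L : Gr k N m) : Set (PluckerIdx N m → k) :=
  {p | ∃ v : Fin (m + 1) → Fin (N + 1) → k,
    Submodule.span k (Set.range v) = L.1 ∧ p = plucker v}

/-- The vectors of bihomogeneous coordinates of a point of `𝔾(m, ℙ^N) × ℙ^N`. -/
def prodReps (z : GrProd k N m) : Set (PluckerIdx N m ⊕ Fin (N + 1) → k) :=
  {q | ∃ p ∈ planeReps z.plane, ∃ v ∈ pointReps z.point, q = Sum.elim p v}

instance : TopologicalSpace (PSpace k N) := zariskiTopology pointReps fun _ => (1 : ℕ)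

instance : TopologicalSpace (Gr k N m) := zariskiTopology planeReps fun _ => (1 : ℕ)

instance : TopologicalSpace (GrProd k N m) :=
  zariskiTopology prodReps (Sum.elim (fun _ => ((1, 0) : ℕ × ℕ)) fun _ => (0, 1))

end Spaces

/-! ### Varieties in `ℙ^N`, tangent spaces, Gauss maps and contact loci -/

section Varieties

variable {k : Type*} [Field k] {N : ℕ}

/-- The homogeneous ideal `I(X)` of a subset of `ℙ^N`. -/
abbrev homIdeal (X : Set (PSpace k N)) : Ideal (MvPolynomial (Fin (N + 1)) k) :=
  idealOf pointReps X

/-- The function field of an irreducible closed subset of `ℙ^N`. -/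
abbrev functionField (X : Set (PSpace k N)) [(homIdeal X).IsPrime] :
    IntermediateField k (FractionRing (MvPolynomial (Fin (N + 1)) k ⧸ homIdeal X)) :=
  ratioField (homIdeal X) fun _ _ => True

/-- The differential at `v` of a polynomial `F`, a linear form on `k^(N+1)`. -/
def differential (F : MvPolynomial (Fin (N + 1)) k) (v : Fin (N + 1) → k) :
    (Fin (N + 1) → k) →ₗ[k] k :=
  ∑ i, eval v (pderiv i F) • LinearMap.proj i

/-- The embedded tangent space of `X` at `x`, as a linear subspace of `k^(N+1)`: the common zeros of
the differentials of the polynomials in `I(X)` (the choice of coordinates of `x` is immaterial). -/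
def tangentSpace (X : Set (PSpace k N)) (x : PSpace k N) : Submodule k (Fin (N + 1) → k) :=
  ⨅ F ∈ homIdeal X, LinearMap.ker (differential F x.rep)

/-- The smooth locus of an `n`-dimensional `X`: the points whose embedded tangent space has
projective dimension `n`. -/
def smoothLocus (X : Set (PSpace k N)) (n : ℕ) : Set (PSpace k N) :=
  {x | x ∈ X ∧ Module.finrank k (tangentSpace X x) = n + 1}

/-- The variety `P_m^X`: the closure of the set of `(L, x)` with `x` a smooth point of `X` and
`𝕋_x X ⊆ L`. -/
def conormal (X : Set (PSpace k N)) (n m : ℕ) : Set (GrProd k N m) :=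
  closure {z | z.point ∈ smoothLocus X n ∧ tangentSpace X z.point ≤ z.plane.1}

/-- The set `X_m^*` of tangent `m`-planes: the image of the `m`-th Gauss map `γ_m`, the first
projection of `P_m^X`. -/
def tangentPlanes (X : Set (PSpace k N)) (n m : ℕ) : Set (Gr k N m) :=
  GrProd.plane '' conormal X n m

/-- The contact locus on `X` of an `m`-plane `L`: the closure of the set of smooth points of `X` at
which `L` is tangent to `X`. -/
def contactLocus (X : Set (PSpace k N)) (n : ℕ) {m : ℕ} (L : Gr k N m) : Set (PSpace k N) :=
  closure {x | x ∈ smoothLocus X n ∧ tangentSpace X x ≤ L.1}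

/-- Both coordinates belong to the first factor. -/
def BothPlane {α β : Type*} : α ⊕ β → α ⊕ β → Prop
  | .inl _, .inl _ => True
  | _, _ => False

/-- The coordinates belong to the same factor. -/
def SameFactor {α β : Type*} : α ⊕ β → α ⊕ β → Prop
  | .inl _, .inl _ => True
  | .inr _, .inr _ => True
  | _, _ => False

lemma BothPlane.sameFactor {α β : Type*} : ∀ i j : α ⊕ β, BothPlane i j → SameFactor i j
  | .inl _, .inl _, _ => trivial

/-- The first projection from a subvariety `S` of `𝔾(m, ℙ^N) × ℙ^N` onto its image is a separable map
of varieties: `S` is irreducible, and its function field is separably generated over the function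
field of the image. The latter, as a subfield of the former by pullback of rational functions, is
generated by the quotients of the Plücker coordinates. -/
def IsSeparableFst {m : ℕ} (S : Set (GrProd k N m)) : Prop :=
  ∃ _ : (idealOf prodReps S).IsPrime,
    SeparablyGenerated (ratioField (idealOf prodReps S) BothPlane)
      (IntermediateField.extendScalars
        (ratioField_mono (idealOf prodReps S) BothPlane.sameFactor))

end Varieties

end GaussMap

end

/-!
# Linearity of general contact loci

Let `K_Y ⊆ K_W` be the function fields of `X_m^*` and of `P_m^X`, and let `x_l ∈ K_W` be the affine
coordinates of the point component of the generic point of `P_m^X`, with `x_{l₀} = 1`. They generate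
`K_W` over `K_Y`. The theorem says that they satisfy only linear relations over `K_Y`: a maximal
`K_Y`-linearly independent set of coordinates that contains `x_{l₀}` is, `x_{l₀}` left out,
algebraically independent. Once this is known, clearing denominators
(`exists_linearFamily`) and spreading out (`JacobianChart.exists_isOpen_contactLocus_eq`) show that
the contact locus of a general tangent plane is a linear space.

Since `K_W / K_Y` is separably generated, its transcendence degree is the dimension of the space of
its derivations, so that it suffices to find enough derivations: every `K_Y`-linear functional
`φ : K_W → K_Y` with `φ(1) = 0` should agree on the `x_l` with a `K_Y`-derivation
(`algebraicIndependent_of_derivations`). This is `JacobianChart.exists_derivation_eq_functional`, a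
form of the duality between a variety and its tangent planes that holds in all characteristics:

* The plane of the generic point is the common zero space of linear forms `c` with coefficients in
  `K_Y`. By separability each derivation `D` of `K_Y` extends to `K_W`, and the vector `D x` is
  tangent to `X`, hence `c · D x = 0`; differentiating `c · x = 0` gives `D c · x = 0`. The last
  relation being `K_Y`-linear in `x`, it holds for `η = φ(x)` too: `D c · η = 0`
  (`sum_derivation_mul_functional`).
* In a chart of `P_m^X`, the plane consists of the graph `B` of the tangent space of `X`, whose
  entries are functions on `X`, and of free parameters `a`. Taking for `D` the derivatives with
  respect to the parameters shows that `η` is tangent to `X`.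
* Let `∂_i` be the derivations of the function field of the cone of `X` along the basis of the tangent
  space given by the chart. They commute, and so the matrix `B` satisfies the symmetry
  `∂_i B_{l i'} = ∂_{i'} B_{l i}` (`JacobianChart.exists_derivation_pivot`). Thus the derivation
  `∑ η_i ∂_i`, which maps `x` to `η`, takes on the coefficients of `c` values that are the
  combinations `∂_i c · η = 0`: it kills `K_Y`.

The chart is made from a nonvanishing Jacobian minor `h` (`exists_jacobianChart`); the point with
generic parameters in the chart is a generic point of `P_m^X`
(`JacobianChart.aeval_chartPoint_eq_zero_iff`). The field `k` being perfect, the generic tangent space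
has the dimension of the cone of `X` (`IsGenericPoint.finrank_tangentAt`), so that the points with
`h ≠ 0` are smooth.
-/

noncomputable section

namespace GaussMap

/-! ### Derivations and separably generated field extensions -/

section Derivations

open TensorProduct KaehlerDifferential

/-- Derivations extend along formally smooth extensions of fields. -/
lemma exists_derivation_extend {k K L M : Type*} [CommRing k] [Field K] [Field L] [Algebra k K]
    [Algebra k L] [Algebra K L] [IsScalarTower k K L] [Algebra.FormallySmooth K L]
    [AddCommGroup M] [Module L M] [Module K M] [Module k M] [IsScalarTower K L M]
    [IsScalarTower k K M] [IsScalarTower k L M]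
    (d : Derivation k K M) :
    ∃ D : Derivation k L M, ∀ x, D (algebraMap K L x) = d x := by
  have hinj : Function.Injective (mapBaseChange k K L) := by
    rw [injective_iff_map_eq_zero]
    intro x hx
    obtain ⟨x, rfl⟩ := (Algebra.H1Cotangent.exact_δ_mapBaseChange k K L x).mp hx
    rw [Subsingleton.elim x 0, map_zero]
  obtain ⟨g, hg⟩ := LinearMap.exists_leftInverse_of_injective (mapBaseChange k K L)
    (LinearMap.ker_eq_bot.2 hinj)
  let φ : L ⊗[K] Ω[K⁄k] →ₗ[L] M := LinearMap.liftBaseChange L d.liftKaehlerDifferential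
  refine ⟨(φ ∘ₗ g).compDer (KaehlerDifferential.D k L), fun x => ?_⟩
  have h1 : mapBaseChange k K L (1 ⊗ₜ KaehlerDifferential.D k K x) =
      KaehlerDifferential.D k L (algebraMap K L x) := by simp
  have h2 := congrArg (fun f => f (1 ⊗ₜ KaehlerDifferential.D k K x)) hg
  simp only [LinearMap.comp_apply, LinearMap.id_apply] at h2
  change φ (g (KaehlerDifferential.D k L (algebraMap K L x))) = d x
  rw [← h1, h2]
  simp [φ]

/-- Derivations extend along formally étale ring homomorphisms. -/
lemma exists_derivation_extend_of_formallyEtale {k A B M : Type*} [CommRing k] [CommRing A]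
    [CommRing B] [Algebra k A] [Algebra k B] [Algebra A B] [IsScalarTower k A B]
    [Algebra.FormallyEtale A B]
    [AddCommGroup M] [Module B M] [Module A M] [Module k M] [IsScalarTower A B M]
    [IsScalarTower k A M] [IsScalarTower k B M]
    (d : Derivation k A M) :
    ∃ D : Derivation k B M, ∀ x, D (algebraMap A B x) = d x := by
  let φ : B ⊗[A] Ω[A⁄k] →ₗ[B] M := LinearMap.liftBaseChange B d.liftKaehlerDifferential
  refine ⟨(φ ∘ₗ (tensorKaehlerEquivOfFormallyEtale k A B).symm.toLinearMap).compDer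
    (KaehlerDifferential.D k B), fun x => ?_⟩
  have h2 := tensorKaehlerEquivOfFormallyEtale_symm_D_algebraMap k A B x
  change φ ((tensorKaehlerEquivOfFormallyEtale k A B).symm
    (KaehlerDifferential.D k B (algebraMap A B x))) = d x
  rw [h2]
  simp [φ]

/-- A derivation on a formally unramified algebra that vanishes on the base vanishes. -/
lemma derivation_eq_zero_of_formallyUnramified {k A B M : Type*} [CommRing k] [CommRing A]
    [CommRing B] [Algebra k A] [Algebra k B] [Algebra A B] [IsScalarTower k A B]
    [Algebra.FormallyUnramified A B]
    [AddCommGroup M] [Module B M] [Module A M] [Module k M] [IsScalarTower A B M]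
    [IsScalarTower k A M] [IsScalarTower k B M]
    (D : Derivation k B M) (h : ∀ x, D (algebraMap A B x) = 0) : D = 0 := by
  let D' : Derivation A B M :=
    { toFun := D
      map_add' := D.map_add
      map_smul' := fun a b => by
        simp [Algebra.smul_def, h]
      map_one_eq_zero' := D.map_one_eq_zero
      leibniz' := D.leibniz }
  have h1 : D' = 0 := by
    rw [← D'.liftKaehlerDifferential_comp]
    ext b
    have : KaehlerDifferential.D A B b = 0 := Subsingleton.elim _ _
    simp [this]
  ext b
  exact congrArg (fun E : Derivation A B M => E b) h1

lemma derivation_sum_apply {R A M ι : Type*} [CommSemiring R] [CommSemiring A] [AddCommMonoid M]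
    [Algebra R A] [Module A M] [Module R M] (s : Finset ι) (D : ι → Derivation R A M) (a : A) :
    (∑ i ∈ s, D i) a = ∑ i ∈ s, D i a := by
  have := map_sum (Derivation.coeFnAddMonoidHom (R := R) (A := A) (M := M)) D s
  have h := congrFun this a
  rwa [Finset.sum_apply] at h

section SepGen

variable {K L σ M : Type*} [Field K] [Field L] [Algebra K L] {v : σ → L}
  [AddCommGroup M] [Module L M] [Module K M] [IsScalarTower K L M]

lemma formallyEtale_aeval (hv : AlgebraicIndependent K v)
    (hsep : Algebra.IsSeparable (IntermediateField.adjoin K (Set.range v)) L) :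
    letI : Algebra (MvPolynomial σ K) L := (aeval v).toAlgebra
    Algebra.FormallyEtale (MvPolynomial σ K) L := by
  let _ : Algebra (MvPolynomial σ K) L := (aeval v).toAlgebra
  let A := Algebra.adjoin K (Set.range v)
  let e : MvPolynomial σ K ≃ₐ[K] A := hv.aevalEquiv
  let _ : Algebra (MvPolynomial σ K) A := e.toRingHom.toAlgebra
  have : IsScalarTower (MvPolynomial σ K) A L := IsScalarTower.of_algebraMap_eq fun p => by
    change aeval v p = (e p : L)
    exact (hv.algebraMap_aevalEquiv p).symm
  have : Algebra.FormallyEtale (MvPolynomial σ K) A := by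
    have : Algebra.FormallyEtale (MvPolynomial σ K) (MvPolynomial σ K) := inferInstance
    let e' : MvPolynomial σ K ≃ₐ[MvPolynomial σ K] A :=
      { e with commutes' := fun _ => rfl }
    exact .of_equiv e'
  open scoped IntermediateField.algebraAdjoinAdjoin in
  have : Algebra.FormallyEtale A L := by
    have : Algebra.FormallyEtale A (IntermediateField.adjoin K (Set.range v)) :=
      .of_isLocalization (nonZeroDivisors A)
    have : Algebra.FormallyEtale (IntermediateField.adjoin K (Set.range v)) L :=
      Algebra.FormallyEtale.of_isSeparable _ L
    exact .comp _ (IntermediateField.adjoin K (Set.range v)) _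
  exact .comp _ A _

/-- On a separably generated extension, derivations over the base field can be prescribed on the
separating transcendence basis. -/
lemma exists_derivation_of_sepGen (hv : AlgebraicIndependent K v)
    (hsep : Algebra.IsSeparable (IntermediateField.adjoin K (Set.range v)) L) (f : σ → M) :
    ∃ D : Derivation K L M, ∀ i, D (v i) = f i := by
  let _ : Algebra (MvPolynomial σ K) L := (aeval v).toAlgebra
  have := formallyEtale_aeval hv hsep
  let _ : Module (MvPolynomial σ K) M := Module.compHom M (algebraMap (MvPolynomial σ K) L)
  have : IsScalarTower (MvPolynomial σ K) L M := ⟨fun a b c => by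
    rw [Algebra.smul_def, mul_smul]; rfl⟩
  have : IsScalarTower K (MvPolynomial σ K) L :=
    IsScalarTower.of_algebraMap_eq fun p => (aeval v).commutes p |>.symm
  have : IsScalarTower K (MvPolynomial σ K) M := ⟨fun a b c => by
    change algebraMap (MvPolynomial σ K) L (a • b) • c = a • (algebraMap (MvPolynomial σ K) L b • c)
    rw [← smul_assoc, algebra_compatible_smul L a (algebraMap (MvPolynomial σ K) L b),
      Algebra.smul_def a b, map_mul, ← IsScalarTower.algebraMap_apply]
    simp [smul_eq_mul]⟩
  obtain ⟨D, hD⟩ := exists_derivation_extend_of_formallyEtale (B := L)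
    (mkDerivation K f : Derivation K (MvPolynomial σ K) M)
  refine ⟨D, fun i => ?_⟩
  have := hD (X i)
  rw [mkDerivation_X] at this
  rw [← this]
  congr 1
  exact (aeval_X v i).symm

/-- On a separably generated extension, a derivation over the base field is determined by its
values on the separating transcendence basis. -/
lemma derivation_eq_zero_of_sepGen
    (hsep : Algebra.IsSeparable (IntermediateField.adjoin K (Set.range v)) L)
    (D : Derivation K L M) (h : ∀ i, D (v i) = 0) : D = 0 := by
  have : Algebra.FormallyEtale (IntermediateField.adjoin K (Set.range v)) L :=
      Algebra.FormallyEtale.of_isSeparable _ L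
  have : IsScalarTower K (IntermediateField.adjoin K (Set.range v)) M := ⟨fun a b c => by
    change ((a • b : IntermediateField.adjoin K (Set.range v)) : L) • c = a • ((b : L) • c)
    rw [← smul_assoc]; rfl⟩
  have : IsScalarTower (IntermediateField.adjoin K (Set.range v)) L M := ⟨fun a b c => by
    change ((a : L) * b) • c = (a : L) • (b • c)
    rw [mul_smul]⟩
  refine derivation_eq_zero_of_formallyUnramified
    (A := IntermediateField.adjoin K (Set.range v)) D ?_
  rintro ⟨x, hx⟩
  change D x = 0
  induction hx using IntermediateField.adjoin_induction with
  | mem x hx => obtain ⟨i, rfl⟩ := hx; exact h i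
  | algebraMap x => simp
  | add x y _ _ hx hy => simp [hx, hy]
  | inv x _ hx => simp [Derivation.leibniz_inv, hx]
  | mul x y _ _ hx hy => simp [hx, hy]

end SepGen

end Derivations

universe u v

/-! ### Algebraic independence from derivations -/

/-- Let `L = K(x_l)` be separably generated over `K` with `x_{l₀} = 1`. If every `K`-linear functional
that kills `1` agrees on the `x_l` with a `K`-derivation, then `K`-linearly independent `x_l` (with
`x_{l₀}` among them, and spanning all of them) are algebraically independent, `x_{l₀}` left out:
the derivations show that the transcendence degree of `L / K` is at least their number. -/
lemma algebraicIndependent_of_derivations {K : Type*} {L : Type u} {Ω : Type*} {ι : Type v}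
    [Field K] [Field L] [Field Ω]
    [Algebra K L] [Algebra K Ω] [Algebra L Ω] [IsScalarTower K L Ω] [Finite ι]
    (hsep : SeparablyGenerated K L) (x : ι → L) (l₀ : ι) (hx₀ : x l₀ = 1)
    (htop : IntermediateField.adjoin K (Set.range x) = ⊤)
    (H : ∀ φ : L →ₗ[K] K, φ 1 = 0 →
      ∃ E : Derivation K L Ω, ∀ l, E (x l) = algebraMap K Ω (φ (x l)))
    (β : Set ι) (hβ₀ : l₀ ∈ β) (hβ : LinearIndepOn K x β)
    (hspan : ∀ l, x l ∈ Submodule.span K (x '' β)) :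
    AlgebraicIndependent K fun b : ↥(β \ {l₀}) => x b := by
  classical
  have := Fintype.ofFinite ↥(β \ {l₀})
  obtain ⟨S, hS, hSsep⟩ := hsep
  have hSsep' : Algebra.IsSeparable (IntermediateField.adjoin K
      (Set.range ((↑) : S → L))) L := by
    rw [Subtype.range_coe]; exact hSsep
  -- the derivations dual to the `x_b`
  have hE : ∀ b : ↥(β \ {l₀}), ∃ E : Derivation K L Ω, ∀ b' : ↥(β \ {l₀}),
      E (x b') = if b' = b then 1 else 0 := by
    intro b
    obtain ⟨φ, hφ⟩ := LinearMap.exists_extend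
      ((Finsupp.lapply (R := K) (⟨b, b.2.1⟩ : β)).comp hβ.repr)
    have hφ' : ∀ b' : β, φ (x b') = if (b' : ι) = b then 1 else 0 := by
      intro b'
      have hmem : x b' ∈ Submodule.span K (Set.range fun i : β => x i) :=
        Submodule.subset_span ⟨b', rfl⟩
      have h1 := congrArg (fun f => f ⟨x b', hmem⟩) hφ
      simp only [LinearMap.comp_apply, Submodule.subtype_apply, Finsupp.lapply_apply] at h1
      rw [h1, LinearIndependent.repr_eq_single hβ b' ⟨x b', hmem⟩ rfl]
      simp [Finsupp.single_apply, Subtype.ext_iff]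
    obtain ⟨E, hE⟩ := H φ (by
      rw [← hx₀, hφ' ⟨l₀, hβ₀⟩, if_neg]
      exact fun h => b.2.2 h.symm)
    refine ⟨E, fun b' => ?_⟩
    rw [hE, hφ' ⟨b', b'.2.1⟩]
    simp [Subtype.ext_iff, apply_ite]
  choose E hE using hE
  have hli : LinearIndependent Ω fun (b : ↥(β \ {l₀})) (s : S) => E b s := by
    rw [Fintype.linearIndependent_iff]
    intro g hg b
    have h0 : ∑ b, g b • E b = 0 := by
      refine derivation_eq_zero_of_sepGen hSsep' _ fun s => ?_
      have := congrFun hg s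
      simpa [Finset.sum_apply, derivation_sum_apply] using this
    have := congrArg (fun D : Derivation K L Ω => D (x b)) h0
    simpa [derivation_sum_apply, hE] using this
  have hcard : Cardinal.lift.{u} (Cardinal.mk ↥(β \ {l₀})) ≤
      Cardinal.lift.{v} (Cardinal.mk S) := by
    rcases finite_or_infinite S with hfin | hinf
    · have := Fintype.ofFinite S
      have h := hli.fintype_card_le_finrank
      rw [Module.finrank_fintype_fun_eq_card] at h
      rw [Cardinal.mk_fintype, Cardinal.mk_fintype]
      simpa using h
    · refine le_trans ?_ (Cardinal.lift_le.2 (Cardinal.aleph0_le_mk S))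
      rw [Cardinal.lift_aleph0]
      simp
  have htop' : IntermediateField.adjoin K (Set.range fun b : ↥(β \ {l₀}) => x b) = ⊤ := by
    rw [eq_top_iff, ← htop, IntermediateField.adjoin_le_iff]
    rintro _ ⟨l, rfl⟩
    have : Submodule.span K (x '' β) ≤ (IntermediateField.adjoin K
        (Set.range fun b : ↥(β \ {l₀}) => x b)).toSubalgebra.toSubmodule := by
      rw [Submodule.span_le]
      rintro _ ⟨b, hb, rfl⟩
      by_cases hb0 : b = l₀
      · rw [hb0, hx₀]; exact one_mem (IntermediateField.adjoin K _)
      · exact IntermediateField.subset_adjoin K _ ⟨⟨b, hb, hb0⟩, rfl⟩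
    exact this (hspan l)
  open scoped IntermediateField.algebraAdjoinAdjoin in
  have halg : Algebra.IsAlgebraic (Algebra.adjoin K (Set.range fun b : ↥(β \ {l₀}) => x b)) L := by
    have h1 : Algebra.IsAlgebraic (Algebra.adjoin K (Set.range fun b : ↥(β \ {l₀}) => x b))
      (IntermediateField.adjoin K (Set.range fun b : ↥(β \ {l₀}) => x b)) :=
      IsLocalization.isAlgebraic _ (nonZeroDivisors _)
    have h2 : Algebra.IsAlgebraic
      (IntermediateField.adjoin K (Set.range fun b : ↥(β \ {l₀}) => x b)) L := by
      rw [htop']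
      infer_instance
    exact Algebra.IsAlgebraic.trans _
      (IntermediateField.adjoin K (Set.range fun b : ↥(β \ {l₀}) => x b)) _
  refine (Algebra.IsAlgebraic.isTranscendenceBasis_of_lift_le_trdeg_of_finite K _ ?_).1
  rw [← hS.cardinalMk_eq_trdeg]
  exact hcard

/-! ### Homogeneous ideals and their points over an extension field -/

section Homogeneous

/-- A weighted homogeneous polynomial is an eigenvector of the torus acting through the weights. -/
lemma aeval_torus_smul {k E σ M : Type*} [CommSemiring k] [CommSemiring E] [Algebra k E]
    [AddCommMonoid M] {w : σ → M} {F : MvPolynomial σ k} {n : M}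
    (hF : IsWeightedHomogeneous w F n) (χ : Multiplicative M →* E) (ξ : σ → E) :
    aeval (fun i => χ (Multiplicative.ofAdd (w i)) * ξ i) F =
      χ (Multiplicative.ofAdd n) * aeval ξ F := by
  induction hF using IsWeightedHomogeneous.induction_on with
  | zero => simp
  | add p q _ _ hp hq => rw [map_add, map_add, hp, hq, mul_add]
  | monomial d r hd =>
    have h1 : χ (Multiplicative.ofAdd n) =
        d.prod fun i c => χ (Multiplicative.ofAdd (w i)) ^ c := by
      rw [← hd, Finsupp.weight_apply, Finsupp.sum, ofAdd_sum, map_prod]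
      exact Finset.prod_congr rfl fun i _ => by rw [ofAdd_nsmul, map_pow]
    simp only [aeval_monomial, mul_pow, Finsupp.prod_mul, h1]
    ring

lemma aeval_smul_of_isHomogeneous {k E σ : Type*} [CommSemiring k] [CommSemiring E] [Algebra k E]
    {F : MvPolynomial σ k} {n : ℕ} (hF : F.IsHomogeneous n) (c : E) (ξ : σ → E) :
    aeval (c • ξ) F = c ^ n * aeval ξ F := by
  have := aeval_torus_smul hF (powersHom E c) ξ
  simp only [powersHom_apply, toAdd_ofAdd, Pi.one_apply, pow_one] at this
  exact this

variable {k σ : Type*} [Field k]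

/-- The chain rule for a derivation applied to a polynomial expression. -/
lemma derivation_aeval {A M : Type*} [CommRing A] [Algebra k A] [AddCommGroup M] [Module A M]
    [Module k M] [IsScalarTower k A M] [Fintype σ] (D : Derivation k A M) (ξ : σ → A)
    (F : MvPolynomial σ k) :
    D (aeval ξ F) = ∑ i, aeval ξ (pderiv i F) • D (ξ i) := by
  classical
  induction F using MvPolynomial.induction_on with
  | C a => simp
  | add p q hp hq => simp [hp, hq, add_smul, Finset.sum_add_distrib]
  | mul_X p j hp =>
    simp only [map_mul, aeval_X, Derivation.leibniz, hp, smul_eq_mul, map_add, add_smul,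
      Finset.sum_add_distrib, Finset.smul_sum, pderiv_X, smul_smul]
    congr 1
    · rw [Finset.sum_eq_single j] <;> simp +contextual [eq_comm]

/-- The embedded tangent space, at a point with coordinates in an extension field, of the affine
scheme defined by an ideal. -/
def tangentAt [Fintype σ] {E : Type*} [Field E] [Algebra k E] (I : Ideal (MvPolynomial σ k))
    (ξ : σ → E) : Submodule E (σ → E) where
  carrier := {w | ∀ F ∈ I, ∑ i, aeval ξ (pderiv i F) * w i = 0}
  add_mem' := fun ha hb F hF => by
    simp [mul_add, Finset.sum_add_distrib, ha F hF, hb F hF]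
  zero_mem' := fun F _ => by simp
  smul_mem' := fun c w hw F hF => by
    simp only [Pi.smul_apply, smul_eq_mul, mul_left_comm _ c, ← Finset.mul_sum, hw F hF, mul_zero]

lemma mem_tangentAt [Fintype σ] {E : Type*} [Field E] [Algebra k E]
    {I : Ideal (MvPolynomial σ k)} {ξ w : σ → E} :
    w ∈ tangentAt I ξ ↔ ∀ F ∈ I, ∑ i, aeval ξ (pderiv i F) * w i = 0 := Iff.rfl

/-- The ideal is generated by homogeneous polynomials. -/
def IsHomog (I : Ideal (MvPolynomial σ k)) : Prop :=
  ∀ F ∈ I, ∀ d, homogeneousComponent d F ∈ I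

variable {I : Ideal (MvPolynomial σ k)}

lemma IsHomog.aeval_smul_eq_zero (hI : IsHomog I) {E : Type*} [CommRing E] [Algebra k E] {ξ : σ → E}
    (hξ : ∀ F ∈ I, aeval ξ F = 0) (c : E) {F : MvPolynomial σ k} (hF : F ∈ I) :
    aeval (c • ξ) F = 0 := by
  rw [← sum_homogeneousComponent F, map_sum]
  refine Finset.sum_eq_zero fun d _ => ?_
  rw [aeval_smul_of_isHomogeneous (homogeneousComponent_isHomogeneous d F), hξ _ (hI F hF d),
    mul_zero]

lemma pderiv_homogeneousComponent (i : σ) (d : ℕ) (F : MvPolynomial σ k) :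
    pderiv i (homogeneousComponent (d + 1) F) = homogeneousComponent d (pderiv i F) := by
  classical
  conv_rhs => rw [← sum_homogeneousComponent F, map_sum, map_sum]
  have h : ∀ n, homogeneousComponent d (pderiv i (homogeneousComponent n F)) =
      if n = d + 1 then pderiv i (homogeneousComponent (d + 1) F) else 0 := by
    intro n
    have h1 : (pderiv i (homogeneousComponent n F)).IsHomogeneous (n - 1) :=
      (homogeneousComponent_isHomogeneous n F).pderiv
    rw [homogeneousComponent_of_mem h1]
    rcases n with _ | n
    · simp
    · simp only [add_tsub_cancel_right, add_left_inj]
      split_ifs with h2 h3 h3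
      · rw [h2]
      · exact absurd h2.symm h3
      · exact absurd h3.symm h2
      · rfl
  simp only [h, Finset.sum_ite_eq', Finset.mem_range]
  split_ifs with h2
  · rfl
  · rw [homogeneousComponent_eq_zero _ _ (by omega), map_zero]

lemma IsHomog.tangentAt_smul_le [Fintype σ] (hI : IsHomog I) {E : Type*} [Field E] [Algebra k E]
    (ξ : σ → E) (c : E) : tangentAt I ξ ≤ tangentAt I (c • ξ) := by
  intro w hw F hF
  have key : ∀ i, aeval (c • ξ) (pderiv i F) = ∑ d ∈ Finset.range (F.totalDegree + 1),
      c ^ (d - 1) * aeval ξ (pderiv i (homogeneousComponent d F)) := by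
    intro i
    conv_lhs => rw [← sum_homogeneousComponent F, map_sum, map_sum]
    refine Finset.sum_congr rfl fun d _ => ?_
    exact aeval_smul_of_isHomogeneous (homogeneousComponent_isHomogeneous d F).pderiv c ξ
  simp only [key, Finset.sum_mul]
  rw [Finset.sum_comm]
  refine Finset.sum_eq_zero fun d _ => ?_
  simp only [mul_assoc, ← Finset.mul_sum]
  rw [hw _ (hI F hF d), mul_zero]

lemma IsHomog.tangentAt_smul [Fintype σ] (hI : IsHomog I) {E : Type*} [Field E] [Algebra k E]
    (ξ : σ → E) {c : E} (hc : c ≠ 0) : tangentAt I (c • ξ) = tangentAt I ξ := by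
  refine le_antisymm ?_ (hI.tangentAt_smul_le ξ c)
  have := hI.tangentAt_smul_le (c • ξ) c⁻¹
  rwa [smul_smul, inv_mul_cancel₀ hc, one_smul] at this

end Homogeneous

/-! ### Jacobian charts -/

section Jacobian

variable {k σ : Type*} [Field k] {I : Ideal (MvPolynomial σ k)} [I.IsPrime]

lemma aeval_coord (I : Ideal (MvPolynomial σ k)) [I.IsPrime] (F : MvPolynomial σ k) :
    aeval (coord I) F =
      algebraMap (MvPolynomial σ k ⧸ I) (FractionRing (MvPolynomial σ k ⧸ I))
        (Ideal.Quotient.mk I F) := by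
  have : aeval (coord I) = (IsScalarTower.toAlgHom k (MvPolynomial σ k ⧸ I)
      (FractionRing (MvPolynomial σ k ⧸ I))).comp (Ideal.Quotient.mkₐ k I) := by
    ext i
    simp [coord]
  rw [this]
  rfl

lemma aeval_coord_eq_zero_iff {F : MvPolynomial σ k} : aeval (coord I) F = 0 ↔ F ∈ I := by
  rw [aeval_coord, ← Ideal.Quotient.eq_zero_iff_mem]
  exact (FaithfulSMul.algebraMap_injective _ _).eq_iff' (map_zero _)

/-- A point with coordinates in an extension field `K` is a generic point of the affine variety of `I`
if exactly the elements of `I` vanish at it, and if its coordinates generate the field `K`. -/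
structure IsGenericPoint (I : Ideal (MvPolynomial σ k)) {K : Type*} [Field K] [Algebra k K]
    (ξ : σ → K) : Prop where
  aeval_eq_zero_iff : ∀ {F : MvPolynomial σ k}, aeval ξ F = 0 ↔ F ∈ I
  exists_div : ∀ z : K, ∃ a b : MvPolynomial σ k, b ∉ I ∧ aeval ξ b * z = aeval ξ a

lemma isGenericPoint_coord (I : Ideal (MvPolynomial σ k)) [I.IsPrime] :
    IsGenericPoint I (coord I) where
  aeval_eq_zero_iff := aeval_coord_eq_zero_iff
  exists_div := fun z => by
    obtain ⟨a, b, hb, rfl⟩ := IsFractionRing.div_surjective (A := MvPolynomial σ k ⧸ I) z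
    obtain ⟨a, rfl⟩ := Ideal.Quotient.mk_surjective a
    obtain ⟨b, rfl⟩ := Ideal.Quotient.mk_surjective b
    have hb' : b ∉ I := fun h => nonZeroDivisors.ne_zero hb (Ideal.Quotient.eq_zero_iff_mem.2 h)
    refine ⟨a, b, hb', ?_⟩
    rw [← aeval_coord, ← aeval_coord, mul_div_cancel₀]
    exact fun h => hb' (aeval_coord_eq_zero_iff.1 h)

variable {K : Type*} [Field K] [Algebra k K] {ξ : σ → K}

variable [Fintype σ] [DecidableEq σ]

/-- A chart of the generic tangent space of the cone of an ideal `I`, made of homogeneous polynomials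
of the same degree: at each point of the cone where the Jacobian minor `h` does not vanish, the
tangent space is the graph of the matrix `b / h`, the coordinates in `I₀` being free. The two last
fields say that the forms `h x_l - ∑ b_{li} x_i` are differentials of elements of `I`, and that they
generate all the differentials. -/
structure JacobianChart (I : Ideal (MvPolynomial σ k)) (I₀ : Finset σ) where
  /-- the degree -/
  deg : ℕ
  /-- the Jacobian minor -/
  h : MvPolynomial σ k
  /-- the numerators of the entries of the matrix whose graph is the tangent space -/
  b : σ → σ → MvPolynomial σ k
  h_notMem : h ∉ I
  h_homog : h.IsHomogeneous deg
  b_homog : ∀ l i, (b l i).IsHomogeneous deg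
  exists_mem : ∀ l ∉ I₀, ∃ F ∈ I, (∀ l' ∉ I₀, pderiv l' F - (if l' = l then h else 0) ∈ I) ∧
    ∀ i ∈ I₀, pderiv i F + b l i ∈ I
  generate : ∀ G ∈ I, ∀ i ∈ I₀, h * pderiv i G + ∑ l ∈ I₀ᶜ, b l i * pderiv l G ∈ I

omit [I.IsPrime] in
lemma JacobianChart.mem_tangentAt_iff {I₀ : Finset σ} (J : JacobianChart I I₀) {E : Type*} [Field E]
    [Algebra k E] {ξ : σ → E} (hξ : ∀ F ∈ I, aeval ξ F = 0) (hh : aeval ξ J.h ≠ 0) {w : σ → E} :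
    w ∈ tangentAt I ξ ↔
      ∀ l ∉ I₀, aeval ξ J.h * w l = ∑ i ∈ I₀, aeval ξ (J.b l i) * w i := by
  constructor
  · intro hw l hl
    obtain ⟨F, hF, h1, h2⟩ := J.exists_mem l hl
    have h3 := hw F hF
    rw [← Finset.sum_compl_add_sum I₀] at h3
    have h4 : ∀ l' ∈ I₀ᶜ, aeval ξ (pderiv l' F) * w l' =
        if l' = l then aeval ξ J.h * w l else 0 := by
      intro l' hl'
      have := hξ _ (h1 l' (Finset.mem_compl.1 hl'))
      rw [map_sub, sub_eq_zero] at this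
      rw [this]
      split_ifs with h
      · rw [h]
      · simp
    have h5 : ∀ i ∈ I₀, aeval ξ (pderiv i F) * w i = -(aeval ξ (J.b l i) * w i) := by
      intro i hi
      have := hξ _ (h2 i hi)
      rw [map_add, add_eq_zero_iff_eq_neg] at this
      rw [this, neg_mul]
    rw [Finset.sum_congr rfl h4, Finset.sum_congr rfl h5, Finset.sum_ite_eq',
      if_pos (Finset.mem_compl.2 hl), Finset.sum_neg_distrib, ← sub_eq_add_neg, sub_eq_zero] at h3
    exact h3
  · intro hw G hG
    have h1 : aeval ξ J.h * ∑ i, aeval ξ (pderiv i G) * w i = 0 := by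
      rw [← Finset.sum_compl_add_sum I₀, mul_add, Finset.mul_sum, Finset.mul_sum]
      have h2 : ∀ l ∈ I₀ᶜ, aeval ξ J.h * (aeval ξ (pderiv l G) * w l) =
          ∑ i ∈ I₀, aeval ξ (pderiv l G) * (aeval ξ (J.b l i) * w i) := by
        intro l hl
        rw [mul_left_comm, hw l (Finset.mem_compl.1 hl), Finset.mul_sum]
      have h3 : ∀ i ∈ I₀, aeval ξ J.h * (aeval ξ (pderiv i G) * w i) =
          -∑ l ∈ I₀ᶜ, aeval ξ (pderiv l G) * (aeval ξ (J.b l i) * w i) := by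
        intro i hi
        have := hξ _ (J.generate G hG i hi)
        rw [map_add, map_mul, map_sum, add_eq_zero_iff_eq_neg] at this
        rw [← mul_assoc, this, neg_mul, Finset.sum_mul]
        congr 1
        exact Finset.sum_congr rfl fun l _ => by rw [map_mul]; ring
      rw [Finset.sum_congr rfl h2, Finset.sum_congr rfl h3, Finset.sum_neg_distrib,
        Finset.sum_comm, add_neg_cancel]
    exact (mul_eq_zero.1 h1).resolve_left hh

/-- The differential of a polynomial at the generic point, as a linear form. -/
def genericDifferential (ξ : σ → K) (F : MvPolynomial σ k) :
    Module.Dual K (σ → K) :=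
  ∑ i, aeval ξ (pderiv i F) • LinearMap.proj i

omit [DecidableEq σ] in
lemma genericDifferential_apply (F : MvPolynomial σ k)
    (w : σ → K) :
    genericDifferential ξ F w = ∑ i, aeval ξ (pderiv i F) * w i := by
  simp [genericDifferential]

omit [I.IsPrime] [DecidableEq σ] in
lemma genericDifferential_mul (hξ : IsGenericPoint I ξ) {F : MvPolynomial σ k} (hF : F ∈ I)
    (g : MvPolynomial σ k) :
    genericDifferential ξ (g * F) = aeval ξ g • genericDifferential ξ F := by
  simp [genericDifferential, hξ.aeval_eq_zero_iff.2 hF, mul_smul, Finset.smul_sum]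

omit [DecidableEq σ] in
lemma genericDifferential_add (F G : MvPolynomial σ k) :
    genericDifferential ξ (F + G) = genericDifferential ξ F + genericDifferential ξ G := by
  simp [genericDifferential, add_smul, Finset.sum_add_distrib]

omit [DecidableEq σ] in
/-- A linear form that vanishes on the generic tangent space is, up to a denominator, the
differential of an element of the ideal. -/
lemma exists_genericDifferential_eq (hξ : IsGenericPoint I ξ)
    (τ : Module.Dual K (σ → K))
    (hτ : ∀ w ∈ tangentAt I ξ, τ w = 0) :
    ∃ g ∉ I, ∃ F ∈ I, aeval ξ g • τ = genericDifferential ξ F := by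
  have h1 : τ ∈ Submodule.span K
      (genericDifferential ξ '' (I : Set (MvPolynomial σ k))) := by
    have : τ ∈ (Submodule.span K
      (genericDifferential ξ '' (I : Set (MvPolynomial σ k)))).dualCoannihilator.dualAnnihilator := by
      rw [Submodule.mem_dualAnnihilator]
      intro w hw
      refine hτ w fun F hF => ?_
      rw [Submodule.mem_dualCoannihilator] at hw
      rw [← genericDifferential_apply]
      exact hw _ (Submodule.subset_span ⟨F, hF, rfl⟩)
    rwa [Subspace.dualCoannihilator_dualAnnihilator_eq] at this
  clear hτ
  induction h1 using Submodule.span_induction with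
  | mem τ hτ =>
    obtain ⟨F, hF, rfl⟩ := hτ
    exact ⟨1, (Ideal.ne_top_iff_one I).1 (Ideal.IsPrime.ne_top ‹_›), F, hF, by simp⟩
  | zero => exact ⟨1, (Ideal.ne_top_iff_one I).1 (Ideal.IsPrime.ne_top ‹_›), 0, I.zero_mem, by
      simp [genericDifferential]⟩
  | add τ₁ τ₂ _ _ h₁ h₂ =>
    obtain ⟨g₁, hg₁, F₁, hF₁, e₁⟩ := h₁
    obtain ⟨g₂, hg₂, F₂, hF₂, e₂⟩ := h₂
    refine ⟨g₁ * g₂, fun h => (Ideal.IsPrime.mem_or_mem ‹_› h).elim hg₁ hg₂, g₂ * F₁ + g₁ * F₂,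
      I.add_mem (I.mul_mem_left _ hF₁) (I.mul_mem_left _ hF₂), ?_⟩
    rw [genericDifferential_add, genericDifferential_mul hξ hF₁, genericDifferential_mul hξ hF₂, ← e₁,
      ← e₂, map_mul, smul_add, mul_smul, mul_smul, smul_comm (aeval ξ g₁) _ τ₁]
  | smul c τ _ h =>
    obtain ⟨g, hg, F, hF, e⟩ := h
    obtain ⟨a, b, hb, hc⟩ := hξ.exists_div c
    refine ⟨b * g, fun h => (Ideal.IsPrime.mem_or_mem ‹_› h).elim hb hg, a * F,
      I.mul_mem_left _ hF, ?_⟩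
    rw [genericDifferential_mul hξ hF, ← e, map_mul, ← hc]
    simp only [smul_smul]
    congr 1
    ring

omit [Fintype σ] [DecidableEq σ] [I.IsPrime] in
lemma exists_homogeneousComponent_notMem {F : MvPolynomial σ k} (hF : F ∉ I) :
    ∃ d, homogeneousComponent d F ∉ I := by
  by_contra! h
  rw [← sum_homogeneousComponent F] at hF
  exact hF (I.sum_mem fun d _ => h d)

omit [DecidableEq σ] in
/-- Some of the coordinates form a basis of the dual of a subspace of a coordinate space. -/
lemma exists_coordinate_basis (T : Submodule K (σ → K)) :
    ∃ (I₀ : Finset σ) (c : σ → σ → K), I₀.card = Module.finrank K T ∧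
      (∀ w ∈ T, ∀ l, w l = ∑ i ∈ I₀, c l i * w i) ∧
      ∀ a : σ → K, (∀ w ∈ T, ∑ i ∈ I₀, a i * w i = 0) → ∀ i ∈ I₀, a i = 0 := by
  classical
  let ε : σ → Module.Dual K T := fun i => (LinearMap.proj i).comp T.subtype
  have hεtop : Submodule.span K (Set.range ε) = ⊤ := by
    rw [eq_top_iff]
    intro φ _
    obtain ⟨ψ, rfl⟩ := LinearMap.exists_extend φ
    have : ψ ∘ₗ T.subtype = ∑ i, ψ (Pi.single i 1) • ε i := by
      ext w
      simp only [LinearMap.comp_apply, Submodule.subtype_apply, LinearMap.sum_apply,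
        LinearMap.smul_apply, ε, LinearMap.proj_apply, smul_eq_mul]
      conv_lhs => rw [LinearMap.pi_apply_eq_sum_univ ψ]
      refine Finset.sum_congr rfl fun i _ => ?_
      rw [smul_eq_mul, mul_comm]
      congr 2
      ext j
      simp [Pi.single_apply, eq_comm]
    rw [this]
    exact Submodule.sum_mem _ fun i _ => Submodule.smul_mem _ _ (Submodule.subset_span ⟨i, rfl⟩)
  obtain ⟨B, -, -, hBspan, hBli⟩ := exists_linearIndepOn_extension (K := K) (v := ε)
    (linearIndepOn_empty K ε) (Set.subset_univ _)
  rw [Set.image_univ] at hBspan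
  let I₀ : Finset σ := B.toFinset
  have hBtop : Submodule.span K (ε '' B) = ⊤ := by
    rw [eq_top_iff, ← hεtop, Submodule.span_le]
    exact hBspan
  have hcard : I₀.card = Module.finrank K T := by
    rw [← Subspace.dual_finrank_eq, ← finrank_top K (Module.Dual K T), ← hBtop]
    have := finrank_span_eq_card (R := K) (b := fun i : B => ε i) hBli
    rw [← Set.image_eq_range] at this
    rw [this]
    simp [I₀]
  have hBex : ∀ l, ∃ c : σ → K, ε l = ∑ i ∈ I₀, c i • ε i := by
    intro l
    have : ε l ∈ Submodule.span K (ε '' (I₀ : Set σ)) := by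
      simp only [I₀, Set.coe_toFinset, hBtop, Submodule.mem_top]
    obtain ⟨c, hc⟩ := (Submodule.mem_span_image_finset_iff_exists_fun K).1 this
    refine ⟨fun i => if hi : i ∈ I₀ then c ⟨i, hi⟩ else 0, ?_⟩
    rw [← hc, ← Finset.sum_attach I₀ fun i => (if hi : i ∈ I₀ then c ⟨i, hi⟩ else 0) • ε i]
    exact Finset.sum_congr rfl fun i _ => by simp
  choose c hc using hBex
  refine ⟨I₀, c, hcard, fun w hw l => ?_, fun a ha => ?_⟩
  · have := congrArg (fun f => f ⟨w, hw⟩) (hc l)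
    simpa [ε] using this
  · have h1 : LinearIndepOn K ε (I₀ : Set σ) := by simpa [I₀] using hBli
    rw [linearIndepOn_finset_iff] at h1
    refine h1 a ?_
    ext ⟨w, hw⟩
    simpa [ε] using ha w hw

lemma exists_jacobianChart (hξ : IsGenericPoint I ξ) (hI : IsHomog I) :
    ∃ I₀ : Finset σ, I₀.card = Module.finrank K
        (tangentAt I ξ) ∧ Nonempty (JacobianChart I I₀) := by
  obtain ⟨I₀, c, hcard, hc, hli⟩ := exists_coordinate_basis (tangentAt I ξ)
  refine ⟨I₀, hcard, ?_⟩
  let τ : σ → Module.Dual K (σ → K) := fun l =>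
    LinearMap.proj l - ∑ i ∈ I₀, c l i • LinearMap.proj i
  have hτ : ∀ l, ∀ w ∈ tangentAt I ξ, τ l w = 0 := by
    intro l w hw
    simpa [τ, sub_eq_zero] using hc w hw l
  choose g hg F hF hgF using fun l => exists_genericDifferential_eq hξ (τ l) (hτ l)
  let h := ∏ l, g l
  have hh : h ∉ I := by
    intro h0
    obtain ⟨l, -, hl⟩ := (Ideal.IsPrime.prod_mem_iff (p := I)).1 h0
    exact hg l hl
  let F' : σ → MvPolynomial σ k := fun l => (∏ l' ∈ Finset.univ.erase l, g l') * F l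
  have hF' : ∀ l, F' l ∈ I := fun l => I.mul_mem_left _ (hF l)
  have hhF : ∀ l, aeval ξ h • τ l = genericDifferential ξ (F' l) := by
    intro l
    rw [genericDifferential_mul hξ (hF l), ← hgF, smul_smul, ← map_mul,
      Finset.prod_erase_mul _ _ (Finset.mem_univ l)]
  -- pass to homogeneous components
  obtain ⟨e, he⟩ := exists_homogeneousComponent_notMem hh
  let h₁ := homogeneousComponent e h
  let F₁ : σ → MvPolynomial σ k := fun l => homogeneousComponent (e + 1) (F' l)
  have hF₁ : ∀ l, F₁ l ∈ I := fun l => hI _ (hF' l) _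
  have hd : ∀ l ∉ I₀, ∀ l' ∉ I₀, pderiv l' (F₁ l) - (if l' = l then h₁ else 0) ∈ I := by
    intro l hl l' hl'
    have h2 : pderiv l' (F' l) - (if l' = l then h else 0) ∈ I := by
      rw [← hξ.aeval_eq_zero_iff, map_sub, sub_eq_zero]
      have := congrArg (fun f => f (Pi.single l' 1)) (hhF l)
      simp only [genericDifferential_apply, Pi.single_apply, mul_ite, mul_one, mul_zero,
        Finset.sum_ite_eq', Finset.mem_univ, if_true] at this
      rw [← this]
      simp only [τ, LinearMap.smul_apply, LinearMap.sub_apply, LinearMap.proj_apply,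
        LinearMap.sum_apply, smul_eq_mul, Pi.single_apply, mul_ite, mul_one, mul_zero,
        Finset.sum_ite_eq', hl', if_false, sub_zero, eq_comm (a := l)]
      split_ifs <;> simp
    have h3 := hI _ h2 e
    rw [map_sub, ← pderiv_homogeneousComponent] at h3
    convert h3 using 2
    split_ifs <;> simp [h₁]
  have hb : ∀ l ∉ I₀, ∀ i ∈ I₀,
      aeval ξ h₁ * c l i = - aeval ξ (pderiv i (F₁ l)) := by
    intro l hl i hi
    refine eq_neg_of_add_eq_zero_left
      (hli (fun i => aeval ξ h₁ * c l i + aeval ξ (pderiv i (F₁ l))) ?_ i hi)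
    intro w hw
    have h3 := hw _ (hF₁ l)
    rw [← Finset.sum_compl_add_sum I₀] at h3
    have h4 : ∀ l' ∈ I₀ᶜ, aeval ξ (pderiv l' (F₁ l)) * w l' =
        if l' = l then aeval ξ h₁ * w l else 0 := by
      intro l' hl'
      have := hξ.aeval_eq_zero_iff.2 (hd l hl l' (Finset.mem_compl.1 hl'))
      rw [map_sub, sub_eq_zero] at this
      rw [this]
      split_ifs with h
      · rw [h]
      · simp
    rw [Finset.sum_congr rfl h4, Finset.sum_ite_eq', if_pos (Finset.mem_compl.2 hl)] at h3
    simp only [add_mul, Finset.sum_add_distrib, mul_assoc, ← Finset.mul_sum, ← hc w hw l]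
    exact h3
  refine ⟨
    { deg := e
      h := h₁
      b := fun l i => - pderiv i (F₁ l)
      h_notMem := he
      h_homog := homogeneousComponent_isHomogeneous e h
      b_homog := fun l i => by
        have := (homogeneousComponent_isHomogeneous (e + 1) (F' l)).pderiv (i := i)
        exact this.neg
      exists_mem := fun l hl => ⟨F₁ l, hF₁ l, hd l hl, fun i _ => by simp⟩
      generate := ?_ }⟩
  intro G hG i hi
  have h3 := hli (fun i => aeval ξ (pderiv i G) +
      ∑ l ∈ I₀ᶜ, aeval ξ (pderiv l G) * c l i) (by
    intro w hw
    have h3 := hw _ hG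
    rw [← Finset.sum_compl_add_sum I₀] at h3
    simp only [add_mul, Finset.sum_add_distrib]
    rw [← h3, add_comm]
    congr 1
    simp only [Finset.sum_mul]
    rw [Finset.sum_comm]
    refine Finset.sum_congr rfl fun l _ => ?_
    rw [hc w hw l, Finset.mul_sum]
    exact Finset.sum_congr rfl fun i _ => by ring) i hi
  rw [← hξ.aeval_eq_zero_iff, map_add, map_mul, map_sum, ← mul_zero (aeval ξ h₁), ← h3,
    mul_add, Finset.mul_sum]
  congr 1
  refine Finset.sum_congr rfl fun l hl => ?_
  rw [mul_left_comm, hb l (Finset.mem_compl.1 hl) i hi, map_mul, map_neg]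
  ring

end Jacobian

/-! ### The generic tangent space -/

/-- A derivation on a field generated by a set vanishes if it vanishes on that set. -/
lemma derivation_adjoin_ext {k L M : Type*} [Field k] [Field L] [Algebra k L]
    {F : IntermediateField k L} {S : Set L} (hF : F = IntermediateField.adjoin k S)
    [AddCommGroup M] [Module k M] [Module F M] (D : Derivation k F M)
    (h : ∀ z ∈ S, ∀ hz : z ∈ F, D ⟨z, hz⟩ = 0) : D = 0 := by
  subst hF
  ext ⟨z, hz⟩
  change D ⟨z, hz⟩ = 0
  induction hz using IntermediateField.adjoin_induction with
  | mem z hz => exact h z hz _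
  | algebraMap z => exact D.map_algebraMap z
  | add x y hx hy h₁ h₂ => exact (D.map_add ⟨x, hx⟩ ⟨y, hy⟩).trans (by rw [h₁, h₂, add_zero])
  | inv x hx h₁ => exact (D.leibniz_inv ⟨x, hx⟩).trans (by rw [h₁, smul_zero])
  | mul x y hx hy h₁ h₂ =>
    exact (D.leibniz ⟨x, hx⟩ ⟨y, hy⟩).trans (by rw [h₁, h₂, smul_zero, smul_zero, add_zero])

lemma exists_derivation_quotient {k R M : Type*} [CommRing k] [CommRing R] [Algebra k R]
    (I : Ideal R) [AddCommGroup M] [Module k M] [Module R M] [Module (R ⧸ I) M]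
    [IsScalarTower R (R ⧸ I) M] (d : Derivation k R M) (h : ∀ F ∈ I, d F = 0) :
    ∃ D : Derivation k (R ⧸ I) M, ∀ F, D (Ideal.Quotient.mk I F) = d F := by
  let d₁ : (R ⧸ I) →ₗ[k] M := Submodule.liftQ (I.restrictScalars k) d.toLinearMap h
  have hd₁ : ∀ F, d₁ (Ideal.Quotient.mk I F) = d F := fun F => rfl
  refine ⟨Derivation.mk' d₁ fun a b => ?_, hd₁⟩
  obtain ⟨a, rfl⟩ := Ideal.Quotient.mk_surjective a
  obtain ⟨b, rfl⟩ := Ideal.Quotient.mk_surjective b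
  rw [← map_mul, hd₁, hd₁, hd₁, d.leibniz]
  exact congrArg₂ (· + ·) (algebraMap_smul (R ⧸ I) a (d b)).symm
    (algebraMap_smul (R ⧸ I) b (d a)).symm

section GenericTangent

variable {k σ : Type*} [Field k] {I : Ideal (MvPolynomial σ k)} [Fintype σ]
  {K : Type*} [Field K] [Algebra k K] {ξ : σ → K}

/-- A vector of the tangent space at a generic point is the velocity of a derivation. -/
lemma IsGenericPoint.exists_derivation (hξ : IsGenericPoint I ξ) {v : σ → K}
    (hv : v ∈ tangentAt I ξ) : ∃ D : Derivation k K K, ∀ i, D (ξ i) = v i := by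
  let _ : Algebra (MvPolynomial σ k) K := (aeval ξ).toAlgebra
  let _ : Algebra (MvPolynomial σ k ⧸ I) K :=
    (Ideal.Quotient.lift I (aeval ξ : MvPolynomial σ k →ₐ[k] K).toRingHom
      fun F hF => hξ.aeval_eq_zero_iff.2 hF).toAlgebra
  have : IsScalarTower k (MvPolynomial σ k) K :=
    IsScalarTower.of_algebraMap_eq fun a => ((aeval ξ).commutes a).symm
  have : IsScalarTower (MvPolynomial σ k) (MvPolynomial σ k ⧸ I) K := ⟨fun F y z => by
    obtain ⟨G, rfl⟩ := Ideal.Quotient.mk_surjective y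
    change aeval ξ (F * G) * z = aeval ξ F * (aeval ξ G * z)
    rw [map_mul, mul_assoc]⟩
  have : IsScalarTower k (MvPolynomial σ k ⧸ I) K := ⟨fun a y z => by
    obtain ⟨G, rfl⟩ := Ideal.Quotient.mk_surjective y
    change aeval ξ (a • G) * z = a • (aeval ξ G * z)
    rw [map_smul, smul_mul_assoc]⟩
  have hmk : ∀ F, algebraMap (MvPolynomial σ k ⧸ I) K (Ideal.Quotient.mk I F) = aeval ξ F :=
    fun F => rfl
  have hinj : Function.Injective (algebraMap (MvPolynomial σ k ⧸ I) K) := by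
    rw [injective_iff_map_eq_zero]
    intro F hF
    obtain ⟨F, rfl⟩ := Ideal.Quotient.mk_surjective F
    exact Ideal.Quotient.eq_zero_iff_mem.2 (hξ.aeval_eq_zero_iff.1 hF)
  have : IsDomain (MvPolynomial σ k ⧸ I) := hinj.isDomain _
  have : FaithfulSMul (MvPolynomial σ k ⧸ I) K := (faithfulSMul_iff_algebraMap_injective _ _).2 hinj
  have : IsFractionRing (MvPolynomial σ k ⧸ I) K := .of_field _ _ fun z => by
    obtain ⟨a, b, hb, hz⟩ := hξ.exists_div z
    refine ⟨Ideal.Quotient.mk I a, Ideal.Quotient.mk I b, ?_⟩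
    rw [hmk, hmk, eq_div_iff fun h => hb (hξ.aeval_eq_zero_iff.1 h), mul_comm, hz]
  let d₀ : Derivation k (MvPolynomial σ k) K := mkDerivation k v
  have hd₀ : ∀ F, d₀ F = ∑ i, aeval ξ (pderiv i F) * v i := by
    intro F
    have h := derivation_aeval d₀ X F
    rw [aeval_X_left_apply] at h
    rw [h]
    refine Finset.sum_congr rfl fun i _ => ?_
    rw [aeval_X_left_apply, Algebra.smul_def]
    congr 1
    exact mkDerivation_X k v i
  obtain ⟨d, hd⟩ := exists_derivation_quotient I d₀ fun F hF => (hd₀ F).trans (hv F hF)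
  have : Algebra.FormallyEtale (MvPolynomial σ k ⧸ I) K :=
    .of_isLocalization (nonZeroDivisors _)
  obtain ⟨D, hD⟩ := exists_derivation_extend_of_formallyEtale (B := K) d
  refine ⟨D, fun i => ?_⟩
  rw [← aeval_X (R := k) ξ i, ← hmk, hD]
  exact (hd (X i)).trans (mkDerivation_X k v i)

/-- The velocity of a derivation is tangent. -/
lemma derivation_mem_tangentAt {E : Type*} [Field E] [Algebra k E] {J : Ideal (MvPolynomial σ k)}
    {ξ : σ → E} (hξ : ∀ F ∈ J, aeval ξ F = 0) (D : Derivation k E E) :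
    (fun i => D (ξ i)) ∈ tangentAt J ξ := fun F hF => by
  have := derivation_aeval D ξ F
  rw [hξ F hF, map_zero] at this
  simpa using this.symm

/-- By Euler's identity, the point itself is a vector of the tangent space of a cone. -/
lemma IsHomog.self_mem_tangentAt (hI : IsHomog I) {E : Type*} [Field E] [Algebra k E]
    {ξ : σ → E} (hξ : ∀ F ∈ I, aeval ξ F = 0) : ξ ∈ tangentAt I ξ := by
  intro F hF
  conv_lhs => rw [← sum_homogeneousComponent F]
  simp only [map_sum, Finset.sum_mul]
  rw [Finset.sum_comm]
  refine Finset.sum_eq_zero fun d _ => ?_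
  have := congrArg (aeval ξ) (homogeneousComponent_isHomogeneous d F).sum_X_mul_pderiv
  rw [map_sum, map_nsmul, hξ _ (hI F hF d), smul_zero] at this
  simpa [mul_comm] using this

omit [Fintype σ] in
/-- A derivation is determined by its values on the coordinates of a generic point. -/
lemma IsGenericPoint.derivation_ext (hξ : IsGenericPoint I ξ) (D : Derivation k K K)
    (h : ∀ i, D (ξ i) = 0) : D = 0 := by
  have h1 : ∀ F : MvPolynomial σ k, D (aeval ξ F) = 0 := by
    intro F
    induction F using MvPolynomial.induction_on with
    | C a => simp
    | add p q hp hq => simp [hp, hq]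
    | mul_X p j hp => simp [hp, h]
  ext z
  obtain ⟨a, b, hb, hz⟩ := hξ.exists_div z
  have h2 := congrArg D hz
  rw [D.leibniz, h1, h1, smul_zero, add_zero] at h2
  exact (smul_eq_zero.1 h2).resolve_left fun h => hb (hξ.aeval_eq_zero_iff.1 h)

omit [Fintype σ] in
/-- The field of ratios of coordinates is generated by the ratios with a fixed denominator. -/
lemma ratioField_eq_adjoin [I.IsPrime] {l₀ : σ} (hl₀ : coord I l₀ ≠ 0) :
    ratioField I (fun _ _ => True) =
      IntermediateField.adjoin k (Set.range fun l => coord I l / coord I l₀) := by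
  apply le_antisymm
  · rw [ratioField, IntermediateField.adjoin_le_iff]
    rintro _ ⟨i, j, -, rfl⟩
    have : coord I i / coord I j = (coord I i / coord I l₀) / (coord I j / coord I l₀) := by
      rw [div_div_div_cancel_right₀ hl₀]
    rw [this]
    exact div_mem (IntermediateField.subset_adjoin _ _ ⟨i, rfl⟩)
      (IntermediateField.subset_adjoin _ _ ⟨j, rfl⟩)
  · rw [IntermediateField.adjoin_le_iff]
    rintro _ ⟨i, rfl⟩
    exact IntermediateField.subset_adjoin _ _ ⟨i, l₀, trivial, rfl⟩

/-- The generic tangent space of a cone has the dimension of the cone: `k` being perfect, derivations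
can be prescribed on a separating transcendence basis of the field of ratios, and on one coordinate. -/
lemma IsGenericPoint.finrank_tangentAt [PerfectField k] (hξ : IsGenericPoint I ξ) (hI : IsHomog I)
    {l₀ : σ} (hl₀ : ξ l₀ ≠ 0) (F₀ : IntermediateField k K)
    (hgen : F₀ = IntermediateField.adjoin k (Set.range fun l => ξ l / ξ l₀))
    {n : ℕ} (hn : Algebra.trdeg k F₀ = (n : Cardinal)) :
    Module.finrank K (tangentAt I ξ) = n + 1 := by
  have hzero : ∀ F ∈ I, aeval ξ F = 0 := fun F hF => hξ.aeval_eq_zero_iff.2 hF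
  have hy : ∀ l, ξ l / ξ l₀ ∈ F₀ := fun l => by
    rw [hgen]
    exact IntermediateField.subset_adjoin _ _ ⟨l, rfl⟩
  have hess : Algebra.EssFiniteType k F₀ := by
    rw [IntermediateField.essFiniteType_iff, hgen]
    exact IntermediateField.fg_adjoin_of_finite (Set.finite_range _)
  obtain ⟨s, hs, hsep⟩ := exists_isTranscendenceBasis_and_isSeparable_of_perfectField k F₀
  have hsep' : Algebra.IsSeparable (IntermediateField.adjoin k
      (Set.range ((↑) : s → F₀))) F₀ := by
    rw [show Set.range ((↑) : s → F₀) = (s : Set F₀) from Subtype.range_coe]; exact hsep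
  have hcard : Fintype.card s = n := by
    have := hs.cardinalMk_eq_trdeg
    rw [hn, Cardinal.mk_fintype] at this
    exact_mod_cast this
  let e₁ : Derivation k K K
      →ₗ[K] tangentAt I (ξ) :=
    { toFun := fun D => ⟨fun i => D (ξ i), derivation_mem_tangentAt hzero D⟩
      map_add' := fun _ _ => rfl
      map_smul' := fun _ _ => rfl }
  have he₁ : Function.Bijective e₁ := by
    constructor
    · rw [injective_iff_map_eq_zero]
      intro D hD
      exact hξ.derivation_ext D fun i => congrFun (congrArg Subtype.val hD) i
    · rintro ⟨v, hv⟩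
      obtain ⟨D, hD⟩ := hξ.exists_derivation hv
      exact ⟨D, Subtype.ext (funext hD)⟩
  let e₂ : Derivation k K K
      →ₗ[K]
        (Option s → K) :=
    { toFun := fun D o => D (o.elim (ξ l₀) fun i => ((i : F₀) : _))
      map_add' := fun _ _ => rfl
      map_smul' := fun _ _ => rfl }
  have hmul : ∀ l, ξ l = ξ l / ξ l₀ * ξ l₀ := fun l =>
    (div_mul_cancel₀ _ hl₀).symm
  have he₂ : Function.Bijective e₂ := by
    constructor
    · rw [injective_iff_map_eq_zero]
      intro D hD
      have hD₀ : D.compAlgebraMap F₀ = 0 :=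
        derivation_eq_zero_of_sepGen hsep' _ fun i => congrFun hD (some i)
      have h0 : D (ξ l₀) = 0 := congrFun hD none
      refine hξ.derivation_ext D fun l => ?_
      have h1 : D (ξ l / ξ l₀) = 0 :=
        congrArg (fun E : Derivation k F₀ _ => E ⟨_, hy l⟩) hD₀
      rw [hmul l, D.leibniz, h0, h1, smul_zero, smul_zero, add_zero]
    · intro f
      obtain ⟨D₀, hD₀⟩ := exists_derivation_of_sepGen hs.1 hsep' fun i : s => f (some i)
      let y : σ → F₀ := fun l => ⟨_, hy l⟩
      have hyc : (fun l => (y l : K)) =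
          (ξ l₀)⁻¹ • ξ := by
        ext l
        simp [y, div_eq_inv_mul]
      have hcoe : ∀ F, ((aeval y F : F₀) : K) =
          aeval ((ξ l₀)⁻¹ • ξ) F := fun F => by
        rw [← hyc]
        exact comp_aeval_apply y F₀.val F
      have hyzero : ∀ F ∈ I, aeval y F = 0 := fun F hF =>
        Subtype.ext ((hcoe F).trans (hI.aeval_smul_eq_zero hzero _ hF))
      have hDy : (fun l => D₀ (y l)) ∈ tangentAt I (ξ) := by
        rw [← hI.tangentAt_smul ξ (inv_ne_zero hl₀)]
        intro F hF
        have h1 := derivation_aeval D₀ y F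
        rw [hyzero F hF, map_zero] at h1
        rw [h1]
        refine Finset.sum_congr rfl fun i _ => ?_
        rw [← hcoe]
        rfl
      obtain ⟨D, hD⟩ := hξ.exists_derivation
        (Submodule.add_mem _ (Submodule.smul_mem _ (ξ l₀) hDy)
          (Submodule.smul_mem _ (f none * (ξ l₀)⁻¹) (hI.self_mem_tangentAt hzero)))
      simp only [Pi.add_apply, Pi.smul_apply, smul_eq_mul] at hD
      have hy₀ : y l₀ = 1 := Subtype.ext (div_self hl₀)
      have hDl₀ : D (ξ l₀) = f none := by
        rw [hD, hy₀, D₀.map_one_eq_zero, mul_zero, zero_add, inv_mul_cancel_right₀ hl₀]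
      have hDD₀ : ∀ z : K, ∀ hz : z ∈ F₀, D z = D₀ ⟨z, hz⟩ := by
        intro z hz
        have h2 : D.compAlgebraMap F₀ - D₀ = 0 := by
          refine derivation_adjoin_ext hgen _ ?_
          rintro _ ⟨l, rfl⟩ hl
          have h3 : ξ l₀ • D (ξ l / ξ l₀) = ξ l₀ • D₀ (y l) := by
            have h4 := congrArg D (hmul l)
            rw [D.leibniz, hDl₀, hD, smul_eq_mul, smul_eq_mul] at h4
            have h5 : ξ l / ξ l₀ * f none = f none * (ξ l₀)⁻¹ * ξ l := by
              rw [div_eq_mul_inv]; ring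
            rw [h5, add_comm] at h4
            exact (add_left_cancel h4).symm
          rw [smul_right_injective _ hl₀ |>.eq_iff] at h3
          exact sub_eq_zero.2 h3
        exact sub_eq_zero.1 (congrArg (fun E : Derivation k F₀ _ => E ⟨z, hz⟩) h2)
      refine ⟨D, funext fun o => ?_⟩
      rcases o with _ | i
      · exact hDl₀
      · exact (hDD₀ i (i : F₀).2).trans (hD₀ i)
  let E := (LinearEquiv.ofBijective e₁ he₁).symm.trans (LinearEquiv.ofBijective e₂ he₂)
  rw [E.finrank_eq, Module.finrank_fintype_fun_eq_card, Fintype.card_option, hcard]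

end GenericTangent

/-! ### Minors and Plücker coordinates -/

section Minors

variable {E : Type*} [CommRing E] {r s : ℕ}

/-- The minor of an `r × s` matrix on the columns `f 0, ..., f (r - 1)`. -/
def minor (v : Fin r → Fin s → E) (f : Fin r → Fin s) : E :=
  Matrix.det (Matrix.of fun a b => v a (f b))

lemma map_minor {E' : Type*} [CommRing E'] (φ : E →+* E') (v : Fin r → Fin s → E)
    (f : Fin r → Fin s) : φ (minor v f) = minor (fun a l => φ (v a l)) f := by
  rw [minor, RingHom.map_det]
  rfl

lemma minor_smul (c : E) (v : Fin r → Fin s → E) (f : Fin r → Fin s) :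
    minor (c • v) f = c ^ r * minor v f := by
  have : (Matrix.of fun a b => (c • v) a (f b)) = c • Matrix.of fun a b => v a (f b) := rfl
  rw [minor, this, Matrix.det_smul, Fintype.card_fin]
  rfl

lemma minor_comp_perm (v : Fin r → Fin s → E) (f : Fin r → Fin s) (τ : Equiv.Perm (Fin r)) :
    minor v (f ∘ τ) = Equiv.Perm.sign τ * minor v f :=
  Matrix.det_permute' τ (Matrix.of fun a b => v a (f b))

/-- An injective sequence of columns is a permutation of an increasing one. -/
lemma exists_orderEmbedding_comp {f : Fin r → Fin s} (hf : Function.Injective f) :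
    ∃ (J : Fin r ↪o Fin s) (τ : Equiv.Perm (Fin r)), f = J ∘ τ := by
  refine ⟨OrderEmbedding.ofStrictMono (f ∘ Tuple.sort f)
    ((Tuple.monotone_sort f).strictMono_of_injective (hf.comp (Tuple.sort f).injective)),
    (Tuple.sort f).symm, ?_⟩
  ext a
  simp

/-- Changing the basis multiplies all the minors by the same determinant. -/
lemma minor_mul (P : Matrix (Fin r) (Fin r) E) (v : Fin r → Fin s → E) (f : Fin r → Fin s) :
    minor (fun a l => ∑ b, P a b * v b l) f = P.det * minor v f := by
  rw [minor, minor, ← Matrix.det_mul]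
  rfl

/-- The minors of a matrix in echelon form that exchange one of the pivots for another column are
the entries of the matrix. -/
lemma minor_update_of_echelon {v : Fin r → Fin s → E} {J : Fin r → Fin s}
    (hv : ∀ a b, v a (J b) = if a = b then 1 else 0) (b : Fin r) (l : Fin s) :
    minor v (Function.update J b l) = v b l := by
  have : (Matrix.of fun a c => v a (Function.update J b l c)) =
      (1 : Matrix (Fin r) (Fin r) E).updateCol b fun a => v a l := by
    ext a c
    by_cases h : c = b
    · subst h; simp
    · simp [h, hv, Matrix.one_apply]
  rw [minor, this, ← Matrix.cramer_apply, Matrix.cramer_one]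
  rfl

lemma minor_of_echelon {v : Fin r → Fin s → E} {J : Fin r → Fin s}
    (hv : ∀ a b, v a (J b) = if a = b then 1 else 0) : minor v J = 1 := by
  have : (Matrix.of fun a c => v a (J c)) = (1 : Matrix (Fin r) (Fin r) E) := by
    ext a c
    simp [hv, Matrix.one_apply]
  rw [minor, this, Matrix.det_one]

end Minors

section MinorsField

variable {E : Type*} [Field E] {r s : ℕ}

lemma linearIndependent_of_minor_ne_zero {v : Fin r → Fin s → E} {f : Fin r → Fin s}
    (h : minor v f ≠ 0) : LinearIndependent E v := by
  have h1 := Matrix.linearIndependent_rows_of_det_ne_zero h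
  exact LinearIndependent.of_comp (LinearMap.funLeft E E f) h1

lemma exists_minor_ne_zero {v : Fin r → Fin s → E} (hv : LinearIndependent E v) :
    ∃ J : Fin r ↪o Fin s, minor v J ≠ 0 := by
  let A : Matrix (Fin r) (Fin s) E := Matrix.of v
  have hrank : A.rank = r := by
    have := LinearIndependent.rank_matrix (M := A) hv
    simpa using this
  obtain ⟨κ, a, ha, hspan, hli⟩ := exists_linearIndependent' E A.col
  have htop : Submodule.span E (Set.range (A.col ∘ a)) = ⊤ := by
    rw [hspan]
    apply Submodule.eq_top_of_finrank_eq
    rw [← Matrix.rank_eq_finrank_span_cols, hrank, Module.finrank_fin_fun]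
  have : Finite κ := Finite.of_injective a ha
  have := Fintype.ofFinite κ
  have hcard : Fintype.card κ = Fintype.card (Fin r) := by
    have := finrank_span_eq_card hli
    rw [htop, finrank_top, Module.finrank_fin_fun] at this
    rw [← this, Fintype.card_fin]
  let e := (Fintype.equivOfCardEq hcard).symm
  obtain ⟨J, τ, hJ⟩ := exists_orderEmbedding_comp (ha.comp e.injective)
  refine ⟨J, fun h0 => ?_⟩
  have h1 : minor v (a ∘ e) = 0 := by rw [hJ, minor_comp_perm, h0, mul_zero]
  have h2 : LinearIndependent E (Matrix.of fun i j => v i ((a ∘ e) j)).col :=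
    hli.comp e e.injective
  rw [Matrix.linearIndependent_cols_iff_isUnit, Matrix.isUnit_iff_isUnit_det, isUnit_iff_ne_zero]
    at h2
  exact h2 h1

lemma minor_eq_zero_of_not_linearIndependent {v : Fin r → Fin s → E}
    (hv : ¬ LinearIndependent E v) (f : Fin r → Fin s) : minor v f = 0 := by
  by_contra h
  exact hv (linearIndependent_of_minor_ne_zero h)

lemma minor_cons (v : Fin r → Fin s → E) (w : Fin s → E) (f : Fin (r + 1) → Fin s) :
    minor (Fin.cons w v : Fin (r + 1) → Fin s → E) f =
      ∑ a : Fin (r + 1), (-1) ^ (a : ℕ) * w (f a) * minor v (f ∘ a.succAbove) := by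
  rw [minor, Matrix.det_succ_row_zero]
  rfl

/-- The Plücker equations of a linear space. -/
lemma mem_span_iff_minor {v : Fin r → Fin s → E} (hv : LinearIndependent E v) (w : Fin s → E) :
    w ∈ Submodule.span E (Set.range v) ↔ ∀ J : Fin (r + 1) ↪o Fin s,
      ∑ a : Fin (r + 1), (-1) ^ (a : ℕ) * w (J a) * minor v (J ∘ a.succAbove) = 0 := by
  simp only [← minor_cons]
  constructor
  · intro hw J
    refine minor_eq_zero_of_not_linearIndependent (fun h => ?_) J
    exact (linearIndependent_finCons.1 h).2 hw
  · intro h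
    by_contra hw
    obtain ⟨J, hJ⟩ := exists_minor_ne_zero (linearIndependent_finCons.2 ⟨hv, hw⟩)
    exact hJ (h J)

lemma exists_matrix_of_span_le {v v' : Fin r → Fin s → E}
    (h : Submodule.span E (Set.range v') ≤ Submodule.span E (Set.range v)) :
    ∃ P : Matrix (Fin r) (Fin r) E, v' = fun a l => ∑ b, P a b * v b l := by
  have h1 : ∀ a, ∃ c : Fin r → E, ∑ b, c b • v b = v' a := fun a =>
    (Submodule.mem_span_range_iff_exists_fun E).1 (h (Submodule.subset_span ⟨a, rfl⟩))
  choose P hP using h1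
  refine ⟨P, ?_⟩
  ext a l
  rw [← hP]
  simp

end MinorsField

section Planes

variable {k : Type*} [Field k] {N m : ℕ}

lemma linearIndependent_of_span_eq (L : Gr k N m) {v : Fin (m + 1) → Fin (N + 1) → k}
    (hv : Submodule.span k (Set.range v) = L.1) : LinearIndependent k v := by
  rw [linearIndependent_iff_card_eq_finrank_span, Set.finrank, hv, L.2, Fintype.card_fin]

lemma span_eq_of_linearIndependent (L : Gr k N m) {v : Fin (m + 1) → Fin (N + 1) → k}
    (hv : LinearIndependent k v) (h : ∀ a, v a ∈ L.1) :
    Submodule.span k (Set.range v) = L.1 := by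
  have hle : Submodule.span k (Set.range v) ≤ L.1 := by
    rw [Submodule.span_le]
    rintro _ ⟨a, rfl⟩
    exact h a
  apply Submodule.eq_of_le_of_finrank_eq hle
  rw [finrank_span_eq_card hv, L.2, Fintype.card_fin]

lemma exists_basis_plane (L : Gr k N m) : ∃ v : Fin (m + 1) → Fin (N + 1) → k,
    Submodule.span k (Set.range v) = L.1 := by
  let b := Module.finBasisOfFinrankEq k L.1 L.2
  refine ⟨fun a => b a, ?_⟩
  have := congrArg (Submodule.map L.1.subtype) b.span_eq
  rw [Submodule.map_span, ← Set.range_comp, Submodule.map_top, Submodule.range_subtype] at this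
  exact this

lemma planeReps_nonempty (L : Gr k N m) : (planeReps L).Nonempty := by
  obtain ⟨v, hv⟩ := exists_basis_plane L
  exact ⟨_, v, hv, rfl⟩

lemma ne_zero_of_mem_planeReps {L : Gr k N m} {p : PluckerIdx N m → k} (hp : p ∈ planeReps L) :
    p ≠ 0 := by
  obtain ⟨v, hv, rfl⟩ := hp
  obtain ⟨J, hJ⟩ := exists_minor_ne_zero (linearIndependent_of_span_eq L hv)
  exact fun h => hJ (congrFun h J)

lemma exists_smul_of_mem_planeReps {L : Gr k N m} {p p' : PluckerIdx N m → k}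
    (hp : p ∈ planeReps L) (hp' : p' ∈ planeReps L) : ∃ c : k, c ≠ 0 ∧ p' = c • p := by
  have h0 := ne_zero_of_mem_planeReps hp'
  obtain ⟨v, hv, rfl⟩ := hp
  obtain ⟨v', hv', rfl⟩ := hp'
  obtain ⟨P, hP⟩ := exists_matrix_of_span_le (hv'.trans hv.symm).le
  have h1 : plucker v' = P.det • plucker v := by
    ext J
    rw [hP]
    exact minor_mul P v J
  refine ⟨P.det, fun h => h0 (by rw [h1, h, zero_smul]), h1⟩

lemma smul_mem_planeReps {L : Gr k N m} {p : PluckerIdx N m → k} (hp : p ∈ planeReps L) {c : k}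
    (hc : c ≠ 0) : c • p ∈ planeReps L := by
  obtain ⟨v, hv, rfl⟩ := hp
  have hli := linearIndependent_of_span_eq L hv
  let P : Matrix (Fin (m + 1)) (Fin (m + 1)) k := Matrix.diagonal (Function.update 1 0 c)
  have hdet : P.det = c := by
    rw [Matrix.det_diagonal, Fin.prod_univ_succ]
    simp
  have h1 : plucker (fun a l => ∑ b, P a b * v b l) = c • plucker v := by
    ext J
    rw [Pi.smul_apply, smul_eq_mul]
    conv_rhs => rw [← hdet]
    exact minor_mul P v J
  refine ⟨fun a l => ∑ b, P a b * v b l, span_eq_of_linearIndependent L ?_ fun a => ?_, h1.symm⟩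
  · obtain ⟨J, hJ⟩ := exists_minor_ne_zero hli
    refine linearIndependent_of_minor_ne_zero (f := J) ?_
    rw [minor_mul, hdet]
    exact mul_ne_zero hc hJ
  · rw [← hv]
    have : (fun l => ∑ b, P a b * v b l) = ∑ b, P a b • v b := by
      ext l; simp
    rw [this]
    exact Submodule.sum_mem _ fun b _ => Submodule.smul_mem _ _ (Submodule.subset_span ⟨b, rfl⟩)

lemma pointReps_nonempty (x : PSpace k N) : (pointReps x).Nonempty :=
  ⟨x.rep, x.rep_nonzero, x.mk_rep⟩

lemma exists_smul_of_mem_pointReps {x : PSpace k N} {v v' : Fin (N + 1) → k}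
    (hv : v ∈ pointReps x) (hv' : v' ∈ pointReps x) : ∃ c : k, c ≠ 0 ∧ v' = c • v := by
  obtain ⟨h, rfl⟩ := hv
  obtain ⟨h', e⟩ := hv'
  obtain ⟨c, hc⟩ := (Projectivization.mk_eq_mk_iff k v' v h' h).1 e
  exact ⟨c, c.ne_zero, hc.symm⟩

lemma smul_mem_pointReps {x : PSpace k N} {v : Fin (N + 1) → k}
    (hv : v ∈ pointReps x) {c : k} (hc : c ≠ 0) : c • v ∈ pointReps x := by
  obtain ⟨h, rfl⟩ := hv
  refine ⟨smul_ne_zero hc h, ?_⟩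
  rw [Projectivization.mk_eq_mk_iff]
  exact ⟨Units.mk0 c hc, rfl⟩

end Planes

/-! ### Closures in the Zariski topologies -/

section Zariski

variable {k : Type*} [Field k] {Z σ M : Type*} [AddCommMonoid M]
  {reps : Z → Set (σ → k)} {w : σ → M}

lemma exists_eval_eq_zero_of_mem_closure {S : Set Z} {z : Z}
    (hz : z ∈ @closure Z (zariskiTopology reps w) S) {F : MvPolynomial σ k} {d : M}
    (hF : IsWeightedHomogeneous w F d) (hS : ∀ z' ∈ S, ∃ v ∈ reps z', eval v F = 0) :
    ∃ v ∈ reps z, eval v F = 0 := by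
  let _ : TopologicalSpace Z := zariskiTopology reps w
  by_contra! h
  have hopen : IsOpen {z | ∀ v ∈ reps z, eval v F ≠ 0} :=
    TopologicalSpace.isOpen_generateFrom_of_mem ⟨F, d, hF, rfl⟩
  obtain ⟨z', h1, h2⟩ := mem_closure_iff.1 hz _ hopen h
  obtain ⟨v, hv, h3⟩ := hS z' h2
  exact h1 v hv h3

/-- A point outside a closure is separated from it by one multihomogeneous polynomial: the
complements of zero loci form a basis of the topology. -/
lemma exists_separating_of_notMem_closure {S : Set Z} {z : Z}
    (hz : z ∉ @closure Z (zariskiTopology reps w) S) :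
    ∃ (F : MvPolynomial σ k) (d : M), IsWeightedHomogeneous w F d ∧ (∀ v ∈ reps z, eval v F ≠ 0) ∧
      ∀ z' ∈ S, ∃ v ∈ reps z', eval v F = 0 := by
  let _ : TopologicalSpace Z := zariskiTopology reps w
  have hbasis := TopologicalSpace.isTopologicalBasis_of_subbasis (t := zariskiTopology reps w) rfl
  rw [hbasis.mem_closure_iff] at hz
  push Not at hz
  obtain ⟨_, ⟨f, ⟨hfin, hf⟩, rfl⟩, hzf, hdisj⟩ := hz
  have key : ∀ f : Set (Set Z), f.Finite → (∀ U ∈ f, ∃ (F : MvPolynomial σ k) (d : M),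
      IsWeightedHomogeneous w F d ∧ U = {z | ∀ v ∈ reps z, eval v F ≠ 0}) →
      ∃ (F : MvPolynomial σ k) (d : M), IsWeightedHomogeneous w F d ∧
        ⋂₀ f = {z | ∀ v ∈ reps z, eval v F ≠ 0} := by
    intro f hf
    induction f, hf using Set.Finite.induction_on with
    | empty => exact fun _ => ⟨1, 0, isWeightedHomogeneous_one k w, by simp⟩
    | insert _ _ ih =>
      intro h
      obtain ⟨F, d, hF, hFU⟩ := h _ (Set.mem_insert _ _)
      obtain ⟨G, e, hG, hGU⟩ := ih fun U hU => h U (Set.mem_insert_of_mem _ hU)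
      refine ⟨F * G, d + e, hF.mul hG, ?_⟩
      rw [Set.sInter_insert, hFU, hGU]
      ext z
      simp only [Set.mem_inter_iff, Set.mem_ofPred_eq, map_mul, ne_eq, mul_eq_zero, not_or]
      exact ⟨fun h v hv => ⟨h.1 v hv, h.2 v hv⟩, fun h => ⟨fun v hv => (h v hv).1,
        fun v hv => (h v hv).2⟩⟩
  obtain ⟨F, d, hF, hFU⟩ := key f hfin hf
  change z ∈ ⋂₀ f at hzf
  change ⋂₀ f ∩ S = ∅ at hdisj
  rw [hFU] at hzf hdisj
  refine ⟨F, d, hF, hzf, fun z' hz' => ?_⟩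
  by_contra! h
  have : z' ∈ {z | ∀ v ∈ reps z, eval v F ≠ 0} ∩ S := ⟨h, hz'⟩
  rw [hdisj] at this
  exact this

end Zariski

section Ideals

variable {k : Type*} [Field k] {N m : ℕ}

lemma aeval_eq_eval_apply {σ : Type*} (v : σ → k) (F : MvPolynomial σ k) :
    aeval v F = eval v F := by
  rw [← coe_aeval_eq_eval]
  rfl

lemma mem_idealOf {Z σ : Type*} {reps : Z → Set (σ → k)} {S : Set Z} {F : MvPolynomial σ k} :
    F ∈ idealOf reps S ↔ ∀ z ∈ S, ∀ v ∈ reps z, eval v F = 0 := by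
  simp only [idealOf, mem_vanishingIdeal_iff, Set.mem_iUnion, exists_prop, forall_exists_index,
    and_imp, aeval_eq_eval_apply]
  exact ⟨fun h z hz v hv => h v z hz hv, fun h v z hz hv => h z hz v hv⟩

/-- Over an infinite field, a polynomial that vanishes at all the nonzero multiples of a vector has
homogeneous components that vanish at the vector. -/
lemma homIdeal_isHomog [Infinite k] (X : Set (PSpace k N)) : IsHomog (homIdeal X) := by
  intro F hF d
  rw [mem_idealOf] at hF ⊢
  intro x hx v hv
  let q : Polynomial k := ∑ e ∈ Finset.range (F.totalDegree + 1),
    Polynomial.monomial e (eval v (homogeneousComponent e F))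
  have hq : q = 0 := by
    apply Polynomial.eq_zero_of_infinite_isRoot
    refine Set.Infinite.mono (s := {0}ᶜ) (fun c hc => ?_) (Set.finite_singleton 0).infinite_compl
    have h1 := hF x hx _ (smul_mem_pointReps hv hc)
    rw [← sum_homogeneousComponent F, map_sum] at h1
    rw [Set.mem_ofPred_eq, Polynomial.IsRoot, Polynomial.eval_finsetSum, ← h1]
    refine Finset.sum_congr rfl fun e _ => ?_
    rw [Polynomial.eval_monomial, ← aeval_eq_eval_apply,
      ← aeval_eq_eval_apply, aeval_smul_of_isHomogeneous (homogeneousComponent_isHomogeneous e F),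
      mul_comm]
  by_cases hd : d < F.totalDegree + 1
  · have h2 := congrArg (fun q => Polynomial.coeff q d) hq
    simp only [q, Polynomial.finsetSum_coeff, Polynomial.coeff_monomial, Finset.sum_ite_eq',
      Finset.mem_range, hd, if_true, Polynomial.coeff_zero] at h2
    exact h2
  · rw [homogeneousComponent_eq_zero _ _ (by omega), map_zero]

/-- The weights of the bihomogeneous coordinates. -/
abbrev biweight (N m : ℕ) : PluckerIdx N m ⊕ Fin (N + 1) → ℕ × ℕ :=
  Sum.elim (fun _ => ((1, 0) : ℕ × ℕ)) fun _ => (0, 1)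

lemma aeval_sumElim_smul {A : Type*} [CommRing A] [Algebra k A]
    {G : MvPolynomial (PluckerIdx N m ⊕ Fin (N + 1)) k} {d : ℕ × ℕ}
    (hG : IsWeightedHomogeneous (biweight N m) G d) (s t : A) (p : PluckerIdx N m → A)
    (v : Fin (N + 1) → A) :
    aeval (Sum.elim (s • p) (t • v)) G = s ^ d.1 * t ^ d.2 * aeval (Sum.elim p v) G := by
  let χ : Multiplicative (ℕ × ℕ) →* A :=
    { toFun := fun a => s ^ a.toAdd.1 * t ^ a.toAdd.2
      map_one' := by simp
      map_mul' := fun a b => by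
        simp only [toAdd_mul, Prod.fst_add, Prod.snd_add, pow_add]
        ring }
  rw [show s ^ d.1 * t ^ d.2 = χ (Multiplicative.ofAdd d) from rfl, ← aeval_torus_smul hG χ]
  congr 2
  ext i
  rcases i with i | i <;> simp [χ]

/-- A bihomogeneous polynomial vanishes at all the coordinate vectors of a point or at none. -/
lemma eval_prodReps_eq_zero {z : GrProd k N m} {F : MvPolynomial (PluckerIdx N m ⊕ Fin (N + 1)) k}
    {d : ℕ × ℕ} (hF : IsWeightedHomogeneous (biweight N m) F d)
    {q q' : PluckerIdx N m ⊕ Fin (N + 1) → k} (hq : q ∈ prodReps z) (hq' : q' ∈ prodReps z)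
    (h : eval q F = 0) : eval q' F = 0 := by
  obtain ⟨p, hp, v, hv, rfl⟩ := hq
  obtain ⟨p', hp', v', hv', rfl⟩ := hq'
  obtain ⟨c, -, rfl⟩ := exists_smul_of_mem_planeReps hp hp'
  obtain ⟨c', -, rfl⟩ := exists_smul_of_mem_pointReps hv hv'
  have h1 := aeval_sumElim_smul hF c c' p v
  rwa [aeval_eq_eval_apply (Sum.elim p v), h, mul_zero, aeval_eq_eval_apply] at h1

lemma prodReps_nonempty (z : GrProd k N m) : (prodReps z).Nonempty := by
  obtain ⟨p, hp⟩ := planeReps_nonempty z.plane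
  obtain ⟨v, hv⟩ := pointReps_nonempty z.point
  exact ⟨_, p, hp, v, hv, rfl⟩

/-- Vanishing of a bihomogeneous polynomial passes to the closure. -/
lemma eval_eq_zero_of_mem_closure {S : Set (GrProd k N m)} {z : GrProd k N m} (hz : z ∈ closure S)
    {F : MvPolynomial (PluckerIdx N m ⊕ Fin (N + 1)) k} {d : ℕ × ℕ}
    (hF : IsWeightedHomogeneous (biweight N m) F d)
    (hS : ∀ z' ∈ S, ∀ q ∈ prodReps z', eval q F = 0) {q : PluckerIdx N m ⊕ Fin (N + 1) → k}
    (hq : q ∈ prodReps z) : eval q F = 0 := by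
  obtain ⟨q', hq', h⟩ := exists_eval_eq_zero_of_mem_closure hz hF fun z' hz' => by
    obtain ⟨q, hq⟩ := prodReps_nonempty z'
    exact ⟨q, hq, hS z' hz' q hq⟩
  exact eval_prodReps_eq_zero hF hq' hq h

/-- A point of the product at which all bihomogeneous polynomials of the ideal of a closed set vanish
lies in the closed set. -/
lemma mem_of_forall_eval_eq_zero {S : Set (GrProd k N m)} (hS : IsClosed S) {z : GrProd k N m}
    {q : PluckerIdx N m ⊕ Fin (N + 1) → k} (hq : q ∈ prodReps z)
    (h : ∀ F ∈ idealOf prodReps S, ∀ d : ℕ × ℕ,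
      IsWeightedHomogeneous (biweight N m) F d → eval q F = 0) : z ∈ S := by
  by_contra hz
  rw [← hS.closure_eq] at hz
  obtain ⟨F, d, hF, h1, h2⟩ := exists_separating_of_notMem_closure hz
  refine h1 q hq (h F (mem_idealOf.2 fun z' hz' q' hq' => ?_) d hF)
  obtain ⟨q₁, hq₁, h3⟩ := h2 z' hz'
  exact eval_prodReps_eq_zero hF hq₁ hq' h3

lemma eval_pointReps_eq_zero {x : PSpace k N} {F : MvPolynomial (Fin (N + 1)) k} {d : ℕ}
    (hF : F.IsHomogeneous d) {v v' : Fin (N + 1) → k} (hv : v ∈ pointReps x)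
    (hv' : v' ∈ pointReps x) (h : eval v F = 0) : eval v' F = 0 := by
  obtain ⟨c', -, rfl⟩ := exists_smul_of_mem_pointReps hv hv'
  have := aeval_smul_of_isHomogeneous hF c' v
  rw [aeval_eq_eval_apply, aeval_eq_eval_apply, h, mul_zero] at this
  exact this

lemma mem_of_forall_mem_homIdeal {X : Set (PSpace k N)} (hX : IsClosed X) {x : PSpace k N}
    {v : Fin (N + 1) → k} (hv : v ∈ pointReps x)
    (h : ∀ F ∈ homIdeal X, ∀ d, F.IsHomogeneous d → eval v F = 0) : x ∈ X := by
  by_contra hx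
  rw [← hX.closure_eq] at hx
  obtain ⟨F, d, hF, h1, h2⟩ := exists_separating_of_notMem_closure hx
  refine h1 v hv (h F (mem_idealOf.2 fun z' hz' q' hq' => ?_) d hF)
  obtain ⟨q₁, hq₁, h3⟩ := h2 z' hz'
  exact eval_pointReps_eq_zero hF hq₁ hq' h3

end Ideals

/-! ### Tangency in a Jacobian chart -/

section Tangency

lemma isWeightedHomogeneous_rename {k σ τ : Type*} [CommSemiring k] {f : σ → τ}
    {w : τ → ℕ × ℕ} {u : ℕ × ℕ} (hw : ∀ i, w (f i) = u) {F : MvPolynomial σ k} {d : ℕ}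
    (hF : F.IsHomogeneous d) : IsWeightedHomogeneous w (rename f F) (d • u) := by
  have hF' : IsWeightedHomogeneous 1 F d := hF
  induction hF' using IsWeightedHomogeneous.induction_on with
  | zero => rw [map_zero]; exact isWeightedHomogeneous_zero _ _ _
  | add p q hp' hq' hp hq => rw [map_add]; exact (hp hp').add (hq hq')
  | monomial c r hc =>
    rw [rename_monomial]
    apply isWeightedHomogeneous_monomial
    rw [← hc, Finsupp.weight_apply, Finsupp.weight_apply,
      Finsupp.sum_mapDomain_index (by simp) (by simp [add_smul])]
    simp only [hw, Finsupp.sum, Pi.one_apply, smul_eq_mul, mul_one, Finset.sum_smul]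

variable {k : Type*} [Field k] {N : ℕ}

lemma isWeightedHomogeneous_rename_inl {m d : ℕ} {F : MvPolynomial (PluckerIdx N m) k}
    (hF : F.IsHomogeneous d) : IsWeightedHomogeneous (biweight N m) (rename Sum.inl F) (d, 0) := by
  have := isWeightedHomogeneous_rename (w := biweight N m) (f := Sum.inl) (u := (1, 0))
    (fun _ => rfl) hF
  simpa using this

lemma isWeightedHomogeneous_rename_inr {m d : ℕ} {F : MvPolynomial (Fin (N + 1)) k}
    (hF : F.IsHomogeneous d) : IsWeightedHomogeneous (biweight N m) (rename Sum.inr F) (0, d) := by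
  have := isWeightedHomogeneous_rename (w := biweight N m) (f := Sum.inr) (u := (0, 1))
    (fun _ => rfl) hF
  simpa using this

lemma mem_tangentSpace {X : Set (PSpace k N)} {x : PSpace k N} {w : Fin (N + 1) → k} :
    w ∈ tangentSpace X x ↔ w ∈ tangentAt (homIdeal X) x.rep := by
  simp [tangentSpace, Submodule.mem_iInf, mem_tangentAt, differential, aeval_eq_eval_apply]

lemma tangentSpace_eq [Infinite k] {X : Set (PSpace k N)} {x : PSpace k N} {v : Fin (N + 1) → k}
    (hv : v ∈ pointReps x) : tangentSpace X x = tangentAt (homIdeal X) v := by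
  obtain ⟨c, hc, rfl⟩ := exists_smul_of_mem_pointReps ⟨x.rep_nonzero, x.mk_rep⟩ hv
  ext w
  rw [mem_tangentSpace, (homIdeal_isHomog X).tangentAt_smul _ hc]

variable {X : Set (PSpace k N)} {I₀ : Finset (Fin (N + 1))} (J : JacobianChart (homIdeal X) I₀)

/-- Polynomial vectors which span the tangent space where the Jacobian minor does not vanish. -/
def JacobianChart.tangentVector (i l : Fin (N + 1)) : MvPolynomial (Fin (N + 1)) k :=
  if l ∈ I₀ then if l = i then J.h else 0 else J.b l i

lemma JacobianChart.tangentVector_homog (i l : Fin (N + 1)) :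
    (J.tangentVector i l).IsHomogeneous J.deg := by
  unfold JacobianChart.tangentVector
  split_ifs
  · exact J.h_homog
  · exact isHomogeneous_zero _ _ _
  · exact J.b_homog l i

lemma aeval_eq_zero_of_mem {x : PSpace k N} (hx : x ∈ X) {v : Fin (N + 1) → k}
    (hv : v ∈ pointReps x) : ∀ F ∈ homIdeal X, aeval v F = 0 := fun F hF => by
  rw [aeval_eq_eval_apply]
  exact mem_idealOf.1 hF x hx v hv

lemma JacobianChart.tangentSpace_le_iff [Infinite k] {x : PSpace k N} (hx : x ∈ X)
    {v : Fin (N + 1) → k} (hv : v ∈ pointReps x) (hh : eval v J.h ≠ 0)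
    (L : Submodule k (Fin (N + 1) → k)) :
    tangentSpace X x ≤ L ↔ ∀ i ∈ I₀, (fun l => eval v (J.tangentVector i l)) ∈ L := by
  have hh' : aeval v J.h ≠ 0 := by rwa [aeval_eq_eval_apply]
  rw [tangentSpace_eq hv]
  constructor
  · intro h i hi
    apply h
    rw [J.mem_tangentAt_iff (aeval_eq_zero_of_mem hx hv) hh']
    intro l hl
    simp only [tangentVector, hl, if_false]
    rw [Finset.sum_eq_single i]
    · rw [if_pos hi, if_pos rfl, aeval_eq_eval_apply, aeval_eq_eval_apply, mul_comm]
    · intro j hj hji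
      rw [if_pos hj, if_neg hji, map_zero, mul_zero]
    · exact fun h => absurd hi h
  · intro h w hw
    rw [J.mem_tangentAt_iff (aeval_eq_zero_of_mem hx hv) hh'] at hw
    simp only [aeval_eq_eval_apply] at hw
    have h1 : eval v J.h • w = ∑ i ∈ I₀, w i • fun l => eval v (J.tangentVector i l) := by
      ext l
      simp only [Pi.smul_apply, Finset.sum_apply, smul_eq_mul]
      by_cases hl : l ∈ I₀
      · simp only [tangentVector, hl, if_true, apply_ite (eval v), map_zero, mul_ite, mul_zero,
          Finset.sum_ite_eq]
        ring
      · simp only [tangentVector, hl, if_false, hw l hl]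
        exact Finset.sum_congr rfl fun i _ => mul_comm _ _
    have h2 : eval v J.h • w ∈ L := by
      rw [h1]
      exact L.sum_mem fun i hi => L.smul_mem _ (h i hi)
    exact (L.smul_mem_iff hh).1 h2

lemma finrank_graph {E σ : Type*} [Field E] [Fintype σ] [DecidableEq σ] (I₀ : Finset σ)
    (T : Submodule E (σ → E)) {h : E} (hh : h ≠ 0) (b : σ → σ → E)
    (hT : ∀ w, w ∈ T ↔ ∀ l ∉ I₀, h * w l = ∑ i ∈ I₀, b l i * w i) :
    Module.finrank E T = I₀.card := by
  let φ : T →ₗ[E] (I₀ → E) := (LinearMap.funLeft E E ((↑) : I₀ → σ)).comp T.subtype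
  have hφ : Function.Bijective φ := by
    constructor
    · rw [injective_iff_map_eq_zero]
      rintro ⟨w, hw⟩ h0
      have h1 : ∀ i ∈ I₀, w i = 0 := fun i hi => congrFun h0 ⟨i, hi⟩
      ext l
      by_cases hl : l ∈ I₀
      · exact h1 l hl
      · have h2 := (hT w).1 hw l hl
        rw [Finset.sum_eq_zero fun i hi => by rw [h1 i hi, mul_zero]] at h2
        exact (mul_eq_zero.1 h2).resolve_left hh
    · intro f
      let g : σ → E := fun i => if hi : i ∈ I₀ then f ⟨i, hi⟩ else 0
      let w : σ → E := fun l => if l ∈ I₀ then g l else h⁻¹ * ∑ i ∈ I₀, b l i * g i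
      have hw : w ∈ T := by
        rw [hT]
        intro l hl
        simp only [w, hl, if_false]
        rw [mul_inv_cancel_left₀ hh]
        exact Finset.sum_congr rfl fun i hi => by rw [if_pos hi]
      refine ⟨⟨w, hw⟩, ?_⟩
      ext ⟨i, hi⟩
      simp [φ, w, g, hi]
  rw [(LinearEquiv.ofBijective φ hφ).finrank_eq, Module.finrank_fintype_fun_eq_card,
    Fintype.card_coe]

lemma JacobianChart.mem_smoothLocus [Infinite k] {n : ℕ} (hcard : I₀.card = n + 1) {x : PSpace k N}
    (hx : x ∈ X) {v : Fin (N + 1) → k} (hv : v ∈ pointReps x) (hh : eval v J.h ≠ 0) :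
    x ∈ smoothLocus X n := by
  refine ⟨hx, ?_⟩
  have hh' : aeval v J.h ≠ 0 := by rwa [aeval_eq_eval_apply]
  rw [tangentSpace_eq hv, ← hcard]
  exact finrank_graph I₀ _ hh' (fun l i => aeval v (J.b l i))
    fun w => J.mem_tangentAt_iff (aeval_eq_zero_of_mem hx hv) hh'

variable {n m : ℕ}

lemma plane_mem_iff (L : Gr k N m) {v : Fin (m + 1) → Fin (N + 1) → k}
    (hv : Submodule.span k (Set.range v) = L.1) (w : Fin (N + 1) → k) :
    w ∈ L.1 ↔ ∀ K : Fin (m + 2) ↪o Fin (N + 1),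
      ∑ a : Fin (m + 2), (-1) ^ (a : ℕ) * w (K a) *
        plucker v ((Fin.succAboveOrderEmb a).trans K) = 0 := by
  rw [← hv, mem_span_iff_minor (linearIndependent_of_span_eq L hv)]
  rfl

lemma point_mem_of_mem_conormal (hX : IsClosed X) {z : GrProd k N m} (hz : z ∈ conormal X n m) :
    z.point ∈ X := by
  obtain ⟨p, hp⟩ := planeReps_nonempty z.plane
  obtain ⟨v, hv⟩ := pointReps_nonempty z.point
  refine mem_of_forall_mem_homIdeal hX hv fun F hF d hd => ?_
  have := eval_eq_zero_of_mem_closure hz (isWeightedHomogeneous_rename_inr hd) ?_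
    ⟨p, hp, v, hv, rfl⟩
  · rwa [eval_rename, Sum.elim_comp_inr] at this
  · rintro z' ⟨⟨hz', -⟩, -⟩ _ ⟨p', -, v', hv', rfl⟩
    rw [eval_rename, Sum.elim_comp_inr]
    exact mem_idealOf.1 hF _ hz' v' hv'

/-- Over the open set where the Jacobian minor does not vanish, `P_m^X` consists of the pairs of a
smooth point and a plane tangent at it. -/
lemma JacobianChart.tangent_of_mem_conormal [Infinite k] (hX : IsClosed X)
    (hcard : I₀.card = n + 1) {z : GrProd k N m}
    (hz : z ∈ conormal X n m) {v : Fin (N + 1) → k} (hv : v ∈ pointReps z.point)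
    (hh : eval v J.h ≠ 0) : z.point ∈ smoothLocus X n ∧ tangentSpace X z.point ≤ z.plane.1 := by
  have hx := point_mem_of_mem_conormal hX hz
  refine ⟨J.mem_smoothLocus hcard hx hv hh, (J.tangentSpace_le_iff hx hv hh _).2 fun i hi => ?_⟩
  obtain ⟨u, hu⟩ := exists_basis_plane z.plane
  rw [plane_mem_iff _ hu]
  intro K
  let F : MvPolynomial (PluckerIdx N m ⊕ Fin (N + 1)) k := rename Sum.inr J.h *
    ∑ a : Fin (m + 2), rename Sum.inl ((-1) ^ (a : ℕ) *
      MvPolynomial.X ((Fin.succAboveOrderEmb a).trans K)) *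
      rename Sum.inr (J.tangentVector i (K a))
  have hF : IsWeightedHomogeneous (biweight N m) F ((0, J.deg) + ((1, 0) + (0, J.deg))) := by
    refine (isWeightedHomogeneous_rename_inr J.h_homog).mul ?_
    refine IsWeightedHomogeneous.sum _ _ _ fun a _ =>
      IsWeightedHomogeneous.mul (isWeightedHomogeneous_rename_inl ?_)
        (isWeightedHomogeneous_rename_inr (J.tangentVector_homog i _))
    have h1 : ((-1) ^ (a : ℕ) : MvPolynomial (PluckerIdx N m) k).IsHomogeneous 0 := by
      have := isHomogeneous_C (PluckerIdx N m) ((-1 : k) ^ (a : ℕ))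
      simpa using this
    simpa using h1.mul (isHomogeneous_X k ((Fin.succAboveOrderEmb a).trans K))
  have heval : ∀ (p : PluckerIdx N m → k) (v : Fin (N + 1) → k), eval (Sum.elim p v) F =
      eval v J.h * ∑ a : Fin (m + 2), (-1) ^ (a : ℕ) * eval v (J.tangentVector i (K a)) *
        p ((Fin.succAboveOrderEmb a).trans K) := by
    intro p v
    simp only [F, map_mul, map_sum, eval_rename, Sum.elim_comp_inr, map_pow,
      map_neg, map_one, rename_X, eval_X, Sum.elim_inl]
    congr 1
    exact Finset.sum_congr rfl fun a _ => by ring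
  have h2 := eval_eq_zero_of_mem_closure hz hF ?_ ⟨_, ⟨u, hu, rfl⟩, v, hv, rfl⟩
  · rw [heval] at h2
    exact (mul_eq_zero.1 h2).resolve_left hh
  · rintro z' ⟨⟨hz', -⟩, hz'T⟩ _ ⟨_, ⟨u', hu', rfl⟩, v', hv', rfl⟩
    rw [heval]
    by_cases hh' : eval v' J.h = 0
    · rw [hh', zero_mul]
    · rw [(plane_mem_iff _ hu' _).1 ((J.tangentSpace_le_iff hz' hv' hh' _).1 hz'T i hi) K, mul_zero]

end Tangency

/-! ### The chart of tangent planes -/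

section ChartRows

variable {E : Type*} {N m : ℕ} (I₀ : Finset (Fin (N + 1))) (j : Fin (m + 1) → Fin (N + 1))

/-- The vector of the tangent space with pivot `i`, scaled by `h`. -/
def graphVector [Zero E] (h : E) (b : Fin (N + 1) → Fin (N + 1) → E) (i l : Fin (N + 1)) : E :=
  if l ∈ I₀ then if l = i then h else 0 else b l i

/-- The matrix, in `h` times an echelon form with pivot columns `j`, of a general plane containing
the graph of `b / h`: the rows with pivots outside `I₀` are free with parameters `a`, and those
with pivots in `I₀` are then determined. -/
def chartRow [CommRing E] (h : E) (b : Fin (N + 1) → Fin (N + 1) → E)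
    (a : Fin (m + 1) → Fin (N + 1) → E) (r : Fin (m + 1)) (l : Fin (N + 1)) : E :=
  open Classical in
  if l ∈ Set.range j then if l = j r then h else 0
  else if j r ∈ I₀ then b l (j r) - ∑ r', if j r' ∈ I₀ then 0 else b (j r') (j r) * a r' l
  else h * a r l

variable {I₀ j}

lemma map_chartRow {E' : Type*} [CommRing E] [CommRing E'] (φ : E →+* E') (h : E)
    (b : Fin (N + 1) → Fin (N + 1) → E) (a : Fin (m + 1) → Fin (N + 1) → E) (r : Fin (m + 1))
    (l : Fin (N + 1)) : φ (chartRow I₀ j h b a r l) =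
      chartRow I₀ j (φ h) (fun l i => φ (b l i)) (fun r l => φ (a r l)) r l := by
  unfold chartRow
  split_ifs <;> simp [apply_ite φ]

lemma chartRow_pivot [CommRing E] (hj : Function.Injective j) (h : E)
    (b : Fin (N + 1) → Fin (N + 1) → E)
    (a : Fin (m + 1) → Fin (N + 1) → E) (r r' : Fin (m + 1)) :
    chartRow I₀ j h b a r (j r') = if r = r' then h else 0 := by
  simp [chartRow, hj.eq_iff, eq_comm]

/-- The tangent space is contained in the planes of the chart. -/
lemma smul_graphVector [CommRing E] (hj : Function.Injective j) (hI₀ : ∀ i ∈ I₀, i ∈ Set.range j)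
    (h : E) (b : Fin (N + 1) → Fin (N + 1) → E)
    (a : Fin (m + 1) → Fin (N + 1) → E) {i : Fin (N + 1)} (hi : i ∈ I₀) :
    h • graphVector I₀ h b i = ∑ r, graphVector I₀ h b i (j r) • chartRow I₀ j h b a r := by
  classical
  ext l
  simp only [Pi.smul_apply, Finset.sum_apply, smul_eq_mul]
  by_cases hl : l ∈ Set.range j
  · obtain ⟨r, rfl⟩ := hl
    simp only [chartRow_pivot hj, mul_ite, mul_zero, Finset.sum_ite_eq', Finset.mem_univ, if_true]
    ring
  · have hl' : l ∉ I₀ := fun h => hl (hI₀ l h)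
    obtain ⟨s, rfl⟩ := hI₀ i hi
    have h1 : ∀ r, graphVector I₀ h b (j s) (j r) * chartRow I₀ j h b a r l =
        (if r = s then h * chartRow I₀ j h b a s l else 0) +
          h * (if j r ∈ I₀ then 0 else b (j r) (j s) * a r l) := by
      intro r
      by_cases hr : j r ∈ I₀
      · simp only [graphVector, hr, if_true, hj.eq_iff, ite_mul, zero_mul, mul_zero, add_zero]
        split_ifs with h2
        · rw [h2]
        · rfl
      · have hrs : r ≠ s := fun h => hr (h ▸ hi)
        simp only [graphVector, hr, if_false, hrs, zero_add]
        rw [chartRow, if_neg hl, if_neg hr]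
        ring
    rw [Finset.sum_congr rfl fun r _ => h1 r, Finset.sum_add_distrib, Finset.sum_ite_eq',
      if_pos (Finset.mem_univ s), ← Finset.mul_sum, ← mul_add]
    congr 1
    rw [chartRow, if_neg hl, if_pos hi, sub_add_cancel, graphVector, if_neg hl']

variable [Field E]

lemma echelon_chartRow (hj : Function.Injective j) {h : E} (hh : h ≠ 0)
    (b : Fin (N + 1) → Fin (N + 1) → E) (a : Fin (m + 1) → Fin (N + 1) → E) (r r' : Fin (m + 1)) :
    (h⁻¹ • chartRow I₀ j h b a) r (j r') = if r = r' then 1 else 0 := by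
  simp [chartRow_pivot hj, hh]

lemma minor_chartRow {h : E} (hh : h ≠ 0)
    (b : Fin (N + 1) → Fin (N + 1) → E) (a : Fin (m + 1) → Fin (N + 1) → E)
    (f : Fin (m + 1) → Fin (N + 1)) :
    minor (chartRow I₀ j h b a) f = h ^ (m + 1) * minor (h⁻¹ • chartRow I₀ j h b a) f := by
  rw [← minor_smul, smul_inv_smul₀ hh]

lemma minor_chartRow_pivots (hj : Function.Injective j) {h : E} (hh : h ≠ 0)
    (b : Fin (N + 1) → Fin (N + 1) → E) (a : Fin (m + 1) → Fin (N + 1) → E) :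
    minor (chartRow I₀ j h b a) j = h ^ (m + 1) := by
  rw [minor_chartRow hh, minor_of_echelon (echelon_chartRow hj hh b a), mul_one]

/-- Every plane containing the tangent space and projecting isomorphically to the pivot coordinates
belongs to the chart. -/
lemma exists_chartRow (hj : Function.Injective j) (hI₀ : ∀ i ∈ I₀, i ∈ Set.range j) {h : E}
    (hh : h ≠ 0) (b : Fin (N + 1) → Fin (N + 1) → E) {u : Fin (m + 1) → Fin (N + 1) → E}
    (hu : ∀ i ∈ I₀, graphVector I₀ h b i ∈ Submodule.span E (Set.range u))
    (hminor : minor u j ≠ 0) :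
    ∃ (a : Fin (m + 1) → Fin (N + 1) → E) (t : E), t ≠ 0 ∧
      ∀ f, minor u f = t * minor (chartRow I₀ j h b a) f := by
  classical
  let U : Matrix (Fin (m + 1)) (Fin (m + 1)) E := Matrix.of fun r s => u r (j s)
  have hU : IsUnit U.det := isUnit_iff_ne_zero.2 hminor
  let a : Fin (m + 1) → Fin (N + 1) → E := fun r l => ∑ s, U⁻¹ r s * u s l
  have hua : u = fun r l => ∑ s, U r s * a s l := by
    have h1 : U * (U⁻¹ * Matrix.of u) = Matrix.of u := by
      rw [← Matrix.mul_assoc, Matrix.mul_nonsing_inv U hU, Matrix.one_mul]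
    ext r l
    exact (congrFun (congrFun h1 r) l).symm
  have ha : ∀ r s, a r (j s) = if r = s then 1 else 0 := by
    intro r s
    have h1 := congrFun (congrFun (Matrix.nonsing_inv_mul U hU) r) s
    rw [Matrix.one_apply] at h1
    exact h1
  have hspan : ∀ w ∈ Submodule.span E (Set.range u), ∀ l, w l = ∑ r, w (j r) * a r l := by
    intro w hw
    induction hw using Submodule.span_induction with
    | mem w hw =>
      obtain ⟨r, rfl⟩ := hw
      intro l
      conv_lhs => rw [hua]
      rfl
    | zero => simp
    | add x y _ _ hx hy =>
      intro l
      simp only [Pi.add_apply, add_mul, Finset.sum_add_distrib, ← hx, ← hy]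
    | smul c x _ hx =>
      intro l
      simp only [Pi.smul_apply, smul_eq_mul, mul_assoc, ← Finset.mul_sum, ← hx]
  have hrow : chartRow I₀ j h b a = h • a := by
    ext r l
    simp only [Pi.smul_apply, smul_eq_mul]
    by_cases hl : l ∈ Set.range j
    · obtain ⟨s, rfl⟩ := hl
      rw [chartRow_pivot hj, ha]
      simp
    · have hl' : l ∉ I₀ := fun h => hl (hI₀ l h)
      by_cases hr : j r ∈ I₀
      · rw [chartRow, if_neg hl, if_pos hr, sub_eq_iff_eq_add]
        have h1 := hspan _ (hu _ hr) l
        rw [graphVector, if_neg hl'] at h1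
        rw [h1]
        have h2 : ∀ s, graphVector I₀ h b (j r) (j s) * a s l = (if s = r then h * a r l else 0) +
            if j s ∈ I₀ then 0 else b (j s) (j r) * a s l := by
          intro s
          by_cases hs : j s ∈ I₀
          · simp only [graphVector, hs, if_true, hj.eq_iff, add_zero, ite_mul, zero_mul]
            split_ifs with h3
            · rw [h3]
            · rfl
          · have hsr : s ≠ r := fun h => hs (h ▸ hr)
            simp [graphVector, hs, hsr]
        rw [Finset.sum_congr rfl fun s _ => h2 s, Finset.sum_add_distrib, Finset.sum_ite_eq',
          if_pos (Finset.mem_univ r)]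
      · rw [chartRow, if_neg hl, if_neg hr]
  refine ⟨a, U.det * (h ^ (m + 1))⁻¹, mul_ne_zero hminor (inv_ne_zero (pow_ne_zero _ hh)), ?_⟩
  intro f
  rw [hrow, minor_smul, mul_assoc, inv_mul_cancel_left₀ (pow_ne_zero _ hh)]
  conv_lhs => rw [hua]
  exact minor_mul U a f

end ChartRows

/-! ### The generic point of the conormal variety -/

section Universal

variable {k : Type*} [Field k] {N : ℕ} {ι : Type*}

/-- Evaluation of a polynomial with polynomial coefficients. -/
def iteratedEval {K Ω : Type*} [CommRing K] [Algebra k K] [CommRing Ω] [Algebra k Ω] [Algebra K Ω]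
    [IsScalarTower k K Ω] (ξ : Fin (N + 1) → K) (c : ι → Ω) :
    MvPolynomial ι (MvPolynomial (Fin (N + 1)) k) →ₐ[k] Ω :=
  ((aeval c : MvPolynomial ι K →ₐ[K] Ω).restrictScalars k).comp (mapAlgHom (aeval ξ))

variable {K Ω : Type*} [Field K] [Algebra k K] [Field Ω] [Algebra k Ω] [Algebra K Ω]
    [IsScalarTower k K Ω]

lemma iteratedEval_X (ξ : Fin (N + 1) → K) (c : ι → Ω) (i : ι) :
    iteratedEval (k := k) ξ c (X i) = c i := by
  simp [iteratedEval]

lemma iteratedEval_C (ξ : Fin (N + 1) → K) (c : ι → Ω) (F : MvPolynomial (Fin (N + 1)) k) :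
    iteratedEval ξ c (C F) = algebraMap K Ω (aeval ξ F) := by
  change aeval c (mapAlgHom (aeval ξ) (C F)) = _
  rw [mapAlgHom_apply, map_C, aeval_C]
  rfl

/-- An identity holds at a generic point of `X` with independent parameters if and only if it
holds at all points of `X` and for all values of the parameters. -/
lemma iteratedEval_eq_zero_iff [Infinite k] {X : Set (PSpace k N)} {ξ : Fin (N + 1) → K}
    (hξ : IsGenericPoint (homIdeal X) ξ) {c : ι → Ω} (hc : AlgebraicIndependent K c)
    (Q : MvPolynomial ι (MvPolynomial (Fin (N + 1)) k)) :
    iteratedEval ξ c Q = 0 ↔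
      ∀ x ∈ X, ∀ v ∈ pointReps x, ∀ α : ι → k, iteratedEval v α Q = 0 := by
  have h1 : iteratedEval ξ c Q = 0 ↔ ∀ s, coeff s Q ∈ homIdeal X := by
    have : iteratedEval ξ c Q = aeval c (mapAlgHom (aeval ξ) Q) := rfl
    rw [this, map_eq_zero_iff _ hc, MvPolynomial.ext_iff]
    refine forall_congr' fun s => ?_
    rw [mapAlgHom_apply, coeff_map, coeff_zero]
    exact hξ.aeval_eq_zero_iff
  have h2 : ∀ v : Fin (N + 1) → k, (∀ α : ι → k, iteratedEval v α Q = 0) ↔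
      ∀ s, eval v (coeff s Q) = 0 := by
    intro v
    have h3 : (∀ s, eval v (coeff s Q) = 0) ↔ mapAlgHom (aeval v : _ →ₐ[k] k) Q = 0 := by
      rw [MvPolynomial.ext_iff]
      refine forall_congr' fun s => ?_
      rw [mapAlgHom_apply, coeff_map, coeff_zero, ← aeval_eq_eval_apply]
      rfl
    rw [h3]
    constructor
    · intro h
      refine MvPolynomial.funext fun α => ?_
      rw [map_zero, ← h α, ← aeval_eq_eval_apply]
      rfl
    · intro h α
      have : iteratedEval v α Q = aeval α (mapAlgHom (aeval v : _ →ₐ[k] k) Q) := rfl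
      rw [this, h, map_zero]
  rw [h1]
  constructor
  · exact fun h x hx v hv => (h2 v).2 fun s => mem_idealOf.1 (h s) x hx v hv
  · exact fun h s => mem_idealOf.2 fun x hx v hv => (h2 v).1 (h x hx v hv) s

end Universal

section GenericPoint

variable {k : Type*} [Field k] {N n m : ℕ} {X : Set (PSpace k N)} {I₀ : Finset (Fin (N + 1))}
  (J : JacobianChart (homIdeal X) I₀) (j : PluckerIdx N m)

/-- The rows of the matrix of a plane of the chart that is tangent at the point `v`. -/
def JacobianChart.row {E : Type*} [CommRing E] [Algebra k E] (v : Fin (N + 1) → E)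
    (a : Fin (m + 1) → Fin (N + 1) → E) : Fin (m + 1) → Fin (N + 1) → E :=
  chartRow I₀ j (aeval v J.h) (fun l i => aeval v (J.b l i)) a

/-- The bihomogeneous coordinates of the point of `P_m^X` with parameters `v`, `a`, `t`. -/
def JacobianChart.chartPoint {E : Type*} [CommRing E] [Algebra k E] (v : Fin (N + 1) → E)
    (a : Fin (m + 1) → Fin (N + 1) → E) (t : E) : PluckerIdx N m ⊕ Fin (N + 1) → E :=
  Sum.elim (fun f => t * minor (J.row j v a) f) v

lemma JacobianChart.map_chartPoint {E E' : Type*} [CommRing E] [Algebra k E] [CommRing E']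
    [Algebra k E'] (ψ : E →ₐ[k] E') (v : Fin (N + 1) → E)
    (a : Fin (m + 1) → Fin (N + 1) → E) (t : E) :
    (fun i => ψ (J.chartPoint j v a t i)) =
      J.chartPoint j (fun l => ψ (v l)) (fun r l => ψ (a r l)) (ψ t) := by
  have hψ : ∀ F, ψ (aeval v F) = aeval (fun l => ψ (v l)) F := fun F => by
    rw [← comp_aeval_apply]
  ext i
  rcases i with f | l
  · have h1 := map_minor (ψ : E →+* E') (J.row j v a) f
    change ψ _ = minor (fun r l => ψ (J.row j v a r l)) f at h1
    have h2 : (fun r l => ψ (J.row j v a r l)) =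
        J.row j (fun l => ψ (v l)) (fun r l => ψ (a r l)) := by
      ext r l
      have h3 := map_chartRow (I₀ := I₀) (j := j) (ψ : E →+* E') (aeval v J.h)
        (fun l i => aeval v (J.b l i)) a r l
      change ψ _ = chartRow I₀ j (ψ _) (fun l i => ψ _) (fun r l => ψ _) r l at h3
      rw [row, h3]
      simp only [hψ, row]
    simp only [chartPoint, Sum.elim_inl, map_mul, h1, h2]
  · rfl

lemma JacobianChart.aeval_chartPoint_map {E E' : Type*} [CommRing E] [Algebra k E] [CommRing E']
    [Algebra k E'] (ψ : E →ₐ[k] E') (v : Fin (N + 1) → E)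
    (a : Fin (m + 1) → Fin (N + 1) → E) (t : E)
    (G : MvPolynomial (PluckerIdx N m ⊕ Fin (N + 1)) k) :
    ψ (aeval (J.chartPoint j v a t) G) =
      aeval (J.chartPoint j (fun l => ψ (v l)) (fun r l => ψ (a r l)) (ψ t)) G := by
  rw [← map_chartPoint, ← comp_aeval_apply]

variable {j}

/-- The points of the chart lie on `P_m^X`. -/
lemma JacobianChart.exists_mem_conormal [Infinite k] (hcard : I₀.card = n + 1)
    (hj : ∀ i ∈ I₀, i ∈ Set.range j) {x : PSpace k N} (hx : x ∈ X)
    {v : Fin (N + 1) → k} (hv : v ∈ pointReps x) (hh : eval v J.h ≠ 0)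
    (a : Fin (m + 1) → Fin (N + 1) → k) {t : k} (ht : t ≠ 0) :
    ∃ z ∈ conormal X n m, J.chartPoint j v a t ∈ prodReps z := by
  have hli : LinearIndependent k (J.row j v a) := by
    refine linearIndependent_of_minor_ne_zero (f := j) ?_
    rw [row, aeval_eq_eval_apply, minor_chartRow_pivots j.injective hh]
    exact pow_ne_zero _ hh
  let L : Gr k N m := ⟨Submodule.span k (Set.range (J.row j v a)), by
    rw [finrank_span_eq_card hli, Fintype.card_fin]⟩
  refine ⟨⟨L, x⟩, subset_closure ⟨J.mem_smoothLocus hcard hx hv hh,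
    (J.tangentSpace_le_iff hx hv hh _).2 fun i hi => ?_⟩,
    _, smul_mem_planeReps (L := L) ⟨_, rfl, rfl⟩ ht, v, hv, rfl⟩
  have h1 := smul_graphVector j.injective hj (aeval v J.h) (fun l i => aeval v (J.b l i)) a hi
  have h2 : (fun l => eval v (J.tangentVector i l)) =
      graphVector I₀ (aeval v J.h) (fun l i => aeval v (J.b l i)) i := by
    ext l
    unfold tangentVector graphVector
    split_ifs <;> simp [aeval_eq_eval_apply]
  rw [h2, ← L.1.smul_mem_iff (s := aeval v J.h) (by rwa [aeval_eq_eval_apply]), h1]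
  exact Submodule.sum_mem _ fun r _ => Submodule.smul_mem _ _ (Submodule.subset_span ⟨r, rfl⟩)

lemma JacobianChart.X_pivot_notMem (J : JacobianChart (homIdeal X) I₀) [Infinite k]
    (hcard : I₀.card = n + 1)
    (hj : ∀ i ∈ I₀, i ∈ Set.range j) :
    MvPolynomial.X (Sum.inl j) ∉ idealOf prodReps (conormal X n m) := by
  obtain ⟨x, hx, v, hv, hh⟩ : ∃ x ∈ X, ∃ v ∈ pointReps x, eval v J.h ≠ 0 := by
    by_contra! h
    exact J.h_notMem (mem_idealOf.2 h)
  obtain ⟨z, hz, hq⟩ := J.exists_mem_conormal hcard hj hx hv hh 0 one_ne_zero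
  intro h
  have h1 := mem_idealOf.1 h z hz _ hq
  rw [eval_X, chartPoint, Sum.elim_inl, one_mul, row, aeval_eq_eval_apply,
    minor_chartRow_pivots j.injective hh] at h1
  exact pow_ne_zero _ hh h1

lemma JacobianChart.mem_homIdeal_of_rename_mem (J : JacobianChart (homIdeal X) I₀) [Infinite k]
    (hcard : I₀.card = n + 1) (hj : ∀ i ∈ I₀, i ∈ Set.range j) [hirr : (homIdeal X).IsPrime]
    {H : MvPolynomial (Fin (N + 1)) k}
    (hH : rename Sum.inr H ∈ idealOf prodReps (conormal X n m)) : H ∈ homIdeal X := by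
  have h1 : J.h * H ∈ homIdeal X := by
    rw [mem_idealOf]
    intro x hx v hv
    rw [map_mul]
    by_cases hh : eval v J.h = 0
    · rw [hh, zero_mul]
    · obtain ⟨z, hz, hq⟩ := J.exists_mem_conormal (m := m) hcard hj hx hv hh 0 one_ne_zero
      have h2 := mem_idealOf.1 hH z hz _ hq
      rw [eval_rename, chartPoint, Sum.elim_comp_inr] at h2
      rw [h2, mul_zero]
  exact (hirr.mem_or_mem h1).resolve_left J.h_notMem

/-- On the locus where the chart is defined, all the coordinates of points of `P_m^X` arise from
the chart. -/
lemma JacobianChart.exists_eq_chartPoint [Infinite k] (hX : IsClosed X) (hcard : I₀.card = n + 1)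
    (hj : ∀ i ∈ I₀, i ∈ Set.range j) {z : GrProd k N m} (hz : z ∈ conormal X n m)
    {q : PluckerIdx N m ⊕ Fin (N + 1) → k} (hq : q ∈ prodReps z)
    (hh : eval (fun l => q (Sum.inr l)) J.h ≠ 0) (hp : q (Sum.inl j) ≠ 0) :
    ∃ x ∈ X, ∃ v ∈ pointReps x, ∃ a t, q = J.chartPoint j v a t := by
  obtain ⟨_, ⟨u, hu, rfl⟩, v, hv, rfl⟩ := hq
  simp only [Sum.elim_inr, Sum.elim_inl] at hh hp
  have hx := point_mem_of_mem_conormal hX hz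
  have h1 := (J.tangentSpace_le_iff hx hv hh _).1
    (J.tangent_of_mem_conormal hX hcard hz hv hh).2
  obtain ⟨a, t, -, h2⟩ := exists_chartRow (u := u) j.injective hj
    (h := aeval v J.h) (by rwa [aeval_eq_eval_apply]) (fun l i => aeval v (J.b l i))
    (fun i hi => by
      rw [hu]
      convert h1 i hi using 1
      ext l
      unfold tangentVector graphVector
      split_ifs <;> simp [aeval_eq_eval_apply]) hp
  refine ⟨_, hx, v, hv, a, t, ?_⟩
  ext i
  rcases i with f | l
  · exact h2 f
  · rfl

variable {K Ω : Type*} [Field K] [Algebra k K] [Field Ω] [Algebra k Ω] [Algebra K Ω]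
    [IsScalarTower k K Ω]

/-- The point of the chart with generic parameters is a zero of exactly the polynomials of the
ideal of `P_m^X`. -/
lemma JacobianChart.aeval_chartPoint_eq_zero_iff [Infinite k] (hX : IsClosed X)
    (hcard : I₀.card = n + 1) (hj : ∀ i ∈ I₀, i ∈ Set.range j)
    [(homIdeal X).IsPrime]
    (hprime : (idealOf prodReps (conormal X n m)).IsPrime) {ξ : Fin (N + 1) → K}
    (hξ : IsGenericPoint (homIdeal X) ξ) {c : Option (Fin (m + 1) × Fin (N + 1)) → Ω}
    (hc : AlgebraicIndependent K c) {G : MvPolynomial (PluckerIdx N m ⊕ Fin (N + 1)) k} :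
    aeval (J.chartPoint j (fun l => algebraMap K Ω (ξ l)) (fun r l => c (some (r, l))) (c none)) G
      = 0 ↔ G ∈ idealOf prodReps (conormal X n m) := by
  let B := MvPolynomial (Option (Fin (m + 1) × Fin (N + 1))) (MvPolynomial (Fin (N + 1)) k)
  let Φ : PluckerIdx N m ⊕ Fin (N + 1) → B :=
    J.chartPoint j (fun l => C (MvPolynomial.X l)) (fun r l => MvPolynomial.X (some (r, l)))
      (MvPolynomial.X none)
  have hΦ : iteratedEval ξ c (aeval Φ G) = aeval (J.chartPoint j (fun l => algebraMap K Ω (ξ l))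
      (fun r l => c (some (r, l))) (c none)) G := by
    rw [aeval_chartPoint_map]
    simp only [iteratedEval_X, iteratedEval_C, aeval_X]
  have hΦk : ∀ (v : Fin (N + 1) → k) (α : Option (Fin (m + 1) × Fin (N + 1)) → k),
      iteratedEval v α (aeval Φ G) =
        eval (J.chartPoint j v (fun r l => α (some (r, l))) (α none)) G := by
    intro v α
    rw [aeval_chartPoint_map, aeval_eq_eval_apply]
    simp only [iteratedEval_X, iteratedEval_C, aeval_X, Algebra.algebraMap_self, RingHom.id_apply]
  have hhξ : aeval ξ J.h ≠ 0 := fun h => J.h_notMem (hξ.aeval_eq_zero_iff.1 h)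
  constructor
  · intro h
    rw [← hΦ, iteratedEval_eq_zero_iff hξ hc] at h
    have h1 : rename Sum.inr J.h * MvPolynomial.X (Sum.inl j) * G ∈
        idealOf prodReps (conormal X n m) := by
      rw [mem_idealOf]
      intro z hz q hq
      rw [map_mul, map_mul, eval_rename, eval_X]
      by_cases hh : eval (q ∘ Sum.inr) J.h = 0
      · rw [hh, zero_mul, zero_mul]
      by_cases hp : q (Sum.inl j) = 0
      · rw [hp, mul_zero, zero_mul]
      obtain ⟨x, hx, v, hv, a, t, rfl⟩ := J.exists_eq_chartPoint hX hcard hj hz hq hh hp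
      have h2 := h x hx v hv fun o => o.elim t fun i => a i.1 i.2
      rw [hΦk] at h2
      exact mul_eq_zero_of_right _ h2
    refine (hprime.mem_or_mem h1).resolve_left fun h2 => ?_
    rcases hprime.mem_or_mem h2 with h3 | h3
    · exact J.h_notMem (J.mem_homIdeal_of_rename_mem hcard hj h3)
    · exact J.X_pivot_notMem hcard hj h3
  · intro hG
    have h1 : iteratedEval ξ c (C J.h * MvPolynomial.X none * aeval Φ G) = 0 := by
      rw [iteratedEval_eq_zero_iff hξ hc]
      intro x hx v hv α
      rw [map_mul, map_mul, iteratedEval_X, iteratedEval_C, hΦk, aeval_eq_eval_apply]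
      by_cases hh : eval v J.h = 0
      · rw [hh, map_zero, zero_mul, zero_mul]
      by_cases ht : α none = 0
      · rw [ht, mul_zero, zero_mul]
      obtain ⟨z, hz, hq⟩ := J.exists_mem_conormal hcard hj hx hv hh
        (fun r l => α (some (r, l))) ht
      rw [mem_idealOf.1 hG z hz _ hq, mul_zero]
    rw [map_mul, map_mul, hΦ, iteratedEval_X, iteratedEval_C] at h1
    refine (mul_eq_zero.1 h1).resolve_left (mul_ne_zero ?_ (hc.ne_zero none))
    exact (map_ne_zero _).2 hhξ

end GenericPoint

/-! ### Derivations along the contact locus -/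

section Extension

/-- Derivations extend to a purely transcendental extension, with prescribed values on the
variables. -/
lemma exists_derivation_extend_of_values {k K Ω ι : Type*} [Field k] [Field K] [Field Ω]
    [Algebra k K] [Algebra k Ω] [Algebra K Ω] [IsScalarTower k K Ω] {c : ι → Ω}
    (hc : AlgebraicIndependent K c)
    (hsep : Algebra.IsSeparable (IntermediateField.adjoin K (Set.range c)) Ω)
    (d : Derivation k K Ω) (f : ι → Ω) :
    ∃ D : Derivation k Ω Ω, (∀ z, D (algebraMap K Ω z) = d z) ∧ ∀ i, D (c i) = f i := by
  have := Algebra.FormallySmooth.of_algebraicIndependent_of_isSeparable hc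
  obtain ⟨D₁, hD₁⟩ := exists_derivation_extend (L := Ω) d
  obtain ⟨D₂, hD₂⟩ := exists_derivation_of_sepGen hc hsep fun i => f i - D₁ (c i)
  refine ⟨D₁ + D₂.restrictScalars k, fun z => ?_, fun i => ?_⟩
  · rw [Derivation.add_apply, hD₁, Derivation.restrictScalars_apply, D₂.map_algebraMap, add_zero]
  · rw [Derivation.add_apply, Derivation.restrictScalars_apply, hD₂, add_sub_cancel]

lemma map_mem_tangentAt {k σ L Ω : Type*} [Field k] [Fintype σ] [Field L] [Field Ω] [Algebra k L]
    [Algebra k Ω] [Algebra L Ω] [IsScalarTower k L Ω] {I : Ideal (MvPolynomial σ k)} {ξ w : σ → L}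
    (hw : w ∈ tangentAt I ξ) :
    (fun l => algebraMap L Ω (w l)) ∈ tangentAt I fun l => algebraMap L Ω (ξ l) := by
  intro F hF
  have h1 := congrArg (algebraMap L Ω) (hw F hF)
  rw [map_zero, map_sum] at h1
  rw [← h1]
  refine Finset.sum_congr rfl fun i _ => ?_
  rw [map_mul]
  congr 1
  exact aeval_algebraMap_apply Ω ξ _

/-- If the cone of `I` has, at the point `x`, a tangent space contained in a hyperplane with
coefficients in `F`, then the derivative of the hyperplane along any derivation of `F` contains the
images of `x` under the `F`-linear functionals: the relation `∑ y_s x_s = x_l` is differentiated, and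
`dx` being tangent, the result is an `F`-linear relation among the coordinates. -/
lemma sum_derivation_mul_functional {k σ τ F L Ω : Type*} [Field k] [Fintype σ] [Fintype τ] [Field F]
    [Field L] [Field Ω] [Algebra k F] [Algebra k L] [Algebra k Ω] [Algebra F L] [Algebra F Ω]
    [IsScalarTower k F L] [IsScalarTower k F Ω]
    [Algebra.FormallySmooth F L] {I : Ideal (MvPolynomial σ k)} {x : σ → L}
    (hx : ∀ G ∈ I, aeval x G = 0) (j : τ → σ) (l : σ) (y : τ → F)
    (hT : ∀ w ∈ tangentAt I x, w l = ∑ s, algebraMap F L (y s) * w (j s))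
    (hxT : x l = ∑ s, algebraMap F L (y s) * x (j s))
    (φ : L →ₗ[F] F) (D : Derivation k F Ω) :
    ∑ s, algebraMap F Ω (φ (x (j s))) * D (y s) = 0 := by
  rw [← Module.forall_dual_apply_eq_zero_iff F]
  intro ρ
  let d : Derivation k F L := (Algebra.linearMap F L).compDer (ρ.compDer D)
  have hd : ∀ z, d z = algebraMap F L (ρ (D z)) := fun z => rfl
  obtain ⟨D', hD'⟩ := exists_derivation_extend (L := L) d
  have h1 := hT _ (derivation_mem_tangentAt hx D')
  have h2 := congrArg D' hxT
  rw [h1, map_sum] at h2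
  simp only [D'.leibniz, hD', hd, Finset.sum_add_distrib, smul_eq_mul] at h2
  have h3 := congrArg φ (left_eq_add.1 h2)
  rw [map_sum, map_zero] at h3
  rw [map_sum, ← h3]
  refine Finset.sum_congr rfl fun s _ => ?_
  rw [← Algebra.smul_def, map_smul, smul_eq_mul, mul_comm (x (j s)), ← Algebra.smul_def, map_smul,
    smul_eq_mul, mul_comm]

end Extension

section Pivots

variable {N m : ℕ} {I₀ : Finset (Fin (N + 1))} {j : Fin (m + 1) → Fin (N + 1)} {E : Type*}

lemma sum_pivots [AddCommMonoid E] (hj : Function.Injective j) (hI₀ : ∀ i ∈ I₀, i ∈ Set.range j)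
    (f : Fin (N + 1) → E) : (∑ s, if j s ∈ I₀ then f (j s) else 0) = ∑ i ∈ I₀, f i := by
  classical
  rw [← Finset.sum_filter]
  have : I₀ = (Finset.univ.filter fun s => j s ∈ I₀).image j := by
    ext i
    simp only [Finset.mem_image, Finset.mem_filter, Finset.mem_univ, true_and]
    constructor
    · intro hi
      obtain ⟨s, rfl⟩ := hI₀ i hi
      exact ⟨s, hi, rfl⟩
    · rintro ⟨s, hs, rfl⟩
      exact hs
  conv_rhs => rw [this, Finset.sum_image hj.injOn]

lemma sum_mul_pivots [CommRing E] (hj : Function.Injective j) (hI₀ : ∀ i ∈ I₀, i ∈ Set.range j)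
    (β w : Fin (N + 1) → E) (γ : Fin (m + 1) → Fin (N + 1) → E) (α : Fin (m + 1) → E) :
    ∑ s, w (j s) * (if j s ∈ I₀ then β (j s) - ∑ r, if j r ∈ I₀ then 0 else γ r (j s) else α s) =
      ∑ i ∈ I₀, w i * β i +
        ∑ r, if j r ∈ I₀ then 0 else α r * w (j r) - ∑ i ∈ I₀, γ r i * w i := by
  have h1 : ∀ s, w (j s) *
      (if j s ∈ I₀ then β (j s) - ∑ r, if j r ∈ I₀ then 0 else γ r (j s) else α s) =
      (if j s ∈ I₀ then w (j s) * β (j s) else 0) -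
      (if j s ∈ I₀ then ∑ r, if j r ∈ I₀ then 0 else γ r (j s) * w (j s) else 0) +
      (if j s ∈ I₀ then 0 else α s * w (j s)) := by
    intro s
    by_cases hs : j s ∈ I₀
    · simp only [hs, if_true, add_zero]
      rw [mul_sub, Finset.mul_sum, mul_comm]
      congr 1
      refine Finset.sum_congr rfl fun r _ => ?_
      split_ifs
      · exact mul_zero _
      · exact mul_comm _ _
    · simp only [hs, if_false, sub_zero, zero_add, mul_comm]
  rw [Finset.sum_congr rfl fun s _ => h1 s, Finset.sum_add_distrib, Finset.sum_sub_distrib,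
    sum_pivots hj hI₀ fun i => w i * β i,
    sum_pivots hj hI₀ fun i => ∑ r, if j r ∈ I₀ then 0 else γ r i * w i, Finset.sum_comm,
    sub_add_eq_add_sub, add_sub_assoc, ← Finset.sum_sub_distrib]
  congr 1
  refine Finset.sum_congr rfl fun r _ => ?_
  split_ifs <;> simp

lemma smul_chartRow_of_notMem [Field E] {h : E} (hh : h ≠ 0) (b : Fin (N + 1) → Fin (N + 1) → E)
    (a : Fin (m + 1) → Fin (N + 1) → E) {l : Fin (N + 1)} (hl : l ∉ Set.range j)
    (s : Fin (m + 1)) : (h⁻¹ • chartRow I₀ j h b a) s l =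
      if j s ∈ I₀ then b l (j s) / h - ∑ r, if j r ∈ I₀ then 0 else b (j r) (j s) / h * a r l
      else a s l := by
  rw [Pi.smul_apply, Pi.smul_apply, chartRow, if_neg hl, smul_eq_mul]
  split_ifs with hs
  · rw [mul_sub, Finset.mul_sum, div_eq_inv_mul]
    congr 1
    refine Finset.sum_congr rfl fun r _ => ?_
    split_ifs
    · exact mul_zero _
    · ring
  · rw [inv_mul_cancel_left₀ hh]

lemma derivation_minor {k : Type*} [CommRing k] [CommRing E] [Algebra k E] (D : Derivation k E E)
    {r s : ℕ} {A : Fin r → Fin s → E} (hA : ∀ r l, D (A r l) = 0) (f : Fin r → Fin s) :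
    D (minor A f) = 0 := by
  let S : Subalgebra k E := Algebra.adjoin k (Set.range fun i : Fin r × Fin s => A i.1 i.2)
  let A' : Fin r → Fin s → S := fun r l => ⟨A r l, Algebra.subset_adjoin ⟨(r, l), rfl⟩⟩
  have h1 : S.val (minor A' f) = minor A f := map_minor (S.val : S →+* E) A' f
  rw [← h1]
  refine Derivation.eqOn_adjoin (D1 := D) (D2 := 0) ?_ (minor A' f).2
  rintro _ ⟨i, rfl⟩
  exact hA _ _

/-- The entries of a matrix in echelon form are quotients of its minors. -/
lemma exists_eq_minor_of_echelon [CommRing E] {j : PluckerIdx N m}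
    {A : Fin (m + 1) → Fin (N + 1) → E}
    (hA : ∀ r s, A r (j s) = if r = s then 1 else 0) (r : Fin (m + 1)) {l : Fin (N + 1)}
    (hl : l ∉ Set.range j) : ∃ (f : PluckerIdx N m) (ε : ℤˣ), A r l = ε * minor A f := by
  have hf : Function.Injective (Function.update j r l) := by
    intro a b hab
    by_cases ha : a = r <;> by_cases hb : b = r
    · rw [ha, hb]
    · rw [ha, Function.update_self, Function.update_of_ne hb] at hab
      exact absurd ⟨b, hab.symm⟩ hl
    · rw [hb, Function.update_self, Function.update_of_ne ha] at hab
      exact absurd ⟨a, hab⟩ hl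
    · rw [Function.update_of_ne ha, Function.update_of_ne hb] at hab
      exact j.injective hab
  obtain ⟨f, τ, hfτ⟩ := exists_orderEmbedding_comp hf
  refine ⟨f, Equiv.Perm.sign τ, ?_⟩
  rw [← minor_update_of_echelon hA, hfτ, minor_comp_perm]

end Pivots

section Functionals

variable {k : Type*} [Field k] {N m : ℕ} {X : Set (PSpace k N)} {I₀ : Finset (Fin (N + 1))}
  (J : JacobianChart (homIdeal X) I₀) {j : PluckerIdx N m}

/-- The derivations of the field of the generic point `ξ` along the basis of the tangent space
commute, and so the coefficients of the tangent space have symmetric derivatives. -/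
lemma JacobianChart.exists_derivation_pivot {K : Type*} [Field K] [Algebra k K]
    {ξ : Fin (N + 1) → K} (hξ : IsGenericPoint (homIdeal X) ξ) :
    ∃ D : Fin (N + 1) → Derivation k K K,
      (∀ i ∈ I₀, ∀ l ∈ I₀, D i (ξ l) = if l = i then 1 else 0) ∧
      (∀ i ∈ I₀, ∀ l ∉ I₀, D i (ξ l) = aeval ξ (J.b l i) / aeval ξ J.h) ∧
      ∀ i ∈ I₀, ∀ i' ∈ I₀, ∀ l ∉ I₀, D i (aeval ξ (J.b l i') / aeval ξ J.h) =
        D i' (aeval ξ (J.b l i) / aeval ξ J.h) := by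
  have hh : aeval ξ J.h ≠ 0 := fun h => J.h_notMem (hξ.aeval_eq_zero_iff.1 h)
  have hzero : ∀ F ∈ homIdeal X, aeval ξ F = 0 := fun F hF => hξ.aeval_eq_zero_iff.2 hF
  let v : Fin (N + 1) → Fin (N + 1) → K := fun i l =>
    if l ∈ I₀ then if l = i then 1 else 0 else aeval ξ (J.b l i) / aeval ξ J.h
  have hv : ∀ i ∈ I₀, v i ∈ tangentAt (homIdeal X) ξ := by
    intro i hi
    rw [J.mem_tangentAt_iff hzero hh]
    intro l hl
    rw [Finset.sum_eq_single_of_mem i hi fun i' hi' hne => by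
      simp only [v, if_pos hi', if_neg hne, mul_zero]]
    simp only [v, if_neg hl, if_pos hi, if_true, mul_one]
    exact mul_div_cancel₀ _ hh
  have hD : ∀ i, ∃ D : Derivation k K K, i ∈ I₀ → ∀ l, D (ξ l) = v i l := by
    intro i
    by_cases hi : i ∈ I₀
    · obtain ⟨D, hD⟩ := hξ.exists_derivation (hv i hi)
      exact ⟨D, fun _ => hD⟩
    · exact ⟨0, fun h => absurd h hi⟩
  choose D hD using hD
  refine ⟨D, fun i hi l hl => by simp only [hD i hi, v, if_pos hl],
    fun i hi l hl => by simp only [hD i hi, v, if_neg hl], fun i hi i' hi' l hl => ?_⟩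
  have h1 : ∀ l ∈ I₀, ⁅D i, D i'⁆ (ξ l) = 0 := by
    intro l hl
    rw [Derivation.commutator_apply, hD i hi, hD i' hi']
    simp only [v, if_pos hl]
    split_ifs <;> simp
  have h2 := (J.mem_tangentAt_iff hzero hh).1 (derivation_mem_tangentAt hzero ⁅D i, D i'⁆) l hl
  rw [Finset.sum_eq_zero fun i hi => by rw [h1 i hi, mul_zero]] at h2
  have h3 := (mul_eq_zero.1 h2).resolve_left hh
  rw [Derivation.commutator_apply, hD i hi, hD i' hi', sub_eq_zero] at h3
  simpa only [v, if_neg hl] using h3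

variable {K Ω F L ι : Type*} [Field K] [Algebra k K] [Field Ω] [Algebra k Ω] [Algebra K Ω]
    [IsScalarTower k K Ω] [Field F] [Algebra k F] [Field L] [Algebra k L] [Algebra F L]
    [Algebra F Ω] [Algebra L Ω] [IsScalarTower k F L] [IsScalarTower k F Ω] [IsScalarTower k L Ω]
    [IsScalarTower F L Ω]

/-- Let `L / F` be a separable extension such as the one of function fields defined by the Gauss map,
`x` the generic point of `X` with coordinates in `L`, in a chart where the Gauss map is given by the
Plücker coordinates of a matrix with general parameters `c`. An `F`-linear functional `φ` on `L` is
tangent to the fibre of the Gauss map: there is an `F`-derivation that maps each `x_l` to `φ(x_l)`. -/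
lemma JacobianChart.exists_derivation_eq_functional [Infinite k] [Algebra.FormallySmooth F L]
    (hj : ∀ i ∈ I₀, i ∈ Set.range j) (hmN : m < N) {ξ : Fin (N + 1) → K}
    (hξ : IsGenericPoint (homIdeal X) ξ) {c : ι → Ω} (hc : AlgebraicIndependent K c)
    (hcsep : Algebra.IsSeparable (IntermediateField.adjoin K (Set.range c)) Ω)
    {p : Fin (m + 1) → Fin (N + 1) → ι} (hp : ∀ r l r' l', p r l = p r' l' → r = r' ∧ l = l')
    {l₀ : Fin (N + 1)} (hl₀ : ξ l₀ ≠ 0) {x : Fin (N + 1) → L}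
    (hx : ∀ l, algebraMap L Ω (x l) = algebraMap K Ω (ξ l / ξ l₀))
    {R : Fin (m + 1) → Fin (N + 1) → Ω}
    (hR : R = J.row j (fun l => algebraMap K Ω (ξ l)) fun r l => c (p r l))
    (hF : ∀ f : PluckerIdx N m, ∃ y : F, algebraMap F Ω y = minor R f / minor R j)
    (hext : ∀ E : Derivation k Ω Ω, (∀ f : PluckerIdx N m, E (minor R f / minor R j) = 0) →
      ∀ y : F, E (algebraMap F Ω y) = 0)
    (φ : L →ₗ[F] F) (hφ : φ 1 = 0) :
    ∃ E : Derivation F L Ω, ∀ l, E (x l) = algebraMap F Ω (φ (x l)) := by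
  classical
  have hzero : ∀ G ∈ homIdeal X, aeval ξ G = 0 := fun G hG => hξ.aeval_eq_zero_iff.2 hG
  have hhK : aeval ξ J.h ≠ 0 := fun h => J.h_notMem (hξ.aeval_eq_zero_iff.1 h)
  let ξ' : Fin (N + 1) → Ω := fun l => algebraMap K Ω (ξ l)
  have hξ' : ∀ G : MvPolynomial (Fin (N + 1)) k,
      aeval ξ' G = algebraMap K Ω (aeval ξ G) := fun G =>
    aeval_algebraMap_apply Ω ξ G
  have hzero' : ∀ G ∈ homIdeal X, aeval ξ' G = 0 := fun G hG => by
    rw [hξ', hzero G hG, map_zero]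
  have hl₀' : ξ' l₀ ≠ 0 := (map_ne_zero _).2 hl₀
  let h' : Ω := aeval ξ' J.h
  have hh' : h' ≠ 0 := by
    change aeval ξ' J.h ≠ 0
    rw [hξ']
    exact (map_ne_zero _).2 hhK
  let a : Fin (m + 1) → Fin (N + 1) → Ω := fun r l => c (p r l)
  -- the matrix of the plane in echelon form; its tangent space is the graph of `B`
  let A : Fin (m + 1) → Fin (N + 1) → Ω := h'⁻¹ • R
  let B : Fin (N + 1) → Fin (N + 1) → Ω := fun l i => aeval ξ' (J.b l i) / h'
  have hBK : ∀ l i, B l i = algebraMap K Ω (aeval ξ (J.b l i) / aeval ξ J.h) := by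
    intro l i
    simp only [B, h', hξ', map_div₀]
  have hAech : ∀ r s, A r (j s) = if r = s then 1 else 0 := by
    intro r s
    simp only [A, hR]
    exact echelon_chartRow j.injective hh' _ _ r s
  have hA : ∀ l ∉ Set.range j, ∀ s, A s l = if j s ∈ I₀ then B l (j s) -
      ∑ r, (if j r ∈ I₀ then 0 else B (j r) (j s) * a r l) else a s l := by
    intro l hl s
    simp only [A, hR]
    exact smul_chartRow_of_notMem hh' _ _ hl s
  have hAminor : ∀ f, minor R f / minor R j = minor A f := by
    intro f
    have h1 : ∀ f, minor R f = h' ^ (m + 1) * minor A f := fun f => by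
      rw [← minor_smul, smul_inv_smul₀ hh']
    rw [h1, h1, minor_of_echelon hAech, mul_one, mul_div_cancel_left₀ _ (pow_ne_zero _ hh')]
  have hAF : ∀ l ∉ Set.range j, ∀ s, ∃ y : F, algebraMap F Ω y = A s l := by
    intro l hl s
    obtain ⟨f, ε, h1⟩ := exists_eq_minor_of_echelon hAech s hl
    obtain ⟨y, hy⟩ := hF f
    refine ⟨(ε : ℤ) * y, ?_⟩
    rw [h1, ← hAminor, ← hy, map_mul, map_intCast]
  have hBid : ∀ (w : Fin (N + 1) → Ω), ∀ l ∉ Set.range j, ∑ s, w (j s) * A s l =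
      ∑ i ∈ I₀, w i * B l i + ∑ r, if j r ∈ I₀ then 0 else
        a r l * w (j r) - ∑ i ∈ I₀, B (j r) i * a r l * w i := by
    intro w l hl
    simp only [hA l hl]
    exact sum_mul_pivots j.injective hj (B l) w (fun r i => B (j r) i * a r l) fun r => a r l
  have htan : ∀ w : Fin (N + 1) → Ω, w ∈ tangentAt (homIdeal X) ξ' ↔
      ∀ l ∉ I₀, w l = ∑ i ∈ I₀, w i * B l i := by
    intro w
    rw [J.mem_tangentAt_iff hzero' hh']
    refine forall₂_congr fun l hl => ?_
    have h1 : ∑ i ∈ I₀, w i * B l i = (∑ i ∈ I₀, aeval ξ' (J.b l i) * w i) / h' := by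
      rw [Finset.sum_div]
      exact Finset.sum_congr rfl fun i _ => by simp only [B]; ring
    rw [h1, eq_div_iff hh', mul_comm]
  -- the tangent space is contained in the plane
  have hTA : ∀ w ∈ tangentAt (homIdeal X) ξ', ∀ l ∉ Set.range j,
      w l = ∑ s, w (j s) * A s l := by
    intro w hw l hl
    rw [htan] at hw
    rw [hBid w l hl, ← hw l fun h => hl (hj l h), left_eq_add]
    refine Finset.sum_eq_zero fun r _ => ?_
    split_ifs with hr
    · rfl
    · rw [hw _ hr, Finset.mul_sum, sub_eq_zero]
      exact Finset.sum_congr rfl fun i _ => by ring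
  -- the point `x` over `L`
  have hinj := (algebraMap L Ω).injective
  have hxξ : (fun l => algebraMap L Ω (x l)) = (ξ' l₀)⁻¹ • ξ' := by
    ext l
    rw [hx, map_div₀, div_eq_inv_mul]
    rfl
  have hX := homIdeal_isHomog X
  have hxzero : ∀ G ∈ homIdeal X, aeval x G = 0 := by
    intro G hG
    apply hinj
    have h1 : aeval (fun l => algebraMap L Ω (x l)) G = algebraMap L Ω (aeval x G) :=
      aeval_algebraMap_apply Ω x G
    rw [← h1, hxξ, hX.aeval_smul_eq_zero hzero' _ hG, map_zero]
  have hx₀ : x l₀ = 1 := by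
    apply hinj
    rw [hx, div_self hl₀, map_one, map_one]
  have hTx : ∀ w ∈ tangentAt (homIdeal X) x, ∀ l ∉ Set.range j, ∀ y : Fin (m + 1) → F,
      (∀ s, algebraMap F Ω (y s) = A s l) → w l = ∑ s, algebraMap F L (y s) * w (j s) := by
    intro w hw l hl y hy
    have h1 := map_mem_tangentAt (Ω := Ω) hw
    rw [hxξ, hX.tangentAt_smul ξ' (inv_ne_zero hl₀')] at h1
    apply hinj
    rw [hTA _ h1 l hl, map_sum]
    refine Finset.sum_congr rfl fun s _ => ?_
    rw [map_mul, ← IsScalarTower.algebraMap_apply F L Ω, hy, mul_comm]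
  let η : Fin (N + 1) → Ω := fun l => algebraMap F Ω (φ (x l))
  have hηA : ∀ l ∉ Set.range j, η l = ∑ s, η (j s) * A s l := by
    intro l hl
    choose y hy using hAF l hl
    have h1 := congrArg φ (hTx x (hX.self_mem_tangentAt hxzero) l hl y hy)
    simp only [map_sum, ← Algebra.smul_def, map_smul, smul_eq_mul] at h1
    simp only [η, h1, map_sum, map_mul, hy]
    exact Finset.sum_congr rfl fun s _ => mul_comm _ _
  have hηD : ∀ D : Derivation k Ω Ω, ∀ l ∉ Set.range j, ∑ s, η (j s) * D (A s l) = 0 := by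
    intro D l hl
    choose y hy using hAF l hl
    have h1 := sum_derivation_mul_functional hxzero j l y (fun w hw => hTx w hw l hl y hy)
      (hTx x (hX.self_mem_tangentAt hxzero) l hl y hy) φ (D.compAlgebraMap F)
    rw [← h1]
    refine Finset.sum_congr rfl fun s _ => ?_
    rw [← hy]
    rfl
  have hDid : ∀ (D : Derivation k Ω Ω), ∀ l ∉ Set.range j, ∑ i ∈ I₀, η i * D (B l i) +
      ∑ r, (if j r ∈ I₀ then 0 else
        D (a r l) * η (j r) - ∑ i ∈ I₀, D (B (j r) i * a r l) * η i) = 0 := by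
    intro D l hl
    refine Eq.trans ?_ (hηD D l hl)
    rw [← sum_mul_pivots j.injective hj (fun i => D (B l i)) η
      (fun r i => D (B (j r) i * a r l)) fun r => D (a r l)]
    refine Finset.sum_congr rfl fun s _ => ?_
    rw [hA l hl, apply_ite D, map_sub, map_sum]
    simp only [apply_ite D, map_zero]
  have hηpivot : ∀ r, j r ∉ I₀ → η (j r) = ∑ i ∈ I₀, η i * B (j r) i := by
    intro r hr
    obtain ⟨l, hl⟩ : ∃ l, l ∉ Set.range j := by
      by_contra! h
      have := Fintype.card_le_of_surjective j h
      rw [Fintype.card_fin, Fintype.card_fin] at this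
      omega
    -- the derivative with respect to the parameter `a r l`
    obtain ⟨D, hD, hDc⟩ := exists_derivation_extend_of_values (k := k) hc hcsep 0
      fun i => if i = p r l then 1 else 0
    have hDB : ∀ l i, D (B l i) = 0 := fun l i => by rw [hBK, hD]; rfl
    have hDa : ∀ r', D (a r' l) = if r' = r then 1 else 0 := by
      intro r'
      simp only [a, hDc]
      refine if_congr ⟨fun h => (hp _ _ _ _ h).1, fun h => by rw [h]⟩ rfl rfl
    have h1 := hDid D l hl
    simp only [hDB, D.leibniz, hDa, smul_zero, add_zero, mul_zero, Finset.sum_const_zero,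
      zero_add] at h1
    rw [Finset.sum_eq_single r] at h1
    · rw [if_neg hr, if_pos rfl, one_mul, sub_eq_zero] at h1
      rw [h1]
      exact Finset.sum_congr rfl fun i _ => by rw [smul_eq_mul, mul_one, mul_comm]
    · intro r' _ hr'
      simp [if_neg hr']
    · simp
  have hηT : ∀ l ∉ I₀, η l = ∑ i ∈ I₀, η i * B l i := by
    intro l hl
    by_cases hlj : l ∈ Set.range j
    · obtain ⟨r, rfl⟩ := hlj
      exact hηpivot r hl
    · rw [hηA l hlj, hBid η l hlj, add_eq_left]
      refine Finset.sum_eq_zero fun r _ => ?_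
      split_ifs with hr
      · rfl
      · rw [hηpivot r hr, Finset.mul_sum, sub_eq_zero]
        exact Finset.sum_congr rfl fun i _ => by ring
  -- the derivations along the basis of the tangent space, extended to `Ω`
  obtain ⟨D, hD₁, hD₂, hD₃⟩ := J.exists_derivation_pivot hξ
  have hΔ : ∀ i, ∃ Δ : Derivation k Ω Ω, (∀ z, Δ (algebraMap K Ω z) = algebraMap K Ω (D i z)) ∧
      ∀ i, Δ (c i) = 0 := fun i =>
    exists_derivation_extend_of_values hc hcsep ((Algebra.linearMap K Ω).compDer (D i)) 0
  choose Δ hΔ hΔc using hΔ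
  have hΔB : ∀ i ∈ I₀, ∀ i' ∈ I₀, ∀ l ∉ I₀, Δ i (B l i') = Δ i' (B l i) := by
    intro i hi i' hi' l hl
    rw [hBK, hBK, hΔ, hΔ, hD₃ i hi i' hi' l hl]
  let E : Derivation k Ω Ω := ∑ i ∈ I₀, η i • Δ i
  have hE : ∀ z, E z = ∑ i ∈ I₀, η i * Δ i z := by
    intro z
    rw [derivation_sum_apply]
    rfl
  have hEξ : ∀ l, E (ξ' l) = η l := by
    intro l
    rw [hE]
    simp only [ξ', hΔ]
    by_cases hl : l ∈ I₀
    · rw [Finset.sum_eq_single_of_mem l hl fun i hi hne => by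
        rw [hD₁ i hi l hl, if_neg (Ne.symm hne), map_zero, mul_zero], hD₁ l hl l hl, if_pos rfl,
        map_one, mul_one]
    · rw [hηT l hl]
      refine Finset.sum_congr rfl fun i hi => ?_
      rw [hD₂ i hi l hl, hBK]
  have hEc : ∀ i, E (c i) = 0 := by
    intro i
    rw [hE]
    exact Finset.sum_eq_zero fun i' _ => by rw [hΔc, mul_zero]
  have hEB : ∀ l ∉ I₀, ∀ i ∈ I₀, E (B l i) = ∑ i' ∈ I₀, η i' * Δ i (B l i') := by
    intro l hl i hi
    rw [hE]
    exact Finset.sum_congr rfl fun i' hi' => by rw [hΔB i' hi' i hi l hl]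
  have hEA : ∀ s l, E (A s l) = 0 := by
    intro s l
    by_cases hl : l ∈ Set.range j
    · obtain ⟨r, rfl⟩ := hl
      rw [hAech]
      split_ifs <;> simp
    · rw [hA l hl]
      split_ifs with hs
      · have h1 := hDid (Δ (j s)) l hl
        have hΔa : ∀ r l, Δ (j s) (a r l) = 0 := fun r l => hΔc _ _
        refine Eq.trans ?_ h1
        rw [map_sub, hEB l (fun h => hl (hj l h)) _ hs, sub_eq_add_neg, map_sum,
          ← Finset.sum_neg_distrib]
        congr 1
        refine Finset.sum_congr rfl fun r _ => ?_
        split_ifs with hr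
        · rw [map_zero, neg_zero]
        · have hEa : E (a r l) = 0 := hEc _
          rw [hΔa, zero_mul, zero_sub, E.leibniz, hEa, smul_zero, zero_add, hEB _ hr _ hs,
            smul_eq_mul, Finset.mul_sum]
          congr 1
          refine Finset.sum_congr rfl fun i _ => ?_
          rw [Derivation.leibniz, hΔa, smul_zero, zero_add, smul_eq_mul]
          ring
      · exact hEc _
  have hEminor : ∀ f, E (minor A f) = 0 := derivation_minor E hEA
  let E' : Derivation k Ω Ω := ξ' l₀ • E
  have hE'F : ∀ y : F, E' (algebraMap F Ω y) = 0 := by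
    intro y
    refine hext E' (fun f => ?_) y
    rw [hAminor]
    exact (congrArg (ξ' l₀ * ·) (hEminor f)).trans (mul_zero _)
  refine ⟨
    { toFun := fun z => E' (algebraMap L Ω z)
      map_add' := fun z z' => by rw [map_add, map_add]
      map_smul' := fun y z => by
        rw [Algebra.smul_def, map_mul, ← IsScalarTower.algebraMap_apply F L Ω, E'.leibniz, hE'F,
          smul_zero, add_zero, smul_eq_mul, ← Algebra.smul_def, RingHom.id_apply]
      map_one_eq_zero' := by
        change E' (algebraMap L Ω 1) = 0
        rw [map_one, E'.map_one_eq_zero]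
      leibniz' := fun z z' => by
        change E' (algebraMap L Ω (z * z')) = z • E' (algebraMap L Ω z') + z' • E' (algebraMap L Ω z)
        rw [map_mul, E'.leibniz, Algebra.smul_def z, Algebra.smul_def z']
        rfl }, fun l => ?_⟩
  change E' (algebraMap L Ω (x l)) = η l
  have hη₀ : η l₀ = 0 := by simp only [η, hx₀, hφ, map_zero]
  have h1 := congrArg E (show ξ' l = algebraMap L Ω (x l) * ξ' l₀ by
    rw [hx, map_div₀]
    exact (div_mul_cancel₀ _ hl₀').symm)
  rw [E.leibniz, hEξ, hEξ, hη₀, smul_zero, zero_add] at h1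
  exact h1.symm

end Functionals

/-! ### Algebraic independence of the coordinates of a contact locus -/

section Independence

lemma exists_algHom_extend {k A E Ω : Type*} [Field k] [CommRing A] [Field E] [Field Ω]
    [Algebra k A] [Algebra k E] [Algebra A E] [IsScalarTower k A E] [IsFractionRing A E]
    [Algebra k Ω] (g : A →ₐ[k] Ω) (hg : Function.Injective g) :
    ∃ ψ : E →ₐ[k] Ω, ∀ a, ψ (algebraMap A E a) = g a :=
  ⟨IsFractionRing.liftAlgHom hg, fun a => by
    rw [IsFractionRing.liftAlgHom_apply]
    exact IsFractionRing.lift_algebraMap (g := (g : A →+* Ω)) hg a⟩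

/-- The field of the generic point with ideal `I` embeds in each field with a point at which exactly
the elements of `I` vanish. -/
lemma exists_algHom_fractionRing {k σ Ω : Type*} [Field k] [Field Ω] [Algebra k Ω]
    (I : Ideal (MvPolynomial σ k)) [I.IsPrime] (ζ : σ → Ω)
    (hζ : ∀ F : MvPolynomial σ k, aeval ζ F = 0 ↔ F ∈ I) :
    ∃ ψ : FractionRing (MvPolynomial σ k ⧸ I) →ₐ[k] Ω, ∀ i, ψ (coord I i) = ζ i := by
  let g : (MvPolynomial σ k ⧸ I) →ₐ[k] Ω := Ideal.Quotient.liftₐ I (aeval ζ) fun F hF => (hζ F).2 hF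
  have hg : Function.Injective g := by
    rw [injective_iff_map_eq_zero]
    intro F hF
    obtain ⟨F, rfl⟩ := Ideal.Quotient.mk_surjective F
    exact Ideal.Quotient.eq_zero_iff_mem.2 ((hζ F).1 hF)
  obtain ⟨ψ, hψ⟩ := exists_algHom_extend (E := FractionRing (MvPolynomial σ k ⧸ I)) g hg
  refine ⟨ψ, fun i => (hψ _).trans ?_⟩
  exact aeval_X ζ i

variable {k : Type*} [Field k] {N n m : ℕ} {X : Set (PSpace k N)} {I₀ : Finset (Fin (N + 1))}
  (J : JacobianChart (homIdeal X) I₀) {j : PluckerIdx N m}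
  {K Ω E ι : Type*} [Field K] [Algebra k K] [Field Ω] [Algebra k Ω] [Algebra K Ω]
  [IsScalarTower k K Ω] [Field E] [Algebra k E]

/-- If a field `E` is embedded in the field of the generic point of the chart, and `KW / KY` is the
separable extension of function fields defined by the Gauss map, then the coordinates of a point of
the general contact locus satisfy only linear relations over `KY`. -/
lemma JacobianChart.algebraicIndependent_coordinates [Infinite k]
    (hj : ∀ i ∈ I₀, i ∈ Set.range j) (hmN : m < N) {ξ : Fin (N + 1) → K}
    (hξ : IsGenericPoint (homIdeal X) ξ) {c : Option (Fin (m + 1) × Fin (N + 1)) → Ω}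
    (hc : AlgebraicIndependent K c)
    (hcsep : Algebra.IsSeparable (IntermediateField.adjoin K (Set.range c)) Ω)
    {l₀ : Fin (N + 1)} (hl₀ : ξ l₀ ≠ 0)
    (θ : PluckerIdx N m ⊕ Fin (N + 1) → E) (ψ : E →ₐ[k] Ω)
    (hψ : ∀ i, ψ (θ i) = J.chartPoint j (fun l => algebraMap K Ω (ξ l))
      (fun r l => c (some (r, l))) (c none) i)
    (KY : IntermediateField k E)
    (hKY : KY = IntermediateField.adjoin k {f | ∃ i i', BothPlane i i' ∧ f = θ i / θ i'})
    (KW : IntermediateField KY E)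
    (hKW : ∀ z, z ∈ KW ↔
      z ∈ IntermediateField.adjoin k {f | ∃ i i', SameFactor i i' ∧ f = θ i / θ i'})
    (hsep : SeparablyGenerated KY KW) (β : Set (Fin (N + 1))) (hβ₀ : l₀ ∈ β)
    (hβ : LinearIndepOn KY (fun l => θ (Sum.inr l) / θ (Sum.inr l₀)) β)
    (hspan : ∀ l, θ (Sum.inr l) / θ (Sum.inr l₀) ∈
      Submodule.span KY ((fun l => θ (Sum.inr l) / θ (Sum.inr l₀)) '' β)) :
    AlgebraicIndependent KY fun b : ↥(β \ {l₀}) => θ (Sum.inr b) / θ (Sum.inr l₀) := by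
  let _ : Algebra E Ω := ψ.toAlgebra
  have hψKY : ∀ y : KY, algebraMap KY Ω y = ψ y := fun y => rfl
  have hψKW : ∀ y : KW, algebraMap KW Ω y = ψ y := fun y => rfl
  have : IsScalarTower k E Ω := .of_algebraMap_eq fun z => (ψ.commutes z).symm
  have : IsScalarTower k KY Ω := .of_algebraMap_eq fun z => (ψ.commutes z).symm
  have : IsScalarTower k KW Ω := .of_algebraMap_eq fun z => (ψ.commutes z).symm
  have : IsScalarTower KY KW Ω := .of_algebraMap_eq fun z => rfl
  have hfs : Algebra.FormallySmooth KY KW := by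
    obtain ⟨S, hS, hSsep⟩ := hsep
    have : Algebra.IsSeparable (IntermediateField.adjoin KY (Set.range ((↑) : S → KW))) KW := by
      rw [Subtype.range_coe]; exact hSsep
    exact Algebra.FormallySmooth.of_algebraicIndependent_of_isSeparable hS.1
  let x' : Fin (N + 1) → E := fun l => θ (Sum.inr l) / θ (Sum.inr l₀)
  have hxmem : ∀ l, x' l ∈ KW := fun l =>
    (hKW _).2 (IntermediateField.subset_adjoin _ _ ⟨Sum.inr l, Sum.inr l₀, trivial, rfl⟩)
  let x : Fin (N + 1) → KW := fun l => ⟨x' l, hxmem l⟩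
  have hθ₀ : θ (Sum.inr l₀) ≠ 0 := by
    intro h
    have h1 := hψ (Sum.inr l₀)
    rw [h, map_zero] at h1
    exact hl₀ ((map_eq_zero (algebraMap K Ω)).1 h1.symm)
  have hx₀ : x l₀ = 1 := Subtype.ext (div_self hθ₀)
  have hxψ : ∀ l, algebraMap KW Ω (x l) = algebraMap K Ω (ξ l / ξ l₀) := by
    intro l
    rw [hψKW]
    change ψ (θ (Sum.inr l) / θ (Sum.inr l₀)) = _
    rw [map_div₀, hψ, hψ, map_div₀]
    rfl
  have hKWadj : IntermediateField.adjoin KY (Set.range x') = KW := by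
    apply le_antisymm
    · rw [IntermediateField.adjoin_le_iff]
      rintro _ ⟨l, rfl⟩
      exact hxmem l
    · intro z hz
      rw [hKW] at hz
      have h1 : IntermediateField.adjoin k {f | ∃ i i', SameFactor i i' ∧ f = θ i / θ i'} ≤
          (IntermediateField.adjoin KY (Set.range x')).restrictScalars k := by
        rw [IntermediateField.adjoin_le_iff]
        rintro _ ⟨i, i', h, rfl⟩
        change θ i / θ i' ∈ IntermediateField.adjoin KY (Set.range x')
        match i, i', h with
        | .inl f, .inl g, _ =>
          have h2 : θ (Sum.inl f) / θ (Sum.inl g) ∈ KY := by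
            rw [hKY]
            exact IntermediateField.subset_adjoin _ _ ⟨Sum.inl f, Sum.inl g, trivial, rfl⟩
          exact IntermediateField.algebraMap_mem _ (⟨_, h2⟩ : KY)
        | .inr l, .inr l', _ =>
          have h2 : θ (Sum.inr l) / θ (Sum.inr l') = x' l / x' l' :=
            (div_div_div_cancel_right₀ hθ₀ _ _).symm
          rw [h2]
          exact div_mem (IntermediateField.subset_adjoin _ _ ⟨l, rfl⟩)
            (IntermediateField.subset_adjoin _ _ ⟨l', rfl⟩)
      exact h1 hz
  have htop : IntermediateField.adjoin KY (Set.range x) = ⊤ := by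
    apply IntermediateField.lift_injective
    rw [IntermediateField.lift_adjoin, IntermediateField.lift_top, ← Set.range_comp]
    exact hKWadj
  let R : Fin (m + 1) → Fin (N + 1) → Ω :=
    J.row j (fun l => algebraMap K Ω (ξ l)) fun r l => c (some (r, l))
  have hψR : ∀ f g, ψ (θ (Sum.inl f) / θ (Sum.inl g)) = minor R f / minor R g := by
    intro f g
    rw [map_div₀, hψ, hψ]
    exact mul_div_mul_left _ _ (hc.ne_zero none)
  have hhΩ : aeval (fun l => algebraMap K Ω (ξ l)) J.h ≠ 0 := by
    have h1 : aeval (fun l => algebraMap K Ω (ξ l)) J.h = algebraMap K Ω (aeval ξ J.h) :=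
      aeval_algebraMap_apply Ω ξ J.h
    rw [h1]
    exact (map_ne_zero _).2 fun h => J.h_notMem (hξ.aeval_eq_zero_iff.1 h)
  have hRj : minor R j ≠ 0 := by
    rw [show minor R j = _ from minor_chartRow_pivots j.injective hhΩ _ _]
    exact pow_ne_zero _ hhΩ
  have hKYmem : ∀ f g, θ (Sum.inl f) / θ (Sum.inl g) ∈ KY := by
    intro f g
    rw [hKY]
    exact IntermediateField.subset_adjoin _ _ ⟨Sum.inl f, Sum.inl g, trivial, rfl⟩
  have H : ∀ φ : KW →ₗ[KY] KY, φ 1 = 0 →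
      ∃ D : Derivation KY KW Ω, ∀ l, D (x l) = algebraMap KY Ω (φ (x l)) := by
    intro φ hφ
    refine J.exists_derivation_eq_functional (F := KY) (L := KW) hj hmN hξ hc hcsep
      (p := fun r l => some (r, l)) (fun r l r' l' h => ?_) hl₀ hxψ (R := R) rfl
      (fun f => ⟨⟨_, hKYmem f j⟩, hψR f j⟩) (fun D hD y => ?_) φ hφ
    · simpa using h
    · have h1 : D.compAlgebraMap KY = 0 := by
        refine derivation_adjoin_ext hKY _ ?_
        rintro _ ⟨i, i', h, rfl⟩ hmem
        match i, i', h, hmem with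
        | .inl f, .inl g, _, hmem =>
          change D (ψ (θ (Sum.inl f) / θ (Sum.inl g))) = 0
          rw [hψR, ← div_div_div_cancel_right₀ hRj, Derivation.leibniz_div, hD, hD, smul_zero,
            smul_zero, sub_zero, smul_zero]
      exact congrArg (fun D : Derivation k KY Ω => D y) h1
  have hval : (KW.val.toLinearMap ∘ x) = x' := rfl
  have hβ' : LinearIndepOn KY x β := by
    refine LinearIndependent.of_comp KW.val.toLinearMap ?_
    exact hβ
  have hspan' : ∀ l, x l ∈ Submodule.span KY (x '' β) := by
    intro l
    have h1 : KW.val.toLinearMap (x l) ∈ (Submodule.span KY (x '' β)).map KW.val.toLinearMap := by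
      rw [Submodule.map_span, ← Set.image_comp, hval]
      exact hspan l
    obtain ⟨z, hz, h2⟩ := h1
    rwa [← show z = x l from Subtype.ext h2]
  have h1 := algebraicIndependent_of_derivations hsep x l₀ hx₀ htop H β hβ₀ hβ' hspan'
  exact h1.map' (f := KW.val) KW.val.injective

end Independence

/-! ### The linear family of contact loci -/

section LinearFamily

variable {k : Type*} [Field k] {N m : ℕ}

lemma aeval_sumElim_map {A A' : Type*} [CommRing A] [Algebra k A] [CommRing A'] [Algebra k A']
    (f : A →ₐ[k] A') (p : PluckerIdx N m → A) (v : Fin (N + 1) → A)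
    (G : MvPolynomial (PluckerIdx N m ⊕ Fin (N + 1)) k) :
    f (aeval (Sum.elim p v) G) = aeval (Sum.elim (fun i => f (p i)) fun l => f (v l)) G := by
  rw [comp_aeval_apply]
  congr 2
  ext i
  rcases i with i | i <;> rfl

lemma aeval_dehomogenize {F A ι : Type*} [Field F] [CommRing A] [Algebra F A] {β : Set ι} {l₀ : ι}
    {w : ι → A} (hw : w l₀ = 1) {b : ι} (hb : b ∈ β) [Decidable (b ∈ β \ {l₀})] :
    aeval (fun b : ↥(β \ {l₀}) => w b)
      (if hb : b ∈ β \ {l₀} then X ⟨b, hb⟩ else 1 : MvPolynomial ↥(β \ {l₀}) F) = w b := by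
  split_ifs with h
  · rw [aeval_X]
  · have : b = l₀ := by
      by_contra hne
      exact h ⟨hb, hne⟩
    rw [map_one, this, hw]

/-- A bihomogeneous polynomial that vanishes at a point of a linear space, the affine coordinates
of which are algebraically independent, vanishes on the linear space. -/
lemma aeval_linear_eq_zero {F E : Type*} [Field F] [Infinite F] [Field E] [Algebra k F]
    [Algebra k E] [Algebra F E] [IsScalarTower k F E]
    {G : MvPolynomial (PluckerIdx N m ⊕ Fin (N + 1)) k} {d : ℕ × ℕ}
    (hG : IsWeightedHomogeneous (biweight N m) G d) (u : PluckerIdx N m → F)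
    (β : Finset (Fin (N + 1))) (c : Fin (N + 1) → Fin (N + 1) → F) {y : Fin (N + 1) → E}
    {l₀ : Fin (N + 1)} (hl₀ : y l₀ = 1)
    (hy : AlgebraicIndependent F fun b : ↥((β : Set (Fin (N + 1))) \ {l₀}) => y b)
    (h : aeval (Sum.elim (fun f => algebraMap F E (u f))
      fun l => ∑ b ∈ β, algebraMap F E (c l b) * y b) G = 0) (z : Fin (N + 1) → F) :
    aeval (Sum.elim u fun l => ∑ b ∈ β, c l b * z b) G = 0 := by
  classical
  let Z : Fin (N + 1) → MvPolynomial ↥((β : Set (Fin (N + 1))) \ {l₀}) F := fun b =>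
    if hb : b ∈ (β : Set (Fin (N + 1))) \ {l₀} then X ⟨b, hb⟩ else 1
  -- the polynomial in affine coordinates
  let Q : MvPolynomial ↥((β : Set (Fin (N + 1))) \ {l₀}) F :=
    aeval (Sum.elim (fun f => C (u f)) fun l => ∑ b ∈ β, C (c l b) * Z b) G
  have hQ : Q = 0 := by
    rw [← map_eq_zero_iff _ hy]
    have h1 := aeval_sumElim_map (((aeval fun b : ↥((β : Set (Fin (N + 1))) \ {l₀}) => y b) :
      _ →ₐ[F] E).restrictScalars k) (fun f => C (u f)) (fun l => ∑ b ∈ β, C (c l b) * Z b) G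
    refine h1.trans (Eq.trans ?_ h)
    congr 3
    · ext f
      exact aeval_C _ _
    · ext l
      rw [map_sum]
      refine Finset.sum_congr rfl fun b hb => ?_
      rw [map_mul]
      exact congrArg₂ (· * ·) (aeval_C _ _) (aeval_dehomogenize hl₀ hb)
  have hz₁ : ∀ z : Fin (N + 1) → F, z l₀ = 1 →
      aeval (Sum.elim u fun l => ∑ b ∈ β, c l b * z b) G = 0 := by
    intro z hz
    have h1 := aeval_sumElim_map (((aeval fun b : ↥((β : Set (Fin (N + 1))) \ {l₀}) => z b) :
      _ →ₐ[F] F).restrictScalars k) (fun f => C (u f)) (fun l => ∑ b ∈ β, C (c l b) * Z b) G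
    refine Eq.trans ?_ (h1.symm.trans ((congrArg _ hQ).trans (map_zero _)))
    congr 3
    · ext f
      symm
      exact aeval_C _ _
    · ext l
      rw [map_sum]
      refine Finset.sum_congr rfl fun b hb => ?_
      rw [map_mul]
      refine congrArg₂ (· * ·) ?_ (aeval_dehomogenize hz hb).symm
      symm
      exact aeval_C _ _
  have hz₂ : ∀ z : Fin (N + 1) → F, z l₀ ≠ 0 →
      aeval (Sum.elim u fun l => ∑ b ∈ β, c l b * z b) G = 0 := by
    intro z hz
    have h1 := hz₁ ((z l₀)⁻¹ • z) (inv_mul_cancel₀ hz)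
    have h2 := aeval_sumElim_smul hG 1 (z l₀) u fun l => ∑ b ∈ β, c l b * ((z l₀)⁻¹ • z) b
    rw [h1, mul_zero, one_smul] at h2
    rw [← h2]
    congr 3
    ext l
    rw [Pi.smul_apply, smul_eq_mul, Finset.mul_sum]
    refine Finset.sum_congr rfl fun b _ => ?_
    rw [Pi.smul_apply, smul_eq_mul, mul_left_comm, mul_inv_cancel_left₀ hz]
  -- a polynomial vanishing where `z l₀ ≠ 0` vanishes
  let P : MvPolynomial (Fin (N + 1)) F :=
    aeval (Sum.elim (fun f => C (u f)) fun l => ∑ b ∈ β, C (c l b) * X b) G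
  have hP : ∀ z, eval z P = aeval (Sum.elim u fun l => ∑ b ∈ β, c l b * z b) G := by
    intro z
    have h1 := aeval_sumElim_map ((aeval z : _ →ₐ[F] F).restrictScalars k)
      (fun f => C (u f)) (fun l => ∑ b ∈ β, C (c l b) * X b) G
    refine (aeval_eq_eval_apply z P).symm.trans ?_
    refine h1.trans ?_
    congr 3
    · ext f
      exact aeval_C _ _
    · ext l
      rw [map_sum]
      refine Finset.sum_congr rfl fun b hb => ?_
      rw [map_mul]
      exact congrArg₂ (· * ·) (aeval_C _ _) (aeval_X _ _)
  have hP₀ : X l₀ * P = 0 := by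
    refine MvPolynomial.funext fun z => ?_
    rw [map_mul, eval_X, map_zero, hP]
    by_cases hz : z l₀ = 0
    · rw [hz, zero_mul]
    · rw [hz₂ z hz, mul_zero]
  rw [← hP, (mul_eq_zero.1 hP₀).resolve_left (X_ne_zero l₀), map_zero]

section RatioField

variable {E : Type*} [Field E] [Algebra k E] {θ : PluckerIdx N m ⊕ Fin (N + 1) → E}
  {F : IntermediateField k E}

/-- The elements of the field of ratios are quotients of forms of the same degree. -/
lemma exists_homogeneous_div
    (hF : F = IntermediateField.adjoin k {f | ∃ i i', BothPlane i i' ∧ f = θ i / θ i'})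
    {y : E} (hy : y ∈ F) : ∃ (d : ℕ) (A B : MvPolynomial (PluckerIdx N m) k),
      A.IsHomogeneous d ∧ B.IsHomogeneous d ∧ aeval (fun f => θ (Sum.inl f)) B ≠ 0 ∧
      aeval (fun f => θ (Sum.inl f)) B * y = aeval (fun f => θ (Sum.inl f)) A := by
  rw [hF] at hy
  induction hy using IntermediateField.adjoin_induction with
  | mem y hy =>
    obtain ⟨i, i', h, rfl⟩ := hy
    match i, i', h with
    | .inl f, .inl g, _ =>
      by_cases hg : θ (Sum.inl g) = 0
      · exact ⟨0, 0, 1, isHomogeneous_zero _ _ _, isHomogeneous_one _ _, by simp, by simp [hg]⟩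
      · refine ⟨1, X f, X g, isHomogeneous_X _ _, isHomogeneous_X _ _, by rwa [aeval_X], ?_⟩
        rw [aeval_X, aeval_X, mul_div_cancel₀ _ hg]
  | algebraMap y =>
    exact ⟨0, C y, 1, isHomogeneous_C _ _, isHomogeneous_one _ _, by simp, by simp⟩
  | add x y _ _ hx hy =>
    obtain ⟨d, A, B, hA, hB, hB₀, h⟩ := hx
    obtain ⟨d', A', B', hA', hB', hB₀', h'⟩ := hy
    refine ⟨d + d', A * B' + B * A', B * B', (hA.mul hB').add (hB.mul hA'), hB.mul hB', ?_, ?_⟩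
    · rw [map_mul]
      exact mul_ne_zero hB₀ hB₀'
    · simp only [map_mul, map_add, ← h, ← h']
      ring
  | inv x _ hx =>
    obtain ⟨d, A, B, hA, hB, hB₀, h⟩ := hx
    by_cases hx : x = 0
    · exact ⟨0, 0, 1, isHomogeneous_zero _ _ _, isHomogeneous_one _ _, by simp, by simp [hx]⟩
    · refine ⟨d, B, A, hB, hA, ?_, ?_⟩
      · rw [← h]
        exact mul_ne_zero hB₀ hx
      · rw [← h, mul_inv_cancel_right₀ hx]
  | mul x y _ _ hx hy =>
    obtain ⟨d, A, B, hA, hB, hB₀, h⟩ := hx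
    obtain ⟨d', A', B', hA', hB', hB₀', h'⟩ := hy
    refine ⟨d + d', A * A', B * B', hA.mul hA', hB.mul hB', ?_, ?_⟩
    · rw [map_mul]
      exact mul_ne_zero hB₀ hB₀'
    · simp only [map_mul, ← h, ← h']
      ring

lemma exists_common_denominator {ι : Type*} [Fintype ι]
    (hF : F = IntermediateField.adjoin k {f | ∃ i i', BothPlane i i' ∧ f = θ i / θ i'})
    {y : ι → E} (hy : ∀ i, y i ∈ F) :
    ∃ (d : ℕ) (B : MvPolynomial (PluckerIdx N m) k) (A : ι → MvPolynomial (PluckerIdx N m) k),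
      B.IsHomogeneous d ∧ (∀ i, (A i).IsHomogeneous d) ∧ aeval (fun f => θ (Sum.inl f)) B ≠ 0 ∧
      ∀ i, aeval (fun f => θ (Sum.inl f)) B * y i = aeval (fun f => θ (Sum.inl f)) (A i) := by
  classical
  choose d A B hA hB hB₀ h using fun i => exists_homogeneous_div hF (hy i)
  refine ⟨∑ i, d i, ∏ i, B i, fun i => (∏ i' ∈ Finset.univ.erase i, B i') * A i,
    IsHomogeneous.prod _ _ _ fun i _ => hB i, fun i => ?_, ?_, fun i => ?_⟩
  · rw [← Finset.sum_erase_add _ _ (Finset.mem_univ i)]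
    exact (IsHomogeneous.prod _ _ _ fun i _ => hB i).mul (hA i)
  · rw [map_prod]
    exact Finset.prod_ne_zero_iff.2 fun i _ => hB₀ i
  · rw [← Finset.prod_erase_mul _ _ (Finset.mem_univ i), map_mul, map_mul, mul_assoc, h]

/-- Suppose that the coordinates of the generic point `θ` satisfy only linear relations over the field
of ratios of Plücker coordinates. Then there are a denominator `g` and a matrix `A` of forms in the
Plücker coordinates which define a linear family, parametrized by `z ↦ A z`, such that

* the equations `g x_l = ∑ A_{lb} x_b` of the family belong to the ideal,
* all the polynomials of the ideal vanish on the family,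
* a form in the `x_l` outside the ideal does not vanish on the general member of the family. -/
lemma exists_linearFamily [Infinite k] {I : Ideal (MvPolynomial (PluckerIdx N m ⊕ Fin (N + 1)) k)}
    (hθ : ∀ G : MvPolynomial (PluckerIdx N m ⊕ Fin (N + 1)) k, aeval θ G = 0 ↔ G ∈ I)
    (hF : F = IntermediateField.adjoin k {f | ∃ i i', BothPlane i i' ∧ f = θ i / θ i'})
    {j : PluckerIdx N m} (hj : θ (Sum.inl j) ≠ 0) {l₀ : Fin (N + 1)} (hl₀ : θ (Sum.inr l₀) ≠ 0)
    (hind : ∀ β : Set (Fin (N + 1)), l₀ ∈ β →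
      LinearIndepOn F (fun l => θ (Sum.inr l) / θ (Sum.inr l₀)) β →
      (∀ l, θ (Sum.inr l) / θ (Sum.inr l₀) ∈
        Submodule.span F ((fun l => θ (Sum.inr l) / θ (Sum.inr l₀)) '' β)) →
      AlgebraicIndependent F fun b : ↥(β \ {l₀}) => θ (Sum.inr b) / θ (Sum.inr l₀)) :
    ∃ (β : Finset (Fin (N + 1))) (e : ℕ) (g : MvPolynomial (PluckerIdx N m) k)
      (A : Fin (N + 1) → Fin (N + 1) → MvPolynomial (PluckerIdx N m) k),
      g.IsHomogeneous e ∧ (∀ l b, (A l b).IsHomogeneous e) ∧ rename Sum.inl g ∉ I ∧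
      (∀ l, rename Sum.inl g * X (Sum.inr l) -
        ∑ b ∈ β, rename Sum.inl (A l b) * X (Sum.inr b) ∈ I) ∧
      (∀ G ∈ I, ∀ d, IsWeightedHomogeneous (biweight N m) G d → ∀ z : Fin (N + 1) → k,
        rename Sum.inl (aeval (Sum.elim X fun l => ∑ b ∈ β, z b • A l b) G) ∈ I) ∧
      ∀ (H : MvPolynomial (Fin (N + 1)) k) (d : ℕ), H.IsHomogeneous d → rename Sum.inr H ∉ I →
        ∃ z : Fin (N + 1) → k, rename Sum.inl (aeval (fun l => ∑ b ∈ β, z b • A l b) H) ∉ I := by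
  classical
  let x : Fin (N + 1) → E := fun l => θ (Sum.inr l) / θ (Sum.inr l₀)
  have hx₀ : x l₀ = 1 := div_self hl₀
  let π : MvPolynomial (PluckerIdx N m) k →ₐ[k] E := aeval fun f => θ (Sum.inl f)
  have hπ : ∀ A, aeval θ (rename Sum.inl A) = π A := fun A => by
    rw [aeval_rename]; rfl
  have hs : LinearIndepOn F x {l₀} := by
    rw [linearIndepOn_singleton_iff, hx₀]
    exact one_ne_zero
  obtain ⟨β', -, hβ₀, hβspan, hβ⟩ := exists_linearIndepOn_extension hs (Set.subset_univ _)
  have hβspan' : ∀ l, x l ∈ Submodule.span F (x '' β') := fun l => hβspan ⟨l, trivial, rfl⟩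
  have hindβ := hind β' (hβ₀ rfl) hβ hβspan'
  let β : Finset (Fin (N + 1)) := β'.toFinset
  have hββ : β' = (β : Set (Fin (N + 1))) := (Set.coe_toFinset β').symm
  have hc : ∀ l, ∃ c : Fin (N + 1) → F, ∑ b ∈ β, (c b : E) * x b = x l := by
    intro l
    have h1 := hβspan' l
    rw [hββ] at h1
    obtain ⟨c, h2⟩ := (Submodule.mem_span_image_finset_iff_exists_fun F).1 h1
    refine ⟨fun b => if hb : b ∈ β then c ⟨b, hb⟩ else 0, ?_⟩
    rw [← h2, ← Finset.sum_attach]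
    exact Finset.sum_congr rfl fun b _ => by
      simp only [b.2, dite_true]
      rfl
  choose c hc using hc
  have hcθ : ∀ l, θ (Sum.inr l) = ∑ b ∈ β, (c l b : E) * θ (Sum.inr b) := by
    intro l
    have h1 : ∀ l, θ (Sum.inr l) = x l * θ (Sum.inr l₀) := fun l =>
      (div_mul_cancel₀ _ hl₀).symm
    rw [h1 l, ← hc, Finset.sum_mul]
    exact Finset.sum_congr rfl fun b _ => by rw [h1 b, mul_assoc]
  obtain ⟨e, g, A, hg, hA, hg₀, hgA⟩ := exists_common_denominator hF
    (y := fun i : Fin (N + 1) × Fin (N + 1) => (c i.1 i.2 : E)) fun i => (c i.1 i.2).2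
  have hgA' : ∀ l b, π (A (l, b)) = π g * c l b := fun l b => (hgA (l, b)).symm
  refine ⟨β, e, g, fun l b => A (l, b), hg, fun l b => hA _, ?_, fun l => ?_, ?_, ?_⟩
  · rw [← hθ, hπ]
    exact hg₀
  · rw [← hθ, map_sub, map_mul, map_sum, hπ, aeval_X, hcθ l, sub_eq_zero, Finset.mul_sum]
    refine Finset.sum_congr rfl fun b _ => ?_
    rw [map_mul, hπ, hgA', aeval_X, mul_assoc]
  · intro G hG d hd z
    rw [← hθ, hπ, aeval_sumElim_map]
    have hu : ∀ f, θ (Sum.inl f) / θ (Sum.inl j) ∈ F := by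
      intro f
      rw [hF]
      exact IntermediateField.subset_adjoin _ _ ⟨Sum.inl f, Sum.inl j, trivial, rfl⟩
    let u : PluckerIdx N m → F := fun f => ⟨_, hu f⟩
    have hθu : (fun f => θ (Sum.inl f)) = θ (Sum.inl j) • fun f => (u f : E) := by
      ext f
      exact (mul_div_cancel₀ _ hj).symm
    have h1 : aeval (Sum.elim (fun f => algebraMap F E (u f))
        fun l => ∑ b ∈ β, algebraMap F E (c l b) * x b) G = 0 := by
      have h2 := aeval_sumElim_smul hd (θ (Sum.inl j))⁻¹ (θ (Sum.inr l₀))⁻¹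
        (fun f => θ (Sum.inl f)) fun l => θ (Sum.inr l)
      have h3 : Sum.elim (fun f => θ (Sum.inl f)) (fun l => θ (Sum.inr l)) = θ := by
        ext i
        rcases i with i | i <;> rfl
      rw [h3, (hθ G).2 hG, mul_zero] at h2
      rw [← h2]
      congr 3
      · ext f
        exact div_eq_inv_mul _ _
      · ext l
        exact (hc l).trans (div_eq_inv_mul _ _)
    have hinf : Infinite F := Infinite.of_injective _ (algebraMap k F).injective
    have hind' : AlgebraicIndependent F fun b : ↥((β : Set (Fin (N + 1))) \ {l₀}) => x b := by
      rw [← hββ]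
      exact hindβ
    have h4 := aeval_linear_eq_zero hd u β c hx₀ hind' h1 fun b => algebraMap k F (z b)
    have h5 := congrArg (algebraMap F E) h4
    rw [map_zero] at h5
    have h6 := aeval_sumElim_map (IsScalarTower.toAlgHom k F E) u
      (fun l => ∑ b ∈ β, c l b * algebraMap k F (z b)) G
    have h7 := aeval_sumElim_smul hd (θ (Sum.inl j)) (π g) (fun f => (u f : E))
      fun l => IsScalarTower.toAlgHom k F E (∑ b ∈ β, c l b * algebraMap k F (z b))
    rw [show aeval (Sum.elim (fun f => (u f : E))
      fun l => IsScalarTower.toAlgHom k F E (∑ b ∈ β, c l b * algebraMap k F (z b))) G = 0 from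
      h6.symm.trans h5, mul_zero] at h7
    rw [← h7]
    congr 3
    · rw [← hθu]
      ext f
      exact aeval_X _ _
    · ext l
      rw [Pi.smul_apply, smul_eq_mul, map_sum, map_sum, Finset.mul_sum]
      refine Finset.sum_congr rfl fun b _ => ?_
      rw [map_smul, hgA', map_mul, Algebra.smul_def, mul_comm, mul_assoc]
      rfl
  · intro H d hd hH
    by_contra! h
    let Q : MvPolynomial (Fin (N + 1)) E := aeval (fun l => ∑ b ∈ β, C (π (A (l, b))) * X b) H
    have hQ : Q = 0 := by
      refine MvPolynomial.funext_set (fun _ => Set.range (algebraMap k E))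
        (fun _ => Set.infinite_range_of_injective (algebraMap k E).injective) fun z hz => ?_
      choose z' hz' using fun i => hz i trivial
      have h1 := h z'
      rw [← hθ, hπ, comp_aeval_apply] at h1
      rw [map_zero, ← h1, ← aeval_eq_eval_apply]
      refine (comp_aeval_apply _ ((aeval z : _ →ₐ[E] E).restrictScalars k) H).trans ?_
      congr 2
      ext l
      rw [map_sum, map_sum]
      refine Finset.sum_congr rfl fun b _ => ?_
      rw [map_smul, map_mul, Algebra.smul_def, hz', mul_comm]
      exact congrArg₂ (· * ·) (aeval_X _ _) (aeval_C _ _)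
    have h1 : aeval (fun l => θ (Sum.inr l)) Q = π g ^ d * aeval (fun l => θ (Sum.inr l)) H := by
      rw [← aeval_smul_of_isHomogeneous hd]
      refine (comp_aeval_apply _ ((aeval fun l => θ (Sum.inr l) :
        _ →ₐ[E] E).restrictScalars k) H).trans ?_
      congr 2
      ext l
      rw [Pi.smul_apply, smul_eq_mul, hcθ, map_sum, Finset.mul_sum]
      refine Finset.sum_congr rfl fun b _ => ?_
      rw [map_mul, ← mul_assoc, ← hgA']
      exact congrArg₂ (· * ·) (aeval_C _ _) (aeval_X _ _)
    rw [hQ, map_zero] at h1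
    apply hH
    rw [← hθ, aeval_rename]
    exact (mul_eq_zero.1 h1.symm).resolve_left (pow_ne_zero _ hg₀)

end RatioField

end LinearFamily

/-! ### General contact loci -/

section ContactLocus

variable {k : Type*} [Field k] {N n m : ℕ} {X : Set (PSpace k N)} {I₀ : Finset (Fin (N + 1))}
  {j : PluckerIdx N m}

/-- If the coordinates of the generic point of `P_m^X` lie in a linear family over the Plücker
coordinates, the general contact locus is the corresponding member of the family: it is contained in
it since the equations hold on `P_m^X`, and it is dense in it, because it contains the points of the
family where the Jacobian minor does not vanish. -/
lemma JacobianChart.exists_isOpen_contactLocus_eq (J : JacobianChart (homIdeal X) I₀)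
    [Infinite k] (hX : IsClosed X)
    [hirr : (homIdeal X).IsPrime] (hcard : I₀.card = n + 1) (hj : ∀ i ∈ I₀, i ∈ Set.range j)
    (hprime : (idealOf prodReps (conormal X n m)).IsPrime) {l₀ : Fin (N + 1)}
    (hl₀ : MvPolynomial.X l₀ ∉ homIdeal X) (β : Finset (Fin (N + 1))) {e : ℕ}
    {g : MvPolynomial (PluckerIdx N m) k}
    {A : Fin (N + 1) → Fin (N + 1) → MvPolynomial (PluckerIdx N m) k} (hg : g.IsHomogeneous e)
    (hA : ∀ l b, (A l b).IsHomogeneous e)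
    (hg₀ : rename Sum.inl g ∉ idealOf prodReps (conormal X n m))
    (hrel : ∀ l, rename Sum.inl g * MvPolynomial.X (Sum.inr l) -
        ∑ b ∈ β, rename Sum.inl (A l b) * MvPolynomial.X (Sum.inr b) ∈
          idealOf prodReps (conormal X n m))
    (hvan : ∀ G ∈ idealOf prodReps (conormal X n m), ∀ d,
      IsWeightedHomogeneous (biweight N m) G d → ∀ z : Fin (N + 1) → k,
        rename Sum.inl (aeval (Sum.elim MvPolynomial.X fun l => ∑ b ∈ β, z b • A l b) G) ∈
          idealOf prodReps (conormal X n m))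
    (hdense : ∀ (H : MvPolynomial (Fin (N + 1)) k) (d : ℕ), H.IsHomogeneous d →
      rename Sum.inr H ∉ idealOf prodReps (conormal X n m) →
        ∃ z : Fin (N + 1) → k, rename Sum.inl (aeval (fun l => ∑ b ∈ β, z b • A l b) H) ∉
          idealOf prodReps (conormal X n m)) :
    ∃ U : Set (Gr k N m), IsOpen U ∧ (U ∩ tangentPlanes X n m).Nonempty ∧
      ∀ L ∈ U ∩ tangentPlanes X n m, (contactLocus X n L).Nonempty ∧
        ∃ M : Projectivization.Subspace k (Fin (N + 1) → k),
          contactLocus X n L = (M : Set (PSpace k N)) := by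
  let H : MvPolynomial (Fin (N + 1)) k := J.h * MvPolynomial.X l₀
  have hH : H.IsHomogeneous (J.deg + 1) := J.h_homog.mul (isHomogeneous_X _ _)
  have hH₀ : rename Sum.inr H ∉ idealOf prodReps (conormal X n m) := fun h =>
    (hirr.mem_or_mem (J.mem_homIdeal_of_rename_mem hcard hj h)).elim J.h_notMem hl₀
  obtain ⟨z₀, hz₀⟩ := hdense H _ hH hH₀
  let S : MvPolynomial (PluckerIdx N m) k := g * aeval (fun l => ∑ b ∈ β, z₀ b • A l b) H
  have hS : S.IsHomogeneous (e + e * (J.deg + 1)) := by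
    refine hg.mul (hH.aeval _ fun l => IsHomogeneous.sum _ _ _ fun b _ => ?_)
    rw [smul_eq_C_mul]
    simpa using (isHomogeneous_C _ (z₀ b)).mul (hA l b)
  have hS₀ : rename Sum.inl S ∉ idealOf prodReps (conormal X n m) := by
    rw [map_mul]
    exact fun h => (hprime.mem_or_mem h).elim hg₀ hz₀
  refine ⟨{L | ∀ p ∈ planeReps L, eval p S ≠ 0},
    TopologicalSpace.isOpen_generateFrom_of_mem ⟨S, _, hS, rfl⟩, ?_, ?_⟩
  · have h1 : ∃ z ∈ conormal X n m, ∃ q ∈ prodReps z, eval q (rename Sum.inl S) ≠ 0 := by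
      by_contra! h
      exact hS₀ (mem_idealOf.2 h)
    obtain ⟨z, hz, _, ⟨p, hp, v, hv, rfl⟩, h2⟩ := h1
    rw [eval_rename, Sum.elim_comp_inl] at h2
    refine ⟨z.plane, fun p' hp' => ?_, z, hz, rfl⟩
    obtain ⟨t, ht, rfl⟩ := exists_smul_of_mem_planeReps hp hp'
    rw [← aeval_eq_eval_apply, aeval_smul_of_isHomogeneous hS, aeval_eq_eval_apply]
    exact mul_ne_zero (pow_ne_zero _ ht) h2
  rintro L ⟨hLU, zL, hzL, rfl⟩
  obtain ⟨p, hp⟩ := planeReps_nonempty zL.plane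
  have hpS := hLU p hp
  have hpI : ∀ Q : MvPolynomial (PluckerIdx N m) k,
      rename Sum.inl Q ∈ idealOf prodReps (conormal X n m) → eval p Q = 0 := by
    intro Q hQ
    obtain ⟨v, hv⟩ := pointReps_nonempty zL.point
    have h1 := mem_idealOf.1 hQ zL hzL _ ⟨p, hp, v, hv, rfl⟩
    rwa [eval_rename, Sum.elim_comp_inl] at h1
  -- the linear space of the family
  let Λ : (Fin (N + 1) → k) →ₗ[k] (Fin (N + 1) → k) :=
    LinearMap.pi fun l => ∑ b ∈ β, eval p (A l b) • LinearMap.proj b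
  have hΛ : ∀ z l, Λ z l = ∑ b ∈ β, z b * eval p (A l b) := by
    intro z l
    simp [Λ, mul_comm]
  have hcon : ∀ z, ∀ hz : Λ z ≠ 0, (⟨zL.plane, Projectivization.mk k (Λ z) hz⟩ : GrProd k N m) ∈
      conormal X n m := by
    intro z hz
    refine mem_of_forall_eval_eq_zero isClosed_closure (q := Sum.elim p (Λ z))
      ⟨p, hp, _, ⟨hz, rfl⟩, rfl⟩ fun F hF d hd => ?_
    have h1 := hpI _ (hvan F hF d hd z)
    rw [← aeval_eq_eval_apply, aeval_sumElim_map, aeval_eq_eval_apply] at h1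
    rw [← h1]
    congr 2
    congr 1
    · ext f
      simp
    · ext l
      rw [hΛ, map_sum]
      exact Finset.sum_congr rfl fun b _ => by rw [map_smul, aeval_eq_eval_apply, smul_eq_mul]
  have htan : ∀ z, ∀ hz : Λ z ≠ 0, eval (Λ z) J.h ≠ 0 →
      Projectivization.mk k (Λ z) hz ∈ {x | x ∈ smoothLocus X n ∧ tangentSpace X x ≤ zL.plane.1} :=
    fun z hz hh => J.tangent_of_mem_conormal hX hcard (hcon z hz) ⟨hz, rfl⟩ hh
  have hΛ₀ : eval (Λ z₀) H ≠ 0 := by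
    intro h
    apply hpS
    rw [map_mul, ← aeval_eq_eval_apply p (aeval _ H), comp_aeval_apply, aeval_eq_eval_apply]
    refine mul_eq_zero_of_right _ ?_
    rw [← h]
    congr 2
    ext l
    rw [hΛ, map_sum]
    exact Finset.sum_congr rfl fun b _ => by rw [map_smul, aeval_eq_eval_apply, smul_eq_mul]
  have hne : ∀ z, eval (Λ z) H ≠ 0 → Λ z ≠ 0 ∧ eval (Λ z) J.h ≠ 0 := by
    intro z hz
    rw [map_mul, eval_X] at hz
    exact ⟨fun h => right_ne_zero_of_mul hz (congrFun h l₀), left_ne_zero_of_mul hz⟩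
  refine ⟨⟨_, subset_closure (htan z₀ (hne z₀ hΛ₀).1 (hne z₀ hΛ₀).2)⟩,
    (LinearMap.range Λ).projectivization, ?_⟩
  ext x
  obtain ⟨v, hv, rfl⟩ := pointReps_nonempty x
  rw [SetLike.mem_coe, Submodule.mk_mem_projectivization_iff]
  constructor
  · intro hx
    have hgp : eval p g ≠ 0 := left_ne_zero_of_mul (by rwa [← map_mul])
    have h1 : ∀ l, eval p g * v l = ∑ b ∈ β, v b * eval p (A l b) := by
      intro l
      let Q : MvPolynomial (Fin (N + 1)) k := C (eval p g) * MvPolynomial.X l -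
        ∑ b ∈ β, C (eval p (A l b)) * MvPolynomial.X b
      have hQ : Q.IsHomogeneous 1 := by
        refine IsHomogeneous.sub ?_ (IsHomogeneous.sum _ _ _ fun b _ => ?_)
        · simpa using (isHomogeneous_C _ (eval p g)).mul (isHomogeneous_X k l)
        · simpa using (isHomogeneous_C _ (eval p (A l b))).mul (isHomogeneous_X k b)
      obtain ⟨v', hv', h2⟩ := exists_eval_eq_zero_of_mem_closure hx hQ fun x hx => by
        obtain ⟨v, hv⟩ := pointReps_nonempty x
        refine ⟨v, hv, ?_⟩
        have h3 := mem_idealOf.1 (hrel l) ⟨zL.plane, x⟩ (subset_closure hx) _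
          ⟨p, hp, v, hv, rfl⟩
        simpa [Q, eval_rename, map_sum] using h3
      have h4 := eval_pointReps_eq_zero hQ hv' ⟨hv, rfl⟩ h2
      simp only [Q, map_sub, map_mul, map_sum, eval_C, eval_X, sub_eq_zero] at h4
      rw [h4]
      exact Finset.sum_congr rfl fun b _ => mul_comm _ _
    refine ⟨(eval p g)⁻¹ • v, ?_⟩
    ext l
    rw [map_smul, Pi.smul_apply, hΛ, ← h1, smul_eq_mul, inv_mul_cancel_left₀ hgp]
  · rintro ⟨z, rfl⟩
    by_contra hx
    obtain ⟨F, d, hF, h1, h2⟩ := exists_separating_of_notMem_closure hx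
    let toΛ : Fin (N + 1) → MvPolynomial (Fin (N + 1)) k := fun l =>
      ∑ b ∈ β, MvPolynomial.X b * C (eval p (A l b))
    have htoΛ : ∀ (z : Fin (N + 1) → k) Q, eval z (aeval toΛ Q) = eval (Λ z) Q := by
      intro z Q
      rw [← aeval_eq_eval_apply, comp_aeval_apply, aeval_eq_eval_apply]
      congr 2
      ext l
      rw [hΛ, map_sum]
      refine Finset.sum_congr rfl fun b _ => ?_
      rw [map_mul, aeval_X, algHom_C]
      rfl
    have h3 : aeval toΛ F * aeval toΛ H = 0 := by
      refine MvPolynomial.funext fun w => ?_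
      rw [map_mul, htoΛ, htoΛ, map_zero]
      by_cases hw : eval (Λ w) H = 0
      · rw [hw, mul_zero]
      · obtain ⟨hw0, hwh⟩ := hne w hw
        obtain ⟨v', hv', h4⟩ := h2 _ (htan w hw0 hwh)
        rw [eval_pointReps_eq_zero hF hv' ⟨hw0, rfl⟩ h4, zero_mul]
    rcases mul_eq_zero.1 h3 with h4 | h4
    · refine h1 _ ⟨hv, rfl⟩ ?_
      rw [← htoΛ, h4, map_zero]
    · apply hΛ₀
      rw [← htoΛ, h4, map_zero]

end ContactLocus

section Parameters

/-- A purely transcendental extension, with any set of variables. -/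
lemma exists_algebraicIndependent_of_field.{w} (ι : Type) (K : Type w) [Field K] :
    ∃ (Ω : Type w) (_ : Field Ω) (_ : Algebra K Ω) (c : ι → Ω), AlgebraicIndependent K c ∧
      Algebra.IsSeparable (IntermediateField.adjoin K (Set.range c)) Ω := by
  let Ω := FractionRing (MvPolynomial ι K)
  let φ : MvPolynomial ι K →ₐ[K] Ω := IsScalarTower.toAlgHom K (MvPolynomial ι K) Ω
  let c : ι → Ω := fun i => φ (X i)
  have hφ : φ = aeval c := by
    ext i
    rw [aeval_X]
  have hc : AlgebraicIndependent K c := by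
    change Function.Injective (aeval c)
    rw [← hφ]
    exact IsFractionRing.injective (MvPolynomial ι K) Ω
  refine ⟨Ω, inferInstance, inferInstance, c, hc, ⟨fun z => ?_⟩⟩
  have hmem : ∀ a : MvPolynomial ι K, φ a ∈ IntermediateField.adjoin K (Set.range c) := by
    intro a
    rw [hφ]
    have h1 : aeval c a ∈ Algebra.adjoin K (Set.range c) := by
      rw [Algebra.adjoin_range_eq_range_aeval]
      exact ⟨a, rfl⟩
    exact IntermediateField.algebra_adjoin_le_adjoin K _ h1
  have hz : z ∈ IntermediateField.adjoin K (Set.range c) := by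
    obtain ⟨a, b, -, rfl⟩ := IsFractionRing.div_surjective (A := MvPolynomial ι K) z
    exact div_mem (hmem a) (hmem b)
  exact isSeparable_algebraMap (⟨z, hz⟩ : IntermediateField.adjoin K (Set.range c))

end Parameters

end GaussMap

end

theorem theorem1 {k : Type*} [Field k] [IsAlgClosed k] (N n m : ℕ)
    -- a projective variety `X` of dimension `n` in `ℙ^N`
    (X : Set (GaussMap.PSpace k N)) (hclosed : IsClosed X)
    [hirr : (GaussMap.homIdeal X).IsPrime]
    (hdim : Algebra.trdeg k (GaussMap.functionField X) = (n : Cardinal))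
    (hnm : n ≤ m) (hmN : m < N)
    -- the `m`-th Gauss map is separable
    (hsep : GaussMap.IsSeparableFst (GaussMap.conormal X n m)) :
    -- for all `L` in a nonempty open subset of `X_m^*`, the contact locus is a linear variety
    ∃ U : Set (GaussMap.Gr k N m), IsOpen U ∧ (U ∩ GaussMap.tangentPlanes X n m).Nonempty ∧
      ∀ L ∈ U ∩ GaussMap.tangentPlanes X n m,
        (GaussMap.contactLocus X n L).Nonempty ∧
        ∃ M : Projectivization.Subspace k (Fin (N + 1) → k),
          GaussMap.contactLocus X n L = (M : Set (GaussMap.PSpace k N)) := by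
  open GaussMap in
  obtain ⟨hprime, hsep⟩ := hsep
  have hinf : Infinite k := IsAlgClosed.instInfinite
  -- a coordinate that does not vanish on `X`
  obtain ⟨l₀, hl₀⟩ : ∃ l₀, MvPolynomial.X l₀ ∉ homIdeal X := by
    by_contra! h
    refine (Ideal.ne_top_iff_one _).1 hirr.ne_top (mem_idealOf.2 fun x hx v hv => absurd ?_ hv.1)
    ext l
    have h1 := mem_idealOf.1 (h l) x hx v hv
    rwa [eval_X] at h1
  have hξ := isGenericPoint_coord (homIdeal X)
  have hξ₀ : coord (homIdeal X) l₀ ≠ 0 := by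
    rw [← aeval_X (R := k) (coord (homIdeal X)) l₀]
    exact fun h => hl₀ (hξ.aeval_eq_zero_iff.1 h)
  -- the Jacobian chart, of dimension `n`, and a chart of the planes containing the tangent spaces
  obtain ⟨I₀, hcard, ⟨J⟩⟩ := exists_jacobianChart hξ (homIdeal_isHomog X)
  rw [hξ.finrank_tangentAt (homIdeal_isHomog X) hξ₀ (functionField X) (ratioField_eq_adjoin hξ₀)
    hdim] at hcard
  obtain ⟨s, hs, hscard⟩ := Finset.exists_superset_card_eq (s := I₀) (n := m + 1) (by omega)
    (by rw [Fintype.card_fin]; omega)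
  let j : PluckerIdx N m := s.orderEmbOfFin hscard
  have hj : ∀ i ∈ I₀, i ∈ Set.range j := by
    intro i hi
    rw [Finset.range_orderEmbOfFin]
    exact hs hi
  -- the generic point of the chart
  obtain ⟨Ω, _, _, c, hc, hcsep⟩ := exists_algebraicIndependent_of_field
    (Option (Fin (m + 1) × Fin (N + 1)))
    (FractionRing (MvPolynomial (Fin (N + 1)) k ⧸ homIdeal X))
  let _ : Algebra k Ω := Algebra.compHom Ω
    (algebraMap k (FractionRing (MvPolynomial (Fin (N + 1)) k ⧸ homIdeal X)))
  have : IsScalarTower k (FractionRing (MvPolynomial (Fin (N + 1)) k ⧸ homIdeal X)) Ω :=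
    .of_algebraMap_eq fun _ => rfl
  have hζ := fun G => J.aeval_chartPoint_eq_zero_iff (G := G) hclosed hcard hj hprime hξ hc
  obtain ⟨ψ, hψ⟩ := exists_algHom_fractionRing _ _ hζ
  have hθ := fun G => aeval_coord_eq_zero_iff (I := idealOf prodReps (conormal X n m)) (F := G)
  have hθj : coord (idealOf prodReps (conormal X n m)) (Sum.inl j) ≠ 0 := by
    rw [← aeval_X (R := k) (coord _) (Sum.inl j), Ne, hθ]
    exact J.X_pivot_notMem hcard hj
  have hθ₀ : coord (idealOf prodReps (conormal X n m)) (Sum.inr l₀) ≠ 0 := by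
    rw [← aeval_X (R := k) (coord _) (Sum.inr l₀), Ne, hθ, ← rename_X]
    exact fun h => hl₀ (J.mem_homIdeal_of_rename_mem hcard hj h)
  obtain ⟨β, e, g, A, hg, hA, hg₀, hrel, hvan, hdense⟩ := exists_linearFamily hθ rfl hθj hθ₀
    fun β hβ₀ hβ hspan => J.algebraicIndependent_coordinates hj hmN hξ hc hcsep hξ₀ _ ψ hψ _ rfl
      (IntermediateField.extendScalars (ratioField_mono (idealOf prodReps (conormal X n m))
        BothPlane.sameFactor)) (fun z => Iff.rfl) hsep β hβ₀ hβ hspan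
  exact J.exists_isOpen_contactLocus_eq hclosed hcard hj hprime hl₀ β hg hA hg₀ hrel hvan hdense
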